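/- **Setting.** Let $\mathbf H^2$ be the oriented hyperbolic plane. An oriented geodesic is a pair $g=(g^-,g^+)$ of distinct points of $\partial_\infty\mathbf H^2$; a pair $(x,x)$ is a *phantom* geodesic. The intersection number $\epsilon(g_0,g_1)\in\{0,\pm\frac12,\pm1\}$ is antisymmetric, changes sign when $g_0$ is reversed, is $1$ if $(g_0^+,g_1^+,g_0^-,g_1^-)$ is positively oriented, is $\frac12$ if $g_0^-=g_1^-$ and $(g_0^+,g_1^+,g_1^-)$ is positively oriented, and is $0$ if $g_0,g_1$ do not meet (even at infinity), if $g_0=g_1$, or if one of them is phantom. Fix a smooth $f:[0,\infty)\to[0,1]$ equal to $\frac12$ on $[0,\frac12]$ and supported in $[0,1]$, extended to an odd function. The geodesic form of $g$ is $\omega_g=-d(f\circ R_g)$ (extended by $0$ across $g$), where $R_g$ is the signed distance to $g$, positive on the right of $g$. Let $\Theta=(K_1<\dots<K_n)$, $1\le K_a<\dim V$, with $V$ a finite dimensional real vector space. A $\Theta$-uniformly hyperbolic bundle $\rho=(\nabla,h)$ is a trivialisable connection $\nabla$ and a frame $h$ on the trivial bundle with fibre $V$ over the unit tangent bundle $\mathsf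 U\mathbf H^2$, together with a decomposition $E_1\oplus\dots\oplus E_{n+1}$ invariant under the parallel transport $\Phi_s$ along the geodesic flow, such that for every $a$, with $L=E_1\oplus\dots\oplus E_a$ of dimension $K_a$, $P=E_{a+1}\oplus\dots\oplus E_{n+1}$, and the metric for which $h$ is orthonormal: $\|\Phi_1\|$ is bounded; there are $B,b>0$ with $\|\Phi_su\|/\|u\|\le Be^{-bs}\|\Phi_sv\|/\|v\|$ for $s>0$ and nonzero $u\in L_x$, $v\in P_x$; there is $\varepsilon>0$ with $|\langle u,v\rangle|\le(1-\varepsilon)\|u\|\|v\|$ for all limits $u,v\in E_x$ of vectors of $L_{x_m}$, $P_{y_m}$ with $x_m,y_m\to x$; and there is a volume form, bounded with respect to $h$ and parallel along the flow. For a geodesic $g$, $\mathrm p^a(g)\in\operatorname{End}(V)$ ($V$ being identified with the space of $\nabla$-parallel sections) is the projection on $L$ parallel to $P$ along $g$, and $\mathrm p^a(g)=\operatorname{Id}$ if $g$ is phantom. A $\Theta$-geodesic is a (non-phantom) geodesic $g$ with a label $a$; then $\mathrm p(g)=\mathrm p^a(g)$ and $\Theta_g=K_a$. For a tuple $l=(g_1,\dots,g_p)$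 of $\Theta$-geodesics put $\mathrm p(l)=\mathrm p(g_p)\cdots\mathrm p(g_1)$; the correlation function of the cyclically ordered configuration $\lceil g_1,\dots,g_p\rceil$ is $\mathsf T_{\lceil g_1,\dots,g_p\rceil}(\rho)=\operatorname{Tr}\mathrm p(l)$. A configuration $G=\lceil g_1,\dots,g_p\rceil$ of $\Theta$-geodesics with $p\ge2$ (indices mod $p$) has the ghost polygon $(\theta_1,\dots,\theta_{2p})$ with visible edges $\theta_{2i}=g_i$ and ghost edges $\theta_{2i+1}=\zeta_i=(g_{i+1}^-,g_i^+)$, possibly phantom. The opposite tuples are $g_i^*=(g_i,g_{i+1},\dots,g_{i-1},g_i)$ and $\zeta_i^*=(g_{i+1},g_{i+2},\dots,g_{i-1},g_i)$. Given a base point $x\in\mathbf H^2$ (for instance the barycentre of $G$, where it is defined), let $\eta_i$ be the polygonal arc which follows $g_{i+1}$ from $g_{i+1}^-$ to the projection of $x$ on $g_{i+1}$, goes to $x$, then to the projection of $x$ on $g_i$, and follows $g_i$ to $g_i^+$. Let $\omega_{\eta_i}$ be a smooth closed $1$-form supported in the $1$-neighbourhood of $\eta_i$ which outside some ball equals $\omega_{g_{i+1}}$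 along the initial ray plus $\omega_{g_i}$ along the final ray (each extended by $0$). The ghost dual form is $$\Omega_{\rho(G)}=\sum_{i=1}^p\big(\omega_{g_i}\,\mathrm p(g_i^*)-\omega_{\eta_i}\,\mathrm p(\zeta_i^*)\big).$$ For a $\Theta$-geodesic $h$ put $\beta_{\rho(h)}=\omega_h\,\mathrm p(h)$. With $\mathrm p_i=\mathrm p(g_i)$ and $\mathrm P_i=\mathrm p_{i-1}\cdots\mathrm p_{i+1}$, the ghost integral of a closed form $\alpha=dB$ is $$\oint_{\rho(G)}\alpha=\sum_{i=1}^p\Big(\operatorname{Tr}(B(x_i)[\mathrm p_i,\mathrm P_i])+\int_{x_i}^{g_i^+}\operatorname{Tr}(\mathrm P_i[\alpha,\mathrm p_i]\mathrm p_i)+\int_{x_i}^{g_i^-}\operatorname{Tr}(\mathrm P_i\mathrm p_i[\alpha,\mathrm p_i])\Big),\qquad x_i\in g_i ,$$ the integrals being taken along $g_i$. The ghost intersections are $$\mathsf I_\rho(G,H)=\int_{\mathbf H^2}\operatorname{Tr}(\Omega_{\rho(H)}\wedge\Omega_{\rho(G)}),\qquad \mathsf I_\rho(G,h)=-\int_{\mathbf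 H^2}\operatorname{Tr}(\beta_{\rho(h)}\wedge\Omega_{\rho(G)})=-\mathsf I_\rho(h,G).$$ Let $\mathcal A$ be the real vector space freely generated by configurations of rank $\ge2$, $\Theta$-geodesics and an element $\boldsymbol 1$, with the bilinear bracket for which $\boldsymbol1$ is central and, for polygons $G,H$ with edges $(\theta_i)_{1\le i\le 2p}$, $(\sigma_j)_{1\le j\le 2m}$ and $\Theta$-geodesics $g,h$, $$[G,H]=\sum_{i,j}(-1)^{i+j}\epsilon(\sigma_j,\theta_i)\lceil\theta_i^*,\sigma_j^*\rceil,\quad [G,h]=-[h,G]=\sum_i(-1)^{i+1}\epsilon(h,\theta_i)\lceil h,\theta_i^*\rceil,\quad [g,h]=\epsilon(h,g)(\lceil h,g\rceil-\Theta_h\Theta_g\boldsymbol 1).$$ Extend $\mathsf T$ linearly to $\mathcal A$ by $\mathsf T_g(\rho)=\operatorname{Tr}\mathrm p(g)$ and $\mathsf T_{\boldsymbol 1}(\rho)=1/\dim V$. **Statement.** Let $\rho$ be a $\Theta$-uniformly hyperbolic bundle, $G,H$ configurations of $\Theta$-geodesics of ranks $p,m\ge2$, and $h$ a $\Theta$-geodesic.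 For all base points, forms $\omega_{\eta_i}$ as above exist, and for every choice of them the integrands defining $\mathsf I_\rho(G,H)$ and $\mathsf I_\rho(G,h)$ are integrable on $\mathbf H^2$, the coefficients of $\Omega_{\rho(G)},\Omega_{\rho(H)},\beta_{\rho(h)}$ are integrable along all geodesics, $\Omega_{\rho(H)}$ and $\beta_{\rho(h)}$ have primitives, and for all primitives and all points $x_i\in g_i$ used to compute the ghost integrals, $$\mathsf I_\rho(G,H)=\oint_{\rho(G)}\Omega_{\rho(H)}=\mathsf T_{[G,H]}(\rho)=\sum_{i=1}^{2p}\sum_{j=1}^{2m}(-1)^{i+j}\epsilon(\sigma_j,\theta_i)\,\mathsf T_{\lceil\sigma_j^*,\theta_i^*\rceil}(\rho),$$ $$\mathsf I_\rho(G,h)=-\oint_{\rho(G)}\beta_{\rho(h)}=-\int_h\operatorname{Tr}(\Omega_{\rho(G)}\mathrm p(h))=\mathsf T_{[G,h]}(\rho)=\sum_{i=1}^{2p}(-1)^{i+1}\epsilon(h,\theta_i)\,\mathsf T_{\lceil h,\theta_i^*\rceil}(\rho),$$ and $\mathsf I_\rho(h,G)=\mathsf T_{[h,G]}(\rho)$.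 In the projective case $\Theta=\{1\}$, if moreover the metrics of the bundle at unit vectors whose base points are at distance at most $1$ are uniformly comparable (for instance if the frame is the pull-back of a frame over $\mathbf H^2$, or if $\rho$ is periodic), then $$\mathsf I_\rho(G,H)=\mathsf T_G(\rho)\mathsf T_H(\rho)\sum_{i,j}(-1)^{i+j}\epsilon(\sigma_j,\theta_i)\operatorname{Tr}(\mathrm p(\theta_i)\mathrm p(\sigma_j)),\qquad \mathsf I_\rho(G,h)=\mathsf T_G(\rho)\sum_i(-1)^{i+1}\epsilon(h,\theta_i)\operatorname{Tr}(\mathrm p(\theta_i)\mathrm p(h)).$$ -/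

import Mathlib

open Set Filter Topology MeasureTheory Module
open scoped UpperHalfPlane

noncomputable section

namespace Ghost

/-! ### The hyperbolic plane, its boundary, geodesics

The hyperbolic plane is the upper half-plane `ℍ`, oriented by `dx ∧ dy`; its boundary at infinity
is the oriented circle `OnePoint ℝ`. -/

/-- The linear order on the boundary for which `∞` is the largest element. -/
def bdryLT : OnePoint ℝ → OnePoint ℝ → Prop
  | OnePoint.some a, OnePoint.some b => a < b
  | OnePoint.some _, OnePoint.infty => True
  | OnePoint.infty, _ => False

/-- `(x, y, z)` is a positively oriented triple of distinct points of the boundary circle. -/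
def PosOriented (x y z : OnePoint ℝ) : Prop :=
  (bdryLT x y ∧ bdryLT y z) ∨ (bdryLT y z ∧ bdryLT z x) ∨ (bdryLT z x ∧ bdryLT x y)

open Classical in
/-- `1`, `-1` or `0` when the triple is positively oriented, negatively oriented, or has
a repetition. -/
def orient (x y z : OnePoint ℝ) : ℝ :=
  if PosOriented x y z then 1 else if PosOriented z y x then -1 else 0

/-- An oriented geodesic of `ℍ`, as the pair `(g⁻, g⁺)` of its distinct endpoints. -/
abbrev Geodesic : Type := {q : OnePoint ℝ × OnePoint ℝ // q.1 ≠ q.2}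

/-- The (algebraic) intersection number `ε(g₀, g₁)` of two pairs of boundary points, that is of two
oriented geodesics, possibly phantom. The lemmas below give the rules that characterise it. -/
def eps (g₀ g₁ : OnePoint ℝ × OnePoint ℝ) : ℝ :=
  (orient g₀.2 g₁.2 g₁.1 - orient g₀.1 g₁.2 g₁.1) / 2

lemma not_bdryLT_self (x : OnePoint ℝ) : ¬ bdryLT x x := by
  cases x using OnePoint.rec <;> simp [bdryLT]

lemma bdryLT_trans {x y z : OnePoint ℝ} : bdryLT x y → bdryLT y z → bdryLT x z := by
  cases x using OnePoint.rec <;> cases y using OnePoint.rec <;> cases z using OnePoint.rec <;>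
    simp [bdryLT]
  exact lt_trans

lemma bdryLT_total (x y : OnePoint ℝ) : bdryLT x y ∨ x = y ∨ bdryLT y x := by
  cases x using OnePoint.rec <;> cases y using OnePoint.rec <;> simp [bdryLT]
  exact lt_trichotomy _ _

lemma PosOriented.rotate {x y z : OnePoint ℝ} (h : PosOriented x y z) : PosOriented y z x := by
  unfold PosOriented at *; tauto

lemma PosOriented.not_swap {x y z : OnePoint ℝ} (h : PosOriented x y z) : ¬ PosOriented z y x := by
  have t := @bdryLT_trans
  have s := not_bdryLT_self
  unfold PosOriented at *
  rintro h'
  rcases h with ⟨h1, h2⟩ | ⟨h1, h2⟩ | ⟨h1, h2⟩ <;>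
    rcases h' with ⟨h3, h4⟩ | ⟨h3, h4⟩ | ⟨h3, h4⟩ <;>
    first
      | exact s _ (t h1 h3) | exact s _ (t h1 h4) | exact s _ (t h2 h3) | exact s _ (t h2 h4)

lemma orient_pos {x y z : OnePoint ℝ} (h : PosOriented x y z) : orient x y z = 1 := by
  simp [orient, h]

lemma orient_neg {x y z : OnePoint ℝ} (h : PosOriented z y x) : orient x y z = -1 := by
  simp [orient, h, h.not_swap]

lemma orient_swap (x y z : OnePoint ℝ) : orient z y x = - orient x y z := by
  by_cases h : PosOriented x y z
  · rw [orient_neg h, orient_pos h]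
  · by_cases h' : PosOriented z y x
    · rw [orient_neg h', orient_pos h']; norm_num
    · simp [orient, h, h']

lemma orient_rotate (x y z : OnePoint ℝ) : orient y z x = orient x y z := by
  by_cases h : PosOriented x y z
  · rw [orient_pos h, orient_pos h.rotate]
  · by_cases h' : PosOriented z y x
    · rw [orient_neg h', orient_neg h'.rotate.rotate]
    · have h1 : ¬ PosOriented y z x := fun k => h k.rotate.rotate
      have h2 : ¬ PosOriented x z y := fun k => h' k.rotate
      simp [orient, h, h', h1, h2]

lemma orient_self_left (x y : OnePoint ℝ) : orient x x y = 0 := by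
  have h := orient_swap x x y
  have h1 := orient_rotate y x x
  linarith

lemma orient_cocycle (a b c d : OnePoint ℝ) :
    orient b c d - orient a c d + orient a b d - orient a b c = 0 := by
  have t := @bdryLT_trans
  have s := not_bdryLT_self
  have h1 := bdryLT_total a b
  have h2 := bdryLT_total a c
  have h3 := bdryLT_total a d
  have h4 := bdryLT_total b c
  have h5 := bdryLT_total b d
  have h6 := bdryLT_total c d
  unfold orient PosOriented
  grind

/-- The intersection number is antisymmetric. -/
lemma eps_antisymm (g₀ g₁ : OnePoint ℝ × OnePoint ℝ) : eps g₀ g₁ = - eps g₁ g₀ := by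
  obtain ⟨a, b⟩ := g₀
  obtain ⟨c, d⟩ := g₁
  have h1 := orient_cocycle a b c d
  have h2 := orient_swap b c d
  have h3 := orient_swap a c d
  have h4 := orient_swap a b d
  have h5 := orient_swap a b c
  have e1 := orient_rotate d c b
  have e2 := orient_rotate c b d
  have e3 := orient_rotate b d c
  have e4 := orient_rotate a d c
  have e5 := orient_rotate d c a
  have e6 := orient_rotate c a d
  simp only [eps]
  linarith

/-- Reversing the first geodesic changes the sign. -/
lemma eps_reverse (a b : OnePoint ℝ) (g : OnePoint ℝ × OnePoint ℝ) :
    eps (b, a) g = - eps (a, b) g := by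
  simp only [eps]; ring

/-- The intersection number vanishes when the first geodesic is phantom. -/
lemma eps_phantom_left (a : OnePoint ℝ) (g : OnePoint ℝ × OnePoint ℝ) : eps (a, a) g = 0 := by
  simp [eps]

/-- The intersection number vanishes when the second geodesic is phantom. -/
lemma eps_phantom_right (a : OnePoint ℝ) (g : OnePoint ℝ × OnePoint ℝ) : eps g (a, a) = 0 := by
  simp only [eps]
  rw [← orient_rotate, ← orient_rotate g.1, orient_self_left, orient_self_left]; norm_num

/-- The intersection number is `1` when `(g₀⁺, g₁⁺, g₀⁻, g₁⁻)` is positively oriented. -/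
lemma eps_eq_one (g₀ g₁ : OnePoint ℝ × OnePoint ℝ) (h : PosOriented g₀.2 g₁.2 g₁.1)
    (h' : PosOriented g₁.2 g₀.1 g₁.1) : eps g₀ g₁ = 1 := by
  have h2 : PosOriented g₁.1 g₁.2 g₀.1 := h'.rotate.rotate
  rw [eps, orient_pos h, orient_neg h2]; norm_num

/-- The intersection number is `1/2` when `g₀⁻ = g₁⁻` and `(g₀⁺, g₁⁺, g₁⁻)` is positively
oriented. -/
lemma eps_eq_half (a b c : OnePoint ℝ) (h : PosOriented a b c) : eps (c, a) (c, b) = 1 / 2 := by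
  have : orient c b c = 0 := by rw [← orient_rotate, ← orient_rotate, orient_self_left]
  simp [eps, orient_pos h, this]

/-- Geodesics that do not meet, even at infinity, have intersection number `0`. -/
lemma eps_eq_zero (g₀ g₁ : OnePoint ℝ × OnePoint ℝ)
    (h : PosOriented g₀.2 g₁.2 g₁.1 ↔ PosOriented g₀.1 g₁.2 g₁.1)
    (h' : PosOriented g₁.1 g₁.2 g₀.2 ↔ PosOriented g₁.1 g₁.2 g₀.1) : eps g₀ g₁ = 0 := by
  have e : orient g₀.2 g₁.2 g₁.1 = orient g₀.1 g₁.2 g₁.1 := by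
    unfold orient
    rw [propext h, propext h']
  rw [eps, e, sub_self, zero_div]

/-- The hyperbolic sine of the signed distance from `z` to the geodesic `(a, b)`; the sign is
positive on the right of the geodesic. -/
def sinhDist : OnePoint ℝ → OnePoint ℝ → ℂ → ℝ
  | OnePoint.some a, OnePoint.some b, z =>
      ((z.re - a) * (b - z.re) - z.im ^ 2) / (z.im * (b - a))
  | OnePoint.some a, OnePoint.infty, z => (z.re - a) / z.im
  | OnePoint.infty, OnePoint.some b, z => (b - z.re) / z.im
  | OnePoint.infty, OnePoint.infty, _ => 0

/-- The signed distance from `z` to the geodesic `g`. -/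
def Geodesic.signedDist (g : Geodesic) (z : ℂ) : ℝ := Real.arsinh (sinhDist g.1.1 g.1.2 z)

/-- Unit speed parametrisation of the geodesic `(a, b)`. -/
def pointC : OnePoint ℝ → OnePoint ℝ → ℝ → ℂ
  | OnePoint.some a, OnePoint.some b, t =>
      ⟨(a + b * Real.exp t ^ 2) / (1 + Real.exp t ^ 2),
        |b - a| * Real.exp t / (1 + Real.exp t ^ 2)⟩
  | OnePoint.some a, OnePoint.infty, t => ⟨a, Real.exp t⟩
  | OnePoint.infty, OnePoint.some b, t => ⟨b, Real.exp (-t)⟩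
  | OnePoint.infty, OnePoint.infty, _ => Complex.I

lemma pointC_im_pos {a b : OnePoint ℝ} (h : a ≠ b) (t : ℝ) : 0 < (pointC a b t).im := by
  cases a using OnePoint.rec with
  | infty => cases b using OnePoint.rec with
    | infty => exact absurd rfl h
    | coe b => exact Real.exp_pos _
  | coe a => cases b using OnePoint.rec with
    | infty => exact Real.exp_pos _
    | coe b =>
      have hab : b - a ≠ 0 := fun k => h (by rw [sub_eq_zero.1 k])
      have := abs_pos.2 hab
      change 0 < |b - a| * Real.exp t / (1 + Real.exp t ^ 2)
      positivity

/-- The point of `g` at time `t`; it runs from `g⁻` to `g⁺` at unit speed. -/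
def Geodesic.point (g : Geodesic) (t : ℝ) : ℍ := ⟨pointC g.1.1 g.1.2 t, pointC_im_pos g.2 t⟩

/-- The time `t` at which `g.point t` is the orthogonal projection on the geodesic of `z`. -/
def posC : OnePoint ℝ → OnePoint ℝ → ℂ → ℝ
  | OnePoint.some a, OnePoint.some b, z => Real.log (‖z - a‖ / ‖z - b‖)
  | OnePoint.some a, OnePoint.infty, z => Real.log ‖z - a‖
  | OnePoint.infty, OnePoint.some b, z => - Real.log ‖z - b‖
  | OnePoint.infty, OnePoint.infty, _ => 0

/-- The time `t` at which `g.point t` is the orthogonal projection of `z` on `g`. -/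
def Geodesic.pos (g : Geodesic) (z : ℂ) : ℝ := posC g.1.1 g.1.2 z

/-- The velocity of `g` at time `t`, as a tangent vector of the upper half-plane. -/
def Geodesic.velocity (g : Geodesic) (t : ℝ) : ℂ := deriv (fun s => (g.point s : ℂ)) t

/-! ### Geodesic forms and dual forms of polygonal arcs

A 1-form on the hyperbolic plane is a function on `ℂ` with values in the real linear forms on `ℂ`,
of which only the restriction to the upper half-plane matters. -/

abbrev Form : Type := ℂ → ℂ →L[ℝ] ℝ

/-- The profile `f` used to build geodesic forms: a smooth function on `[0, ∞)` with values in
`[0, 1]`, equal to `1/2` on `[0, 1/2]` and supported in `[0, 1]`. -/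
structure CutoffProfile where
  toFun : ℝ → ℝ
  smooth : ContDiff ℝ (⊤ : ℕ∞) toFun
  mem_Icc : ∀ r, 0 ≤ r → toFun r ∈ Icc (0 : ℝ) 1
  eq_half : ∀ r ∈ Icc (0 : ℝ) (1 / 2), toFun r = 1 / 2
  eq_zero : ∀ r, 1 ≤ r → toFun r = 0

/-- The geodesic form `ω_g = - d (f ∘ R_g)`, where `R_g` is the signed distance to `g` and `f` is
extended to an odd function on the line. The extension has derivative `f' |r|` at `r ≠ 0`, and the
form vanishes near `g`, where `f ∘ R_g` is locally constant on each side. -/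
def geodesicForm (f : CutoffProfile) (g : Geodesic) : Form := fun z =>
  -(deriv f.toFun |g.signedDist z|) • fderiv ℝ g.signedDist z

/-- The geodesic segment between two points. -/
def hypSegment (p q : ℍ) : Set ℍ := {w | dist p w + dist w q = dist p q}

/-- The orthogonal projection of `x` on the geodesic `g`. -/
def Geodesic.foot (g : Geodesic) (x : ℍ) : ℍ := g.point (g.pos x)

/-- The polygonal arc which goes from `g'⁻` to the projection of `x` on `g'` along `g'`, from there
to `x`, then to the projection of `x` on `g`, and finally to `g⁺` along `g`. -/
def polygonalArc (x : ℍ) (g' g : Geodesic) : Set ℍ :=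
  g'.point '' Iic (g'.pos x) ∪ hypSegment (g'.foot x) x ∪ hypSegment x (g.foot x) ∪
    g.point '' Ici (g.pos x)

/-- The 1-form `ω` is a polygonal arc form for the above polygonal arc: it is a smooth closed form,
it is supported in the 1-neighbourhood of the arc, and outside some ball it coincides with the
geodesic form of `g'` along the initial ray and with the geodesic form of `g` along the final
ray. -/
structure IsPolygonalArcForm (f : CutoffProfile) (x : ℍ) (g' g : Geodesic) (ω : Form) : Prop where
  smooth : ContDiffOn ℝ (⊤ : ℕ∞) ω {z : ℂ | 0 < z.im}
  closed : ∀ (z : ℍ) (u v : ℂ), fderiv ℝ ω z u v = fderiv ℝ ω z v u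
  support : ∀ z : ℍ, (∀ w ∈ polygonalArc x g' g, 1 < dist z w) → ω z = 0
  ends : ∃ R : ℝ, ∀ z : ℍ, R < dist x z →
    ω z = (if g'.pos z < g'.pos x then geodesicForm f g' z else 0) +
      (if g.pos x < g.pos z then geodesicForm f g z else 0)

/-! ### Configurations of decorated geodesics and ghost polygons -/

/-- A geodesic labelled by an element of `Θ = (K₁, …, K_n)`. -/
structure ThetaGeodesic (n : ℕ) where
  geod : Geodesic
  label : Fin n

/-- An edge of a ghost polygon: a geodesic, possibly phantom, with its opposite configuration,
which is a nonempty tuple. -/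
structure Edge (n : ℕ) where
  ends : OnePoint ℝ × OnePoint ℝ
  opp : List (ThetaGeodesic n)
  opp_ne : opp ≠ []

/-- The tuple `(g_i, g_{i+1}, …, g_{i-1})`. -/
def rot {n p : ℕ} (g : Fin p → ThetaGeodesic n) (i : Fin p) : List (ThetaGeodesic n) :=
  List.ofFn fun k : Fin p => g (i + k)

lemma rot_ne {n p : ℕ} [NeZero p] (g : Fin p → ThetaGeodesic n) (i : Fin p) : rot g i ≠ [] := by
  simp [rot, List.ofFn_eq_nil_iff, NeZero.ne p]

/-- The visible edge `g_i`, whose opposite is `(g_i, g_{i+1}, …, g_{i-1}, g_i)`. -/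
def visibleEdge {n p : ℕ} (g : Fin p → ThetaGeodesic n) (i : Fin p) : Edge n where
  ends := (g i).geod.1
  opp := rot g i ++ [g i]
  opp_ne := by simp

/-- The ghost edge `ζ_i = (g_{i+1}⁻, g_i⁺)`, whose opposite is `(g_{i+1}, …, g_{i-1}, g_i)`. -/
def ghostEdge {n p : ℕ} [NeZero p] (g : Fin p → ThetaGeodesic n) (i : Fin p) : Edge n where
  ends := ((g (i + 1)).geod.1.1, (g i).geod.1.2)
  opp := rot g (i + 1)
  opp_ne := rot_ne g _

/-- The ghost polygon `(θ_k)` of the configuration `(g_i)`, with `θ_{2i} = g_i` and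
`θ_{2i+1} = ζ_i`, indices of the `g_i` being modulo `p`. -/
def ghostPolygon {n p : ℕ} [NeZero p] (g : Fin p → ThetaGeodesic n) (k : ℕ) : Edge n :=
  if Even k then visibleEdge g (Fin.ofNat p (k / 2)) else ghostEdge g (Fin.ofNat p (k / 2))

/-! ### The ghost algebra -/

/-- The generators: the Casimir element, the decorated geodesics, and the configurations
(cyclically ordered) of rank at least 2, that is the ghost polygons. -/
inductive Generator (n : ℕ) where
  | casimir : Generator n
  | geodesic (g : ThetaGeodesic n) : Generator n
  | polygon (c : {c : Cycle (ThetaGeodesic n) // 2 ≤ c.length}) : Generator n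

/-- The vector space freely spanned by the generators. -/
abbrev GhostSpace (n : ℕ) : Type := Generator n →₀ ℝ

/-- The basis element `⌈g_1, …, g_p⌉` given by a tuple with `p ≥ 2`. -/
def config {n : ℕ} (l : List (ThetaGeodesic n)) (h : 2 ≤ l.length) : GhostSpace n :=
  Finsupp.single (Generator.polygon ⟨(l : Cycle (ThetaGeodesic n)), h⟩) 1

/-- A decorated geodesic as an element of the ghost algebra. -/
def ofGeodesic {n : ℕ} (g : ThetaGeodesic n) : GhostSpace n :=
  Finsupp.single (Generator.geodesic g) 1

/-- The configuration of the `g i` as an element of the ghost algebra. -/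
def ofTuple {n p : ℕ} (hp : 2 ≤ p) (g : Fin p → ThetaGeodesic n) : GhostSpace n :=
  config (List.ofFn g) (by simpa using hp)

/-- The two edges attached to a representative `(g_1, …, g_p)` of a cyclically ordered
configuration: the visible edge `g_1`, with sign `+1` and opposite `(g_1, …, g_p, g_1)`, and the
ghost edge `(g_1⁻, g_p⁺)`, with sign `-1` and opposite `(g_1, …, g_p)`. -/
def edgesOfList {n : ℕ} : List (ThetaGeodesic n) → Multiset (ℝ × Edge n)
  | [] => 0
  | g :: l =>
    {(1, ⟨g.geod.1, (g :: l) ++ [g], by simp⟩),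
      (-1, ⟨(g.geod.1.1, ((g :: l).getLast (by simp)).geod.1.2), g :: l, by simp⟩)}

/-- The edges `θ_k` of the ghost polygon of a cyclically ordered configuration, with their signs
`(-1)^k`; all the representatives of the configuration are used. -/
def signedEdges {n : ℕ} (c : Cycle (ThetaGeodesic n)) : Multiset (ℝ × Edge n) :=
  c.lists.bind edgesOfList

/-- `⌈θ*, σ*⌉` -/
def joinEdges {n : ℕ} (θ σ : Edge n) : GhostSpace n :=
  config (θ.opp ++ σ.opp) (by
    have h1 := List.length_pos_of_ne_nil θ.opp_ne
    have h2 := List.length_pos_of_ne_nil σ.opp_ne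
    rw [List.length_append]; omega)

/-- `⌈h, θ*⌉` -/
def joinGeodesicEdge {n : ℕ} (h : ThetaGeodesic n) (θ : Edge n) : GhostSpace n :=
  config (h :: θ.opp) (by
    have h1 := List.length_pos_of_ne_nil θ.opp_ne
    rw [List.length_cons]; omega)

/-- `[G, h]` for a polygon and a geodesic. -/
def bracketPolygonGeodesic {n : ℕ} (G : Cycle (ThetaGeodesic n)) (h : ThetaGeodesic n) :
    GhostSpace n :=
  ((signedEdges G).map fun θ => (-θ.1 * eps h.geod.1 θ.2.ends) • joinGeodesicEdge h θ.2).sum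

/-- The ghost bracket on the generators. -/
def bracketGen {n : ℕ} (K : Fin n → ℕ) : Generator n → Generator n → GhostSpace n
  | .casimir, _ => 0
  | _, .casimir => 0
  | .polygon G, .polygon H =>
      ((signedEdges G.1 ×ˢ signedEdges H.1).map fun q =>
        (eps q.2.2.ends q.1.2.ends * (q.1.1 * q.2.1)) • joinEdges q.1.2 q.2.2).sum
  | .polygon G, .geodesic h => bracketPolygonGeodesic G.1 h
  | .geodesic h, .polygon G => -bracketPolygonGeodesic G.1 h
  | .geodesic g, .geodesic h =>
      eps h.geod.1 g.geod.1 • (config [h, g] (by simp) -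
        Finsupp.single Generator.casimir ((K h.label : ℝ) * K g.label))

/-- The ghost bracket, extended bilinearly from the generators. -/
def ghostBracket {n : ℕ} (K : Fin n → ℕ) (A B : GhostSpace n) : GhostSpace n :=
  A.sum fun G a => B.sum fun H b => (a * b) • bracketGen K G H

/-! ### Uniformly hyperbolic bundles -/

/-- The unit tangent bundle: a unit tangent vector is an oriented geodesic with a point on it. -/
abbrev UnitTangent : Type := {q : Geodesic × ℍ // ∃ t, q.1.point t = q.2}

/-- The tangent vector to `g` at time `t`. -/
def unitVector (g : Geodesic) (t : ℝ) : UnitTangent := ⟨(g, g.point t), t, rfl⟩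

/-- The geodesic flow. -/
def flow (s : ℝ) (x : UnitTangent) : UnitTangent := unitVector x.1.1 (x.1.1.pos x.1.2 + s)

/-- The trace of an endomorphism of `V`. -/
def tr {V : Type*} [NormedAddCommGroup V] [NormedSpace ℝ V] (A : V →L[ℝ] V) : ℝ := LinearMap.trace ℝ V A

lemma tr_mul_comm {V : Type*} [NormedAddCommGroup V] [NormedSpace ℝ V] (A B : V →L[ℝ] V) :
    tr (A * B) = tr (B * A) :=
  LinearMap.trace_mul_comm ℝ (A : V →ₗ[ℝ] V) (B : V →ₗ[ℝ] V)

section Bundle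

variable {V : Type*} [NormedAddCommGroup V] [NormedSpace ℝ V] [FiniteDimensional ℝ V]

/-- The scalar product at `x` for which the frame is orthonormal. -/
def frameInner (h : UnitTangent → Basis (Fin (finrank ℝ V)) ℝ V) (x : UnitTangent) (u v : V) : ℝ :=
  ∑ i, (h x).repr u i * (h x).repr v i

/-- The norm at `x` for which the frame is orthonormal. -/
def frameNorm (h : UnitTangent → Basis (Fin (finrank ℝ V)) ℝ V) (x : UnitTangent) (v : V) : ℝ :=
  √(frameInner h x v v)

/-- Uniformly hyperbolic bundles of rank `k`. The bundle is written in a trivialisation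
`V × UnitTangent` in which the (trivialisable) connection is the trivial one, so that parallel
transport along the geodesic flow is the identity of `V`; the remaining datum is the frame `h`.
The norm of `V` is only used for its topology. -/
structure IsUniformlyHyperbolic (h : UnitTangent → Basis (Fin (finrank ℝ V)) ℝ V)
    (L P : UnitTangent → Submodule ℝ V) (k : ℕ) : Prop where
  continuous_frame : ∀ i, Continuous fun x => h x i
  bounded_cocycle : ∃ C : ℝ, ∀ x v, frameNorm h (flow 1 x) v ≤ C * frameNorm h x v
  isCompl : ∀ x, IsCompl (L x) (P x)
  finrank_eq : ∀ x, finrank ℝ (L x) = k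
  invariant_L : ∀ s x, L (flow s x) = L x
  invariant_P : ∀ s x, P (flow s x) = P x
  contracting : ∃ B > 0, ∃ b > 0, ∀ s > 0, ∀ x, ∀ u ∈ L x, ∀ v ∈ P x, u ≠ 0 → v ≠ 0 →
    frameNorm h (flow s x) u / frameNorm h x u ≤
      B * Real.exp (-b * s) * (frameNorm h (flow s x) v / frameNorm h x v)
  transverse : ∃ ε > 0, ∀ (x : UnitTangent) (xs ys : ℕ → UnitTangent) (us vs : ℕ → V) (u v : V),
    Tendsto xs atTop (𝓝 x) → Tendsto ys atTop (𝓝 x) → Tendsto us atTop (𝓝 u) →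
    Tendsto vs atTop (𝓝 v) → (∀ m, us m ∈ L (xs m)) → (∀ m, vs m ∈ P (ys m)) →
    |frameInner h x u v| ≤ (1 - ε) * (frameNorm h x u * frameNorm h x v)
  volume : ∃ vol : UnitTangent → V [⋀^Fin (finrank ℝ V)]→ₗ[ℝ] ℝ,
    (∀ x, vol x ≠ 0) ∧ (∀ s x, vol (flow s x) = vol x) ∧ ∃ C : ℝ, ∀ x, |vol x (h x)| ≤ C

variable (V) in
/-- A `Θ`-uniformly hyperbolic bundle, for `Θ = (K₁ < … < K_n)`: an invariant decomposition
`E_1 ⊕ … ⊕ E_{n+1}` such that for all `a` the bundle is uniformly hyperbolic of rank `K_a` for the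
decomposition `(E_1 ⊕ … ⊕ E_a) ⊕ (E_{a+1} ⊕ … ⊕ E_{n+1})`. -/
structure UniformlyHyperbolicBundle {n : ℕ} (K : Fin n → ℕ) where
  strictMono : StrictMono K
  one_le : ∀ a, 1 ≤ K a
  lt_dim : ∀ a, K a < finrank ℝ V
  frame : UnitTangent → Basis (Fin (finrank ℝ V)) ℝ V
  E : Fin (n + 1) → UnitTangent → Submodule ℝ V
  isInternal : ∀ x, DirectSum.IsInternal fun b => E b x
  invariant : ∀ b s x, E b (flow s x) = E b x
  hyperbolic : ∀ a : Fin n, IsUniformlyHyperbolic frame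
    (fun x => ⨆ b, ⨆ _ : b ≤ a.castSucc, E b x) (fun x => ⨆ b, ⨆ _ : a.castSucc < b, E b x) (K a)

namespace UniformlyHyperbolicBundle

variable {n : ℕ} {K : Fin n → ℕ} (ρ : UniformlyHyperbolicBundle V K)

/-- The fundamental projector `p^a(g)`, on `E_1 ⊕ … ⊕ E_a` parallel to
`E_{a+1} ⊕ … ⊕ E_{n+1}`, at any point of the geodesic `g`. -/
def proj (a : Fin n) (g : Geodesic) : V →L[ℝ] V :=
  LinearMap.toContinuousLinearMap
    (Submodule.projection _ _ ((ρ.hyperbolic a).isCompl (unitVector g 0)))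

open Classical in
/-- The fundamental projector of a possibly phantom geodesic, with the convention that it is the
identity for phantom geodesics. -/
def edgeProj (a : Fin n) (e : OnePoint ℝ × OnePoint ℝ) : V →L[ℝ] V :=
  if h : e.1 ≠ e.2 then ρ.proj a ⟨e, h⟩ else 1

/-- The fundamental projector `p(g)` of a decorated geodesic. -/
def thetaProj (g : ThetaGeodesic n) : V →L[ℝ] V := ρ.proj g.label g.geod

/-- The product `p(g_p) ⋯ p(g_1)` attached to a tuple `(g_1, …, g_p)`. -/
def listProj (l : List (ThetaGeodesic n)) : V →L[ℝ] V := (l.map ρ.thetaProj).reverse.prod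

lemma tr_listProj_rotate (l : List (ThetaGeodesic n)) (k : ℕ) :
    tr (ρ.listProj (l.rotate k)) = tr (ρ.listProj l) := by
  induction k generalizing l with
  | zero => simp
  | succ k ih =>
    cases l with
    | nil => simp
    | cons g l =>
      rw [List.rotate_cons_succ, ih]
      simp only [listProj, List.map_append, List.map_cons, List.map_nil, List.reverse_append,
        List.reverse_cons, List.reverse_nil, List.nil_append, List.singleton_append,
        List.prod_cons, List.prod_append, List.prod_nil, mul_one]
      exact tr_mul_comm _ _

/-- The correlation function `T_⌈g_1, …, g_p⌉ (ρ) = Tr (p(g_p) ⋯ p(g_1))`. -/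
def correlation (c : Cycle (ThetaGeodesic n)) : ℝ :=
  Quotient.liftOn' c (fun l => tr (ρ.listProj l)) fun l _ h => by
    obtain ⟨k, rfl⟩ := h
    exact (ρ.tr_listProj_rotate l k).symm

/-- The correlation function on generators, with value `1 / dim V` on the Casimir element. -/
def correlationGen : Generator n → ℝ
  | .casimir => 1 / (finrank ℝ V : ℝ)
  | .geodesic g => tr (ρ.thetaProj g)
  | .polygon c => ρ.correlation c.1

/-- The linear extension of the correlation functions to the ghost algebra. -/
def T (A : GhostSpace n) : ℝ := A.sum fun G a => a * ρ.correlationGen G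

/-- The metrics of the bundle at unit tangent vectors whose base points are at distance at most `1`
are uniformly comparable (through the trivialisation given by the connection). -/
def HasComparableMetrics : Prop :=
  ∃ C : ℝ, ∀ x y : UnitTangent, dist x.1.2 y.1.2 ≤ 1 → ∀ v : V,
    frameNorm ρ.frame x v ≤ C * frameNorm ρ.frame y v

end UniformlyHyperbolicBundle

/-! ### Ghost dual forms, ghost integration, ghost intersection -/

variable (V) in
/-- The 1-forms with values in the endomorphisms of `V`. -/
abbrev EndForm : Type _ := ℂ → ℂ →L[ℝ] (V →L[ℝ] V)

/-- The function `F` such that `Tr (α ∧ β) = F dx ∧ dy`. -/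
def trWedge (α β : EndForm V) (z : ℂ) : ℝ :=
  tr (α z 1 * β z Complex.I) - tr (α z Complex.I * β z 1)

/-- `B` is a primitive of `α` on the hyperbolic plane. -/
def IsPrimitive (B : ℂ → V →L[ℝ] V) (α : EndForm V) : Prop := ∀ z : ℍ, HasFDerivAt B (α z) z

/-- The matrix coefficients of `α` are integrable along all geodesics. -/
def LineIntegrable (α : EndForm V) : Prop :=
  ∀ (g : Geodesic) (A : V →L[ℝ] V), Integrable fun t => tr (α (g.point t) (g.velocity t) * A)

/-- The line integration of `α` along `g` from the point `g.point t`: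
the integral of `Tr (Q [α, p] p)` from that point to `g⁺` plus the integral of `Tr (Q p [α, p])`
from that point to `g⁻`. -/
def lineIntegration (g : Geodesic) (t : ℝ) (p Q : V →L[ℝ] V) (α : EndForm V) : ℝ :=
  (∫ s in Ioi t, tr (Q * ⁅α (g.point s) (g.velocity s), p⁆ * p)) -
    ∫ s in Iio t, tr (Q * p * ⁅α (g.point s) (g.velocity s), p⁆)

/-- A choice of polygonal arc forms, one for each ghost edge `ζ_i = (g_{i+1}⁻, g_i⁺)`, for the
arcs from `g_{i+1}⁻` to `g_i⁺` that follow `g_{i+1}`, pass through the base point `x`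
and follow `g_i`. -/
structure ArcForms {n p : ℕ} [NeZero p] (f : CutoffProfile) (x : ℍ)
    (g : Fin p → ThetaGeodesic n) where
  form : Fin p → Form
  isArcForm : ∀ i, IsPolygonalArcForm f x (g (i + 1)).geod (g i).geod (form i)

namespace UniformlyHyperbolicBundle

variable {n : ℕ} {K : Fin n → ℕ} (ρ : UniformlyHyperbolicBundle V K)

/-- The projector form `β_h = ω_h p(h)`. -/
def projectorForm (f : CutoffProfile) (h : ThetaGeodesic n) : EndForm V := fun z =>
  (geodesicForm f h.geod z).smulRight (ρ.thetaProj h)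

variable {p m : ℕ} [NeZero p] [NeZero m] {f : CutoffProfile} {x y : ℍ}
  {G : Fin p → ThetaGeodesic n} {H : Fin m → ThetaGeodesic n}

/-- The ghost dual form
`Ω_{ρ(G)} = ∑ i, (ω_{g_i} p_G(g_i^*) - ω_{η_i} p_G(ζ_i^*))`. -/
def ghostDualForm (η : ArcForms f x G) : EndForm V := fun z =>
  ∑ i, ((geodesicForm f (G i).geod z).smulRight (ρ.listProj (visibleEdge G i).opp) -
    (η.form i z).smulRight (ρ.listProj (ghostEdge G i).opp))

/-- The product `P_i = p_{i-1} ⋯ p_{i+1}`. -/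
def othersProj (G : Fin p → ThetaGeodesic n) (i : Fin p) : V →L[ℝ] V :=
  ρ.listProj (rot G (i + 1)).dropLast

/-- The ghost integral of `α` with respect to `ρ(G)`, computed with a primitive `B` of `α`
and the base points `(G i).geod.point (t i)`. -/
def ghostIntegral (G : Fin p → ThetaGeodesic n) (α : EndForm V) (B : ℂ → V →L[ℝ] V)
    (t : Fin p → ℝ) : ℝ :=
  ∑ i, (tr (B ((G i).geod.point (t i)) * ⁅ρ.thetaProj (G i), ρ.othersProj G i⁆) +
    lineIntegration (G i).geod (t i) (ρ.thetaProj (G i)) (ρ.othersProj G i) α)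

/-- The ghost intersection of two ghost polygons: the integral over the hyperbolic plane of
`Tr (Ω_{ρ(H)} ∧ Ω_{ρ(G)})`. -/
def ghostIntersection (η : ArcForms f x G) (κ : ArcForms f y H) : ℝ :=
  ∫ z in {z : ℂ | 0 < z.im}, trWedge (ρ.ghostDualForm κ) (ρ.ghostDualForm η) z

/-- The ghost intersection of a ghost polygon and a geodesic: minus the integral over the hyperbolic
plane of `Tr (β_{ρ(h)} ∧ Ω_{ρ(G)})`. -/
def ghostIntersectionGeodesic (η : ArcForms f x G) (h : ThetaGeodesic n) : ℝ :=
  -∫ z in {z : ℂ | 0 < z.im}, trWedge (ρ.projectorForm f h) (ρ.ghostDualForm η) z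

end UniformlyHyperbolicBundle

end Bundle

end Ghost

end

open Ghost

noncomputable section

namespace Ghost

set_option linter.unusedSimpArgs false
set_option linter.unnecessarySeqFocus false

/-! Everything rests on one scalar fact. Let `α` and `β` be closed forms which far away look like
geodesic forms along rays, `α` running from `g'⁻` to `g⁺` and `β` from `h'⁻` to `h⁺`. Then the
integral of `α ∧ β` is `ε((g'⁻, g⁺), (h'⁻, h⁺))` (`HasGeodesicEnds.integral_wedge`). Geodesic forms
and polygonal arc forms are both of this kind, so a ghost dual form is a sum over the edges `θ` of a
form dual to `θ` times `± p(θ*)` (`IsEdgeSum`). Bilinearity then turns the ghost intersection into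
the double sum of the terms `± ε(σ, θ) Tr (p(θ*) p(σ*))`, and cyclicity of the trace identifies it
with the correlation function of the bracket.

For the scalar fact, write `α = dφ`, so that `α ∧ β = d(φ β)`. The primitive `φ` has a value `c a`
at every boundary point `a`, up to step functions across the geodesics ending at `a`
(`IsBoundaryValue`). Apart from a compactly supported part, which contributes nothing by Stokes'
theorem, `β` consists of two ends, each a cut-off geodesic form. In coordinates `(s, τ)` along a
geodesic its form is `k(s) ds`, with `k` even of integral `1`. The step terms become odd functions
of `s` as `τ` tends to infinity, so they integrate to `0` against `k` and an end only sees `c`: the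
integral is `c h'⁻ - c h⁺` (`integral_wedge_eq_boundary`). For a geodesic form `c` is known
explicitly; evaluating the integral of `α ∧ ω_γ` from either factor then gives the variation of `c`
for every `α` (`HasGeodesicEnds.boundaryValue_sub`).

The ghost integral uses the same boundary values. The fundamental theorem of calculus along each
`g_i` leaves only values at the ends, which regroup, edge by edge, into `Tr ((c θ⁺ - c θ⁻) p(θ*))`
(`ghostIntegral_eq`).

Arc forms are built from two angle functions around the base point, each cut along one half of the
arc with the cut smoothed out; the singular form at the base point cancels in their difference
(`exists_isPolygonalArcForm`).

In the projective case `p(θ*)` has the same range and kernel constraints as the rank one projector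
`p(θ)`, hence is `T_G p(θ)`. For ghost edges this requires that `L` depend only on `g⁺` and `P` only
on `g⁻`, which a domination argument deduces from the comparability of the metrics. -/

/-! ### Möbius transformations and charts adapted to a geodesic -/

/-- A real Möbius transformation preserving the upper half-plane. -/
structure Moebius where
  a : ℝ
  b : ℝ
  c : ℝ
  d : ℝ
  det_pos : 0 < a * d - b * c

namespace Moebius

variable (M N : Moebius)

def det : ℝ := M.a * M.d - M.b * M.c

def app (w : ℂ) : ℂ := (M.a * w + M.b) / (M.c * w + M.d)

def inv : Moebius := ⟨M.d, -M.b, -M.c, M.a, by have := M.det_pos; linarith⟩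

def mul : Moebius := ⟨M.a * N.a + M.b * N.c, M.a * N.b + M.b * N.d, M.c * N.a + M.d * N.c,
  M.c * N.b + M.d * N.d, by have := mul_pos M.det_pos N.det_pos; linarith⟩

lemma denom_ne {w : ℂ} (hw : 0 < w.im) : (M.c : ℂ) * w + M.d ≠ 0 := by
  intro h
  have h1 := congrArg Complex.im h
  have h2 := congrArg Complex.re h
  simp at h1 h2
  have := M.det_pos
  rcases h1 with h1 | h1
  · simp [h1] at h2; simp [h1, h2] at this
  · exact hw.ne' h1

lemma normSq_denom_pos {w : ℂ} (hw : 0 < w.im) : 0 < Complex.normSq (M.c * w + M.d) :=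
  Complex.normSq_pos.2 (M.denom_ne hw)

lemma im_app (w : ℂ) : (M.app w).im = M.det * w.im / Complex.normSq (M.c * w + M.d) := by
  simp only [app, Complex.div_im, det]
  simp [Complex.normSq_apply]
  ring

lemma re_app (w : ℂ) : (M.app w).re =
    (M.a * M.c * (w.re ^ 2 + w.im ^ 2) + (M.a * M.d + M.b * M.c) * w.re + M.b * M.d) /
      Complex.normSq (M.c * w + M.d) := by
  simp only [app, Complex.div_re]
  simp [Complex.normSq_apply]
  ring

lemma im_app_pos {w : ℂ} (hw : 0 < w.im) : 0 < (M.app w).im := by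
  rw [im_app]
  exact div_pos (mul_pos M.det_pos hw) (M.normSq_denom_pos hw)

lemma re_div_im_app {w : ℂ} (hw : 0 < w.im) : (M.app w).re / (M.app w).im =
    (M.a * M.c * (w.re ^ 2 + w.im ^ 2) + (M.a * M.d + M.b * M.c) * w.re + M.b * M.d) /
      (M.det * w.im) := by
  rw [im_app, re_app, div_div_div_cancel_right₀ (M.normSq_denom_pos hw).ne']

lemma mul_app {w : ℂ} (hw : 0 < w.im) : (M.mul N).app w = M.app (N.app w) := by
  have h1 := N.denom_ne hw
  have h2 := M.denom_ne (N.im_app_pos hw)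
  have h3 := (M.mul N).denom_ne hw
  simp only [app, mul] at *
  push_cast at *
  rw [div_eq_div_iff h3 h2]
  field_simp
  ring

lemma inv_app {w : ℂ} (hw : 0 < w.im) : M.inv.app (M.app w) = w := by
  have h1 := M.denom_ne hw
  have h2 := M.inv.denom_ne (M.im_app_pos hw)
  simp only [app, inv] at *
  rw [div_eq_iff h2]
  push_cast
  linear_combination div_mul_cancel₀ ((M.a : ℂ) * w + M.b) h1

lemma inv_inv : M.inv.inv = M := by simp [inv]

lemma app_inv {w : ℂ} (hw : 0 < w.im) : M.app (M.inv.app w) = w := by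
  have := M.inv.inv_app hw
  rwa [inv_inv] at this

/-- The action on the hyperbolic plane. -/
def act (w : ℍ) : ℍ := ⟨M.app w, M.im_app_pos w.im_pos⟩

@[simp] lemma coe_act (w : ℍ) : (M.act w : ℂ) = M.app w := rfl

lemma app_sub {z w : ℂ} (hz : 0 < z.im) (hw : 0 < w.im) : M.app z - M.app w =
    M.det * (z - w) / ((M.c * z + M.d) * (M.c * w + M.d)) := by
  have h1 := M.denom_ne hz
  have h2 := M.denom_ne hw
  simp only [app, det]
  rw [div_sub_div _ _ h1 h2]
  push_cast
  ring

/-- The hyperbolic cosine of the distance involves only `|z - w|² / (Im z Im w)`, whose numerator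
and denominator are multiplied by the same factor. -/
lemma dist_act (z w : ℍ) : dist (M.act z) (M.act w) = dist z w := by
  have h : Real.cosh (dist (M.act z) (M.act w)) = Real.cosh (dist z w) := by
    rw [UpperHalfPlane.cosh_dist, UpperHalfPlane.cosh_dist]
    have e1 : (M.act z).im = M.det * z.im / Complex.normSq (M.c * z + M.d) := M.im_app z
    have e2 : (M.act w).im = M.det * w.im / Complex.normSq (M.c * w + M.d) := M.im_app w
    have hz := M.normSq_denom_pos z.im_pos
    have hw := M.normSq_denom_pos w.im_pos
    have hd : 0 < M.det := M.det_pos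
    rw [e1, e2, Complex.dist_eq, Complex.dist_eq, coe_act, coe_act,
      M.app_sub z.im_pos w.im_pos, Complex.sq_norm, Complex.sq_norm, Complex.normSq_div,
      Complex.normSq_mul, Complex.normSq_mul, Complex.normSq_ofReal]
    have h1 := z.im_pos
    have h2 := w.im_pos
    set U := Complex.normSq (M.c * z + M.d)
    set V := Complex.normSq (M.c * w + M.d)
    field_simp
  have := Real.cosh_abs (dist z w) ▸ Real.cosh_abs (dist (M.act z) (M.act w)) ▸ h
  rw [← abs_of_nonneg (dist_nonneg (x := M.act z)), ← abs_of_nonneg (dist_nonneg (x := z))]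
  exact le_antisymm (Real.cosh_le_cosh.1 h.le) (Real.cosh_le_cosh.1 h.ge)

lemma inv_act (z : ℍ) : M.inv.act (M.act z) = z := by
  apply UpperHalfPlane.ext
  exact M.inv_app z.im_pos

lemma hasDerivAt_app {w : ℂ} (hw : 0 < w.im) :
    HasDerivAt M.app (M.det / (M.c * w + M.d) ^ 2) w := by
  have h1 := M.denom_ne hw
  have h2 : HasDerivAt (fun w : ℂ => (M.a : ℂ) * w + M.b) M.a w := by
    simpa using ((hasDerivAt_id w).const_mul (M.a : ℂ)).add_const (M.b : ℂ)
  have h3 : HasDerivAt (fun w : ℂ => (M.c : ℂ) * w + M.d) M.c w := by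
    simpa using ((hasDerivAt_id w).const_mul (M.c : ℂ)).add_const (M.d : ℂ)
  refine (h2.div h3 h1).congr_deriv ?_
  simp only [det]
  push_cast
  ring

lemma contDiffOn_app {n : WithTop ℕ∞} : ContDiffOn ℝ n M.app {z : ℂ | 0 < z.im} := by
  change ContDiffOn ℝ n (fun w : ℂ => (M.a * w + M.b) * (M.c * w + M.d)⁻¹) _
  apply ContDiffOn.mul
  · exact (contDiff_const.mul contDiff_id).add contDiff_const |>.contDiffOn
  · refine ContDiffOn.inv ?_ fun z hz => M.denom_ne hz
    exact (contDiff_const.mul contDiff_id).add contDiff_const |>.contDiffOn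

end Moebius

/-- The Möbius transformation which sends `0` to `g⁻` and `∞` to `g⁺`. -/
def chartOf : (a b : OnePoint ℝ) → a ≠ b → Moebius
  | OnePoint.some a, OnePoint.some b, h =>
      -- The columns represent `g⁺` and `g⁻`; the sign put on the second one makes the determinant
      -- `|b - a|`, and the normalisation sends `e^t i` to the point of time `t`.
      ⟨b, SignType.sign (b - a) * a, 1, SignType.sign (b - a), by
        have : b - a ≠ 0 := fun k => h (by rw [sub_eq_zero.1 k])
        have := abs_pos.2 this
        rw [← sign_mul_self] at this
        linarith⟩
  | OnePoint.some a, OnePoint.infty, _ => ⟨1, a, 0, 1, by norm_num⟩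
  | OnePoint.infty, OnePoint.some b, _ => ⟨b, -1, 1, 0, by norm_num⟩
  | OnePoint.infty, OnePoint.infty, h => absurd rfl h

def Geodesic.chart (g : Geodesic) : Moebius := chartOf g.1.1 g.1.2 g.2

lemma Geodesic.rec_cases {P : Geodesic → Prop}
    (h1 : ∀ (a b : ℝ) (h : (a : OnePoint ℝ) ≠ b), a < b → P ⟨(a, b), h⟩)
    (h2 : ∀ (a b : ℝ) (h : (a : OnePoint ℝ) ≠ b), b < a → P ⟨(a, b), h⟩)
    (h3 : ∀ (a : ℝ) (h : (a : OnePoint ℝ) ≠ OnePoint.infty), P ⟨(a, OnePoint.infty), h⟩)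
    (h4 : ∀ (b : ℝ) (h : OnePoint.infty ≠ (b : OnePoint ℝ)), P ⟨(OnePoint.infty, b), h⟩)
    (g : Geodesic) : P g := by
  obtain ⟨⟨a, b⟩, h⟩ := g
  cases a using OnePoint.rec with
  | infty => cases b using OnePoint.rec with
    | infty => exact absurd rfl h
    | coe b => exact h4 b h
  | coe a => cases b using OnePoint.rec with
    | infty => exact h3 a h
    | coe b =>
      rcases lt_trichotomy a b with k | k | k
      · exact h1 a b h k
      · exact absurd (by rw [k]) h
      · exact h2 a b h k

lemma chart_lt {a b : ℝ} (h : (a : OnePoint ℝ) ≠ b) (k : a < b) :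
    Geodesic.chart ⟨(a, b), h⟩ = ⟨b, a, 1, 1, by linarith⟩ := by
  have : SignType.sign (b - a) = 1 := sign_pos (by linarith)
  change Moebius.mk _ _ _ _ _ = _
  simp [this]

lemma chart_gt {a b : ℝ} (h : (a : OnePoint ℝ) ≠ b) (k : b < a) :
    Geodesic.chart ⟨(a, b), h⟩ = ⟨b, -a, 1, -1, by linarith⟩ := by
  have : SignType.sign (b - a) = -1 := sign_neg (by linarith)
  change Moebius.mk _ _ _ _ _ = _
  simp [this]

lemma chart_infty_right {a : ℝ} (h : (a : OnePoint ℝ) ≠ OnePoint.infty) :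
    Geodesic.chart ⟨(a, OnePoint.infty), h⟩ = ⟨1, a, 0, 1, by norm_num⟩ := rfl

lemma chart_infty_left {b : ℝ} (h : OnePoint.infty ≠ (b : OnePoint ℝ)) :
    Geodesic.chart ⟨(OnePoint.infty, b), h⟩ = ⟨b, -1, 1, 0, by norm_num⟩ := rfl

lemma Geodesic.coe_point (g : Geodesic) (t : ℝ) :
    (g.point t : ℂ) = g.chart.app (Real.exp t * Complex.I) := by
  have key : ∀ x : ℝ, (1 : ℂ) + x * Complex.I ≠ 0 := fun x h => by
    have := congrArg Complex.re h
    simp at this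
  induction g using Geodesic.rec_cases with
  | h1 a b h k =>
    rw [chart_lt h k]
    change (⟨_, |b - a| * Real.exp t / (1 + Real.exp t ^ 2)⟩ : ℂ) = _
    rw [abs_of_pos (by linarith)]
    have := Real.exp_pos t
    apply Complex.ext <;>
      simp only [Moebius.re_app, Moebius.im_app, Moebius.det, Complex.normSq_apply] <;>
      simp [-Complex.ofReal_exp] <;> field_simp <;> ring
  | h2 a b h k =>
    rw [chart_gt h k]
    change (⟨_, |b - a| * Real.exp t / (1 + Real.exp t ^ 2)⟩ : ℂ) = _
    rw [abs_of_neg (by linarith)]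
    have := Real.exp_pos t
    apply Complex.ext <;>
      simp only [Moebius.re_app, Moebius.im_app, Moebius.det, Complex.normSq_apply] <;>
      simp [-Complex.ofReal_exp] <;> field_simp <;> ring
  | h3 a h =>
    rw [chart_infty_right h]
    change (⟨a, Real.exp t⟩ : ℂ) = _
    apply Complex.ext <;> simp [Moebius.app, -Complex.ofReal_exp]
  | h4 b h =>
    rw [chart_infty_left h]
    change (⟨b, Real.exp (-t)⟩ : ℂ) = _
    have := Real.exp_pos t
    apply Complex.ext <;>
      simp only [Moebius.re_app, Moebius.im_app, Moebius.det, Complex.normSq_apply] <;>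
      simp [Real.exp_neg, -Complex.ofReal_exp] <;> field_simp

/-- In the chart the geodesic is the imaginary axis, and the hyperbolic sine of the signed distance
to this axis is `Re / Im`. -/
lemma Geodesic.sinhDist_eq (g : Geodesic) {z : ℂ} (hz : 0 < z.im) :
    sinhDist g.1.1 g.1.2 z = (g.chart.inv.app z).re / (g.chart.inv.app z).im := by
  rw [Moebius.re_div_im_app _ hz]
  induction g using Geodesic.rec_cases with
  | h1 a b h k =>
    rw [chart_lt h k]
    have : b - a ≠ 0 := by linarith
    simp only [sinhDist, Moebius.inv, Moebius.det]
    rw [div_eq_div_iff (mul_ne_zero hz.ne' this) (mul_ne_zero (by intro; apply this; linarith) hz.ne')]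
    ring
  | h2 a b h k =>
    rw [chart_gt h k]
    have : b - a ≠ 0 := by linarith
    simp only [sinhDist, Moebius.inv, Moebius.det]
    rw [div_eq_div_iff (mul_ne_zero hz.ne' this) (mul_ne_zero (by intro; apply this; linarith) hz.ne')]
    ring
  | h3 a h =>
    rw [chart_infty_right h]
    simp [sinhDist, Moebius.inv, Moebius.det]
    ring
  | h4 b h =>
    rw [chart_infty_left h]
    simp [sinhDist, Moebius.inv, Moebius.det]
    ring

/-- The perpendiculars to the imaginary axis are the circles centred at `0`, so the projection in
the chart only depends on the modulus. -/
lemma Geodesic.pos_eq (g : Geodesic) (z : ℂ) :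
    g.pos z = Real.log ‖g.chart.inv.app z‖ := by
  induction g using Geodesic.rec_cases with
  | h1 a b h k =>
    rw [chart_lt h k]
    simp only [Geodesic.pos, posC, Moebius.inv, Moebius.app, norm_div]
    congr 2
    · congr 1; push_cast; ring
    · rw [← norm_neg]; congr 1; push_cast; ring
  | h2 a b h k =>
    rw [chart_gt h k]
    simp only [Geodesic.pos, posC, Moebius.inv, Moebius.app, norm_div]
    congr 2
    · rw [← norm_neg]; congr 1; push_cast; ring
    · rw [← norm_neg]; congr 1; push_cast; ring
  | h3 a h =>
    rw [chart_infty_right h]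
    simp [Geodesic.pos, posC, Moebius.inv, Moebius.app, sub_eq_add_neg]
  | h4 b h =>
    rw [chart_infty_left h]
    simp only [Geodesic.pos, posC, Moebius.inv, Moebius.app, norm_div]
    rw [← Real.log_inv]
    congr 1
    rw [← norm_neg (z - b)]
    simp
    congr 1; ring

/-- The entry `p` of the relative matrix `(p q; r s)` of `g` with respect to `h` vanishes exactly
when `h⁻ = g⁺`, the entry `r` exactly when `h⁺ = g⁺`. -/
def Geodesic.rel (h g : Geodesic) : Moebius := h.chart.inv.mul g.chart

lemma orient_eq_sign {x y z : OnePoint ℝ} {r : ℝ} (h1 : 0 < r ↔ PosOriented x y z)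
    (h2 : r < 0 ↔ PosOriented z y x) : orient x y z = SignType.sign r := by
  rcases lt_trichotomy r 0 with h | h | h
  · rw [orient_neg (h2.1 h), sign_neg h]; simp
  · subst h
    simp only [lt_irrefl, false_iff] at h1 h2
    simp [orient, h1, h2]
  · rw [orient_pos (h1.1 h), sign_pos h]; simp

lemma chart_column (g : Geodesic) : (g.1.2 = OnePoint.infty ∧ g.chart.a = 1 ∧ g.chart.c = 0) ∨
    ∃ t : ℝ, g.1.2 = t ∧ g.chart.a = t ∧ g.chart.c = 1 := by
  induction g using Geodesic.rec_cases with
  | h1 a b h k => exact Or.inr ⟨b, rfl, by rw [chart_lt h k], by rw [chart_lt h k]⟩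
  | h2 a b h k => exact Or.inr ⟨b, rfl, by rw [chart_gt h k], by rw [chart_gt h k]⟩
  | h3 a h => exact Or.inl ⟨rfl, rfl, rfl⟩
  | h4 b h => exact Or.inr ⟨b, rfl, rfl, rfl⟩

/-- The first column `(a, c)` gives homogeneous coordinates of `g⁺` in the chart of `h`, where `h⁻`
is `0` and `h⁺` is `∞`. The sign of `a c` tells on which of the two arcs bounded by `h⁻` and `h⁺`
the point `g⁺` lies. -/
lemma Geodesic.rel_spec (h g : Geodesic) :
    ((h.rel g).a = 0 ↔ h.1.1 = g.1.2) ∧ ((h.rel g).c = 0 ↔ h.1.2 = g.1.2) ∧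
    orient g.1.2 h.1.2 h.1.1 = SignType.sign ((h.rel g).a * (h.rel g).c) := by
  rw [orient_eq_sign (r := (h.rel g).a * (h.rel g).c)]
  · simp only [Geodesic.rel, Moebius.mul]
    obtain ⟨h1, h2, h3⟩ | ⟨t, h1, h2, h3⟩ := chart_column g <;> rw [h1, h2, h3] <;>
    induction h using Geodesic.rec_cases with
    | h1 a b h k => 
      rw [chart_lt h k]
      simp [Moebius.inv, bdryLT, PosOriented]
      try grind
    | h2 a b h k => 
      rw [chart_gt h k]
      simp [Moebius.inv, bdryLT, PosOriented]
      try grind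
    | h3 a h => 
      rw [chart_infty_right h]
      simp [Moebius.inv, bdryLT, PosOriented]
      try grind
    | h4 b h => 
      rw [chart_infty_left h]
      simp [Moebius.inv, bdryLT, PosOriented]
      try grind
  all_goals
    simp only [Geodesic.rel, Moebius.mul, mul_pos_iff, mul_neg_iff]
    obtain ⟨h1, h2, h3⟩ | ⟨t, h1, h2, h3⟩ := chart_column g <;> rw [h1, h2, h3] <;>
    induction h using Geodesic.rec_cases with
    | h1 a b h k => 
      rw [chart_lt h k]
      simp [Moebius.inv, bdryLT, PosOriented]
      try grind
    | h2 a b h k => 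
      rw [chart_gt h k]
      simp [Moebius.inv, bdryLT, PosOriented]
      try grind
    | h3 a h => 
      rw [chart_infty_right h]
      simp [Moebius.inv, bdryLT, PosOriented]
      try grind
    | h4 b h => 
      rw [chart_infty_left h]
      simp [Moebius.inv, bdryLT, PosOriented]
      try grind

/-! ### The profile of geodesic forms -/

namespace CutoffProfile

variable (f : CutoffProfile)

/-- The geodesic form of `g` is `kernel (sinh R_g) d (sinh R_g)`. -/
def kernel (s : ℝ) : ℝ := -(deriv f.toFun |Real.arsinh s|) * (√(1 + s ^ 2))⁻¹

/-- The odd primitive of the kernel. -/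
def step (s : ℝ) : ℝ := ∫ x in (0 : ℝ)..s, f.kernel x

lemma differentiable : Differentiable ℝ f.toFun := f.smooth.differentiable (by simp)

lemma deriv_eq_zero_of_eqOn {s : Set ℝ} {c r : ℝ} (hs : UniqueDiffWithinAt ℝ s r) (hr : r ∈ s)
    (h : ∀ x ∈ s, f.toFun x = c) : deriv f.toFun r = 0 := by
  have h1 := (f.differentiable r).hasDerivAt.hasDerivWithinAt (s := s)
  have h2 : HasDerivWithinAt f.toFun 0 s r :=
    (hasDerivWithinAt_const r s c).congr h (h r hr)
  exact hs.eq_deriv _ h1 h2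

lemma deriv_eq_zero_of_le {r : ℝ} (h0 : 0 ≤ r) (h : r ≤ 1 / 2) : deriv f.toFun r = 0 :=
  f.deriv_eq_zero_of_eqOn (uniqueDiffOn_Icc (by norm_num) r ⟨h0, h⟩) ⟨h0, h⟩ f.eq_half

lemma deriv_eq_zero_of_ge {r : ℝ} (h : 1 ≤ r) : deriv f.toFun r = 0 :=
  f.deriv_eq_zero_of_eqOn (uniqueDiffOn_Ici 1 r h) h f.eq_zero

lemma kernel_neg (s : ℝ) : f.kernel (-s) = f.kernel s := by simp [kernel]

lemma kernel_eq_zero_of_abs_le {s : ℝ} (h : |s| ≤ Real.sinh (1 / 2)) : f.kernel s = 0 := by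
  have : |Real.arsinh s| ≤ 1 / 2 := by
    rw [abs_le] at *
    rw [← Real.arsinh_sinh (1 / 2), ← Real.arsinh_neg]
    exact ⟨Real.arsinh_le_arsinh.2 h.1, Real.arsinh_le_arsinh.2 h.2⟩
  rw [kernel, f.deriv_eq_zero_of_le (abs_nonneg _) this]; simp

lemma kernel_eq_zero_of_le_abs {s : ℝ} (h : Real.sinh 1 ≤ |s|) : f.kernel s = 0 := by
  have : 1 ≤ |Real.arsinh s| := by
    rw [le_abs] at *
    rw [← Real.arsinh_sinh 1, ← Real.arsinh_neg]
    exact h.imp Real.arsinh_le_arsinh.2 Real.arsinh_le_arsinh.2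
  rw [kernel, f.deriv_eq_zero_of_ge this]; simp

/-- The absolute value in the kernel is harmless: it is singular only at `0`, and the kernel
vanishes near `0`. -/
lemma contDiff_kernel : ContDiff ℝ (⊤ : ℕ∞) f.kernel := by
  rw [contDiff_iff_contDiffAt]
  intro s
  by_cases h : s = 0
  · refine (contDiffAt_const (c := (0 : ℝ))).congr_of_eventuallyEq ?_
    have : ∀ᶠ x : ℝ in 𝓝 s, |x| < Real.sinh (1 / 2) := by
      refine (continuous_abs.tendsto s).eventually_lt_const ?_
      rw [h, abs_zero]; exact Real.sinh_pos_iff.2 (by norm_num)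
    filter_upwards [this] with x hx
    exact f.kernel_eq_zero_of_abs_le hx.le
  · have hd : ContDiff ℝ (⊤ : ℕ∞) (deriv f.toFun) := (contDiff_infty_iff_deriv.1 f.smooth).2
    have h1 : ContDiffAt ℝ (⊤ : ℕ∞) (fun x => |Real.arsinh x|) s :=
      (contDiffAt_abs (by simpa using h)).comp s Real.contDiff_arsinh.contDiffAt
    have h2 : ContDiffAt ℝ (⊤ : ℕ∞) (fun x : ℝ => (√(1 + x ^ 2))⁻¹) s := by
      have h3 : 1 + s ^ 2 ≠ 0 := by positivity
      refine ContDiffAt.inv (ContDiffAt.sqrt ?_ h3) (by positivity)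
      exact (contDiff_const.add (contDiff_id.pow 2)).contDiffAt
    exact ((hd.contDiffAt.comp s h1).neg).mul h2

lemma continuous_kernel : Continuous f.kernel := f.contDiff_kernel.continuous

lemma hasDerivAt_step (s : ℝ) : HasDerivAt f.step (f.kernel s) s :=
  intervalIntegral.integral_hasDerivAt_right (f.continuous_kernel.intervalIntegrable _ _)
    (f.continuous_kernel.stronglyMeasurableAtFilter _ _) f.continuous_kernel.continuousAt

lemma contDiff_step : ContDiff ℝ (⊤ : ℕ∞) f.step := by
  rw [contDiff_infty_iff_deriv]
  refine ⟨fun s => (f.hasDerivAt_step s).differentiableAt, ?_⟩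
  rw [funext fun s => (f.hasDerivAt_step s).deriv]
  exact f.contDiff_kernel

lemma continuous_step : Continuous f.step := f.contDiff_step.continuous

lemma step_neg (s : ℝ) : f.step (-s) = -f.step s := by
  have := intervalIntegral.integral_comp_neg (a := 0) (b := s) f.kernel
  simp only [f.kernel_neg, neg_zero] at this
  rw [step, step, this, intervalIntegral.integral_symm]

lemma step_eq_zero {s : ℝ} (h : |s| ≤ Real.sinh (1 / 2)) : f.step s = 0 := by
  rw [step]
  apply intervalIntegral.integral_zero_ae
  refine Eventually.of_forall fun x hx => f.kernel_eq_zero_of_abs_le (le_trans ?_ h)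
  rcases le_total 0 s with h' | h'
  · rw [uIoc_of_le h'] at hx
    rw [abs_of_pos hx.1, abs_of_nonneg h']; exact hx.2
  · rw [uIoc_of_ge h'] at hx
    rw [abs_of_nonpos hx.2, abs_of_nonpos h']; linarith [hx.1]

lemma step_of_nonneg {s : ℝ} (h : 0 ≤ s) : f.step s = 1 / 2 - f.toFun (Real.arsinh s) := by
  have h1 : ∀ x ∈ uIcc 0 s, HasDerivAt (fun x => -f.toFun (Real.arsinh x)) (f.kernel x) x := by
    intro x hx
    rw [uIcc_of_le h] at hx
    have := ((f.differentiable (Real.arsinh x)).hasDerivAt.comp x (Real.hasDerivAt_arsinh x)).neg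
    refine this.congr_deriv ?_
    rw [kernel, abs_of_nonneg (Real.arsinh_nonneg_iff.2 hx.1)]
    ring
  rw [step, intervalIntegral.integral_eq_sub_of_hasDerivAt h1
    (f.continuous_kernel.intervalIntegrable _ _), Real.arsinh_zero,
    f.eq_half 0 ⟨le_rfl, by norm_num⟩]
  ring

lemma step_of_sinh_le {s : ℝ} (h : Real.sinh 1 ≤ s) : f.step s = 1 / 2 := by
  have h0 : 0 ≤ s := le_trans (Real.sinh_nonneg_iff.2 zero_le_one) h
  rw [f.step_of_nonneg h0, f.eq_zero _ (by
    rw [← Real.arsinh_sinh 1]; exact Real.arsinh_le_arsinh.2 h), sub_zero]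

lemma step_of_le_neg_sinh {s : ℝ} (h : s ≤ -Real.sinh 1) : f.step s = -(1 / 2) := by
  rw [← neg_neg s, step_neg, f.step_of_sinh_le (by linarith)]

lemma hasCompactSupport_kernel : HasCompactSupport f.kernel := by
  refine HasCompactSupport.of_support_subset_isCompact (isCompact_Icc (a := -Real.sinh 1) (b := Real.sinh 1)) ?_
  intro s hs
  rw [Set.mem_Icc, ← abs_le]
  by_contra h
  exact hs (f.kernel_eq_zero_of_le_abs (not_le.1 h).le)

lemma integrable_kernel : Integrable f.kernel :=
  f.continuous_kernel.integrable_of_hasCompactSupport f.hasCompactSupport_kernel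

lemma tendsto_step_atTop : Tendsto f.step atTop (𝓝 (1 / 2)) :=
  tendsto_const_nhds.congr' <| (eventually_ge_atTop (Real.sinh 1)).mono fun _ h =>
    (f.step_of_sinh_le h).symm

lemma tendsto_step_atBot : Tendsto f.step atBot (𝓝 (-(1 / 2))) :=
  tendsto_const_nhds.congr' <| (eventually_le_atBot (-Real.sinh 1)).mono fun _ h =>
    (f.step_of_le_neg_sinh h).symm

lemma integral_kernel : ∫ s, f.kernel s = 1 := by
  rw [integral_of_hasDerivAt_of_tendsto f.hasDerivAt_step f.integrable_kernel
    f.tendsto_step_atBot f.tendsto_step_atTop]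
  norm_num

lemma integrable_kernel_mul {u : ℝ → ℝ} (hu : Continuous u) :
    Integrable fun s => f.kernel s * u s :=
  (f.continuous_kernel.mul hu).integrable_of_hasCompactSupport f.hasCompactSupport_kernel.mul_right

/-- Even times odd. This cancellation removes the effect of asymptotic geodesics on the integrals
over the plane, and is the reason why intersection numbers at infinity do not depend on the profile.
-/
lemma integral_kernel_mul_step : ∫ s, f.kernel s * f.step s = 0 := by
  have h := integral_neg_eq_self (fun s => f.kernel s * f.step s) volume
  simp only [kernel_neg, step_neg, mul_neg, integral_neg] at h
  linarith

lemma exists_kernel_le : ∃ M, 0 < M ∧ ∀ s, |f.kernel s| ≤ M := by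
  obtain ⟨M, hM⟩ := f.hasCompactSupport_kernel.exists_bound_of_continuous f.continuous_kernel
  exact ⟨max M 1, by positivity, fun s => (hM s).trans (le_max_left _ _)⟩

end CutoffProfile

/-! ### Geodesic forms -/

/-- The upper half-plane as a subset of `ℂ`. -/
abbrev upper : Set ℂ := {z : ℂ | 0 < z.im}

lemma isOpen_upper : IsOpen upper := isOpen_lt continuous_const Complex.continuous_im

lemma upper_mem_nhds {z : ℂ} (hz : 0 < z.im) : upper ∈ 𝓝 z := isOpen_upper.mem_nhds hz

lemma convex_upper : Convex ℝ upper := convex_halfSpace_im_gt 0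

/-- The hyperbolic sine of the signed distance to `g`. -/
def Geodesic.height (g : Geodesic) (z : ℂ) : ℝ := sinhDist g.1.1 g.1.2 z

lemma Geodesic.contDiffOn_height (g : Geodesic) : ContDiffOn ℝ (⊤ : ℕ∞) g.height upper := by
  have h : ContDiffOn ℝ (⊤ : ℕ∞)
      (fun z => (g.chart.inv.app z).re / (g.chart.inv.app z).im) upper := by
    have h1 := g.chart.inv.contDiffOn_app (n := (⊤ : ℕ∞))
    refine ContDiffOn.div ?_ ?_ fun z hz => (g.chart.inv.im_app_pos hz).ne'
    · exact Complex.reCLM.contDiff.comp_contDiffOn h1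
    · exact Complex.imCLM.contDiff.comp_contDiffOn h1
  exact h.congr fun z hz => g.sinhDist_eq hz

lemma Geodesic.differentiableAt_height (g : Geodesic) {z : ℂ} (hz : 0 < z.im) :
    DifferentiableAt ℝ g.height z :=
  (g.contDiffOn_height.contDiffAt (upper_mem_nhds hz)).differentiableAt (by simp)

lemma geodesicForm_eq (f : CutoffProfile) (g : Geodesic) {z : ℂ} (hz : 0 < z.im) :
    geodesicForm f g z = f.kernel (g.height z) • fderiv ℝ g.height z := by
  have h := (g.differentiableAt_height hz).hasFDerivAt.arsinh.fderiv
  change -(deriv f.toFun |g.signedDist z|) • fderiv ℝ (fun z => Real.arsinh (g.height z)) z = _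
  rw [h, smul_smul]
  rfl

/-- The primitive of the geodesic form. -/
def Geodesic.potential (f : CutoffProfile) (g : Geodesic) (z : ℂ) : ℝ := f.step (g.height z)

lemma hasFDerivAt_potential (f : CutoffProfile) (g : Geodesic) {z : ℂ} (hz : 0 < z.im) :
    HasFDerivAt (g.potential f) (geodesicForm f g z) z := by
  rw [geodesicForm_eq f g hz]
  exact (f.hasDerivAt_step _).comp_hasFDerivAt z (g.differentiableAt_height hz).hasFDerivAt

lemma contDiffOn_potential (f : CutoffProfile) (g : Geodesic) :
    ContDiffOn ℝ (⊤ : ℕ∞) (g.potential f) upper :=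
  f.contDiff_step.comp_contDiffOn g.contDiffOn_height

/-- A smooth closed form. -/
structure IsSmoothClosed (ω : Form) : Prop where
  smooth : ContDiffOn ℝ (⊤ : ℕ∞) ω upper
  closed : ∀ (z : ℍ) (u v : ℂ), fderiv ℝ ω z u v = fderiv ℝ ω z v u

lemma isSmoothClosed_of_primitive {φ : ℂ → ℝ} {ω : Form} (hφ : ContDiffOn ℝ (⊤ : ℕ∞) φ upper)
    (h : ∀ z ∈ upper, HasFDerivAt φ (ω z) z) : IsSmoothClosed ω := by
  have h1 : ∀ z ∈ upper, fderiv ℝ φ z = ω z := fun z hz => (h z hz).fderiv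
  refine ⟨?_, ?_⟩
  · refine ContDiffOn.congr (f := fderiv ℝ φ) ?_ fun z hz => (h1 z hz).symm
    exact ContDiffOn.fderiv_of_isOpen hφ isOpen_upper (by simp)
  · intro z u v
    have h2 : fderiv ℝ ω z = fderiv ℝ (fderiv ℝ φ) z := by
      apply Filter.EventuallyEq.fderiv_eq
      filter_upwards [upper_mem_nhds z.im_pos] with w hw
      exact (h1 w hw).symm
    rw [h2]
    exact ((hφ.contDiffAt (upper_mem_nhds z.im_pos)).isSymmSndFDerivAt (by
      rw [minSmoothness_of_isRCLikeNormedField]; exact WithTop.coe_le_coe.2 le_top)) u v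

lemma isSmoothClosed_geodesicForm (f : CutoffProfile) (g : Geodesic) :
    IsSmoothClosed (geodesicForm f g) :=
  isSmoothClosed_of_primitive (contDiffOn_potential f g) fun _ hz => hasFDerivAt_potential f g hz

lemma IsSmoothClosed.exists_primitive {ω : Form} (h : IsSmoothClosed ω) :
    ∃ φ : ℂ → ℝ, ∀ z ∈ upper, HasFDerivAt φ (ω z) z := by
  obtain ⟨φ, hφ⟩ := convex_upper.exists_forall_hasFDerivWithinAt_of_hasFDerivWithinAt_symmetric
    (ω := ω) (dω := fderiv ℝ ω) (fun x hx =>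
      ((h.smooth.contDiffAt (upper_mem_nhds hx)).differentiableAt
        (by simp)).hasFDerivAt.hasFDerivWithinAt) fun a ha x _ y _ => h.closed ⟨a, ha⟩ x y
  exact ⟨φ, fun z hz => (hφ z hz).hasFDerivAt (upper_mem_nhds hz)⟩

lemma eq_add_const_of_hasFDerivAt {E : Type*} [NormedAddCommGroup E] [NormedSpace ℝ E]
    {φ₁ φ₂ : ℂ → E} {ω : ℂ → ℂ →L[ℝ] E}
    (h1 : ∀ z ∈ upper, HasFDerivAt φ₁ (ω z) z) (h2 : ∀ z ∈ upper, HasFDerivAt φ₂ (ω z) z) :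
    ∃ C, ∀ z ∈ upper, φ₁ z = φ₂ z + C := by
  refine ⟨φ₁ Complex.I - φ₂ Complex.I, fun z hz => ?_⟩
  have h3 : ∀ z ∈ upper, HasFDerivWithinAt (fun z => φ₁ z - φ₂ z) (0 : ℂ →L[ℝ] E) upper z := by
    intro z hz
    have := ((h1 z hz).sub (h2 z hz)).hasFDerivWithinAt (s := upper)
    rwa [sub_self] at this
  have hI : Complex.I ∈ upper := by simp
  have := convex_upper.norm_image_sub_le_of_norm_hasFDerivWithin_le (C := 0) h3 (by simp) hI hz
  simp only [zero_mul, norm_le_zero_iff, sub_eq_zero] at this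
  rw [← this]; abel

/-! ### Fermi-type coordinates along a geodesic and the behaviour of forms at its end -/

/-- The point of the upper half-plane with height `ζ.re` and logarithmic imaginary part `ζ.im`. -/
def strip (ζ : ℂ) : ℂ := (Real.exp ζ.im : ℂ) * (ζ.re + Complex.I)

@[simp] lemma strip_re (ζ : ℂ) : (strip ζ).re = Real.exp ζ.im * ζ.re := by
  simp [strip, -Complex.ofReal_exp]

@[simp] lemma strip_im (ζ : ℂ) : (strip ζ).im = Real.exp ζ.im := by
  simp [strip, -Complex.ofReal_exp]

lemma strip_im_pos (ζ : ℂ) : 0 < (strip ζ).im := by rw [strip_im]; exact Real.exp_pos _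

def stripH (ζ : ℂ) : ℍ := ⟨strip ζ, strip_im_pos ζ⟩

/-- Coordinates along `g`: the real part is the height above `g`. -/
def Geodesic.fermi (g : Geodesic) (ζ : ℂ) : ℂ := g.chart.app (strip ζ)

def Geodesic.fermiH (g : Geodesic) (ζ : ℂ) : ℍ := g.chart.act (stripH ζ)

@[simp] lemma Geodesic.coe_fermiH (g : Geodesic) (ζ : ℂ) : (g.fermiH ζ : ℂ) = g.fermi ζ := rfl

lemma Geodesic.fermi_im_pos (g : Geodesic) (ζ : ℂ) : 0 < (g.fermi ζ).im :=
  g.chart.im_app_pos (strip_im_pos ζ)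

lemma Geodesic.point_eq_fermiH (g : Geodesic) (t : ℝ) : g.point t = g.fermiH ⟨0, t⟩ := by
  apply UpperHalfPlane.ext
  rw [g.coe_point]
  simp [Geodesic.fermi, strip]

lemma Geodesic.coe_point_eq_fermi (g : Geodesic) (t : ℝ) : (g.point t : ℂ) = g.fermi ⟨0, t⟩ := by
  rw [g.point_eq_fermiH]; rfl

lemma Geodesic.chart_inv_fermi (g : Geodesic) (ζ : ℂ) :
    g.chart.inv.app (g.fermi ζ) = strip ζ := g.chart.inv_app (strip_im_pos ζ)

/-- The inverse of `fermi`. -/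
def Geodesic.unfermi (g : Geodesic) (z : ℂ) : ℂ :=
  ⟨g.height z, Real.log (g.chart.inv.app z).im⟩

lemma Geodesic.height_fermi (g : Geodesic) (ζ : ℂ) : g.height (g.fermi ζ) = ζ.re := by
  rw [Geodesic.height, g.sinhDist_eq (g.fermi_im_pos ζ), chart_inv_fermi, strip_re, strip_im]
  field_simp

lemma Geodesic.unfermi_fermi (g : Geodesic) (ζ : ℂ) : g.unfermi (g.fermi ζ) = ζ := by
  apply Complex.ext
  · exact g.height_fermi ζ
  · simp [Geodesic.unfermi, chart_inv_fermi]

lemma Geodesic.fermi_unfermi (g : Geodesic) {z : ℂ} (hz : 0 < z.im) :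
    g.fermi (g.unfermi z) = z := by
  have h := g.chart.inv.im_app_pos hz
  have : strip (g.unfermi z) = g.chart.inv.app z := by
    apply Complex.ext
    · rw [strip_re, Geodesic.unfermi, Real.exp_log h, Geodesic.height, g.sinhDist_eq hz]
      field_simp
    · rw [strip_im, Geodesic.unfermi, Real.exp_log h]
  rw [Geodesic.fermi, this, g.chart.app_inv hz]

/-- At the end of `g` the height above `h` is governed by the term in `e^τ`. Its coefficient
contains `a c`, which vanishes exactly when `g⁺` is an end of `h`. The asymptotics of heights below
all come from this formula. -/
lemma Geodesic.height_fermi_eq (h g : Geodesic) (ζ : ℂ) : h.height (g.fermi ζ) =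
    ((h.rel g).a * (h.rel g).c * (Real.exp ζ.im * (1 + ζ.re ^ 2)) +
      ((h.rel g).a * (h.rel g).d + (h.rel g).b * (h.rel g).c) * ζ.re +
      (h.rel g).b * (h.rel g).d * Real.exp (-ζ.im)) / (h.rel g).det := by
  rw [Geodesic.height, h.sinhDist_eq (g.fermi_im_pos ζ), Geodesic.fermi,
    ← Moebius.mul_app _ _ (strip_im_pos ζ)]
  change ((h.rel g).app _).re / ((h.rel g).app _).im = _
  rw [Moebius.re_div_im_app _ (strip_im_pos ζ), strip_re, strip_im, Real.exp_neg]
  have := (h.rel g).det_pos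
  have h2 : (h.rel g).det ≠ 0 := this.ne'
  have := Real.exp_pos ζ.im
  field_simp
  ring

lemma Geodesic.pos_fermi_eq (h g : Geodesic) (ζ : ℂ) :
    h.pos (g.fermi ζ) = Real.log ‖(h.rel g).app (strip ζ)‖ := by
  rw [h.pos_eq, Geodesic.fermi, ← Moebius.mul_app _ _ (strip_im_pos ζ)]
  rfl

lemma Geodesic.pos_fermi (g : Geodesic) (ζ : ℂ) : g.pos (g.fermi ζ) = Real.log ‖strip ζ‖ := by
  rw [g.pos_eq, chart_inv_fermi]

@[simp] lemma Geodesic.pos_point (g : Geodesic) (t : ℝ) : g.pos (g.point t) = t := by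
  rw [g.coe_point_eq_fermi, pos_fermi, strip]
  simp [-Complex.ofReal_exp]

lemma Geodesic.abs_sub_le_dist_fermiH (g : Geodesic) (ζ ξ : ℂ) :
    |ζ.im - ξ.im| ≤ dist (g.fermiH ζ) (g.fermiH ξ) := by
  rw [Geodesic.fermiH, Geodesic.fermiH, Moebius.dist_act]
  have := UpperHalfPlane.dist_log_im_le (stripH ζ) (stripH ξ)
  have e : ∀ ζ, Real.log (stripH ζ).im = ζ.im := fun ζ => by
    change Real.log (strip ζ).im = _
    rw [strip_im, Real.log_exp]
  rwa [e, e, Real.dist_eq] at this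

/-- The filter of the points which go to the end of the geodesic in a tube around it. -/
def endFilter (S : ℝ) : Filter ℂ := comap Complex.im atTop ⊓ 𝓟 {ζ | |ζ.re| ≤ S}

lemma eventually_endFilter {S : ℝ} {P : ℂ → Prop} :
    (∀ᶠ ζ in endFilter S, P ζ) ↔ ∃ T, ∀ ζ : ℂ, T ≤ ζ.im → |ζ.re| ≤ S → P ζ := by
  rw [endFilter, eventually_inf_principal, eventually_comap]
  simp only [eventually_atTop]
  constructor
  · rintro ⟨T, hT⟩
    exact ⟨T, fun ζ h => hT _ h ζ rfl⟩
  · rintro ⟨T, hT⟩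
    exact ⟨T, fun b hb ζ h => hT ζ (h ▸ hb)⟩

lemma tendsto_im_endFilter (S : ℝ) : Tendsto Complex.im (endFilter S) atTop :=
  tendsto_comap.mono_left inf_le_left

lemma Geodesic.eventually_dist_fermiH (g : Geodesic) (S : ℝ) (x : ℍ) (R : ℝ) :
    ∀ᶠ ζ in endFilter S, R < dist x (g.fermiH ζ) := by
  filter_upwards [(tendsto_im_endFilter S).eventually_gt_atTop (R + dist x (g.fermiH 0))] with ζ h
  have h1 := g.abs_sub_le_dist_fermiH ζ 0
  have h2 := dist_triangle (g.fermiH ζ) x (g.fermiH 0)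
  have h3 := le_abs_self (ζ.im - (0 : ℂ).im)
  rw [dist_comm (g.fermiH ζ) x] at h2
  simp only [Complex.zero_im, sub_zero] at h1 h3
  linarith

/-- Here `c = 0`: the relative transformation is affine, the term in `e^τ` disappears and the
coefficient of `s` becomes `1`. -/
lemma Geodesic.height_fermi_of_snd_eq (h g : Geodesic) (e : h.1.2 = g.1.2) :
    ∃ C, ∀ ζ, h.height (g.fermi ζ) = ζ.re + C * Real.exp (-ζ.im) := by
  have hc := (h.rel_spec g).2.1.2 e
  have hd := (h.rel g).det_pos
  refine ⟨(h.rel g).b / (h.rel g).a, fun ζ => ?_⟩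
  rw [height_fermi_eq, Moebius.det]
  simp only [hc, mul_zero, sub_zero] at hd ⊢
  have h1 : (h.rel g).a ≠ 0 := fun k => by simp [k] at hd
  have h2 : (h.rel g).d ≠ 0 := fun k => by simp [k] at hd
  field_simp
  ring

/-- Now `a = 0`, and the two geodesics run in opposite directions near their common end, whence the
sign of `s`. -/
lemma Geodesic.height_fermi_of_fst_eq (h g : Geodesic) (e : h.1.1 = g.1.2) :
    ∃ C, ∀ ζ, h.height (g.fermi ζ) = -ζ.re + C * Real.exp (-ζ.im) := by
  have ha := (h.rel_spec g).1.2 e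
  have hd := (h.rel g).det_pos
  refine ⟨-((h.rel g).d / (h.rel g).c), fun ζ => ?_⟩
  rw [height_fermi_eq, Moebius.det]
  simp only [ha, zero_mul, zero_sub] at hd ⊢
  have h1 : (h.rel g).b ≠ 0 := fun k => by simp [k] at hd
  have h2 : (h.rel g).c ≠ 0 := fun k => by simp [k] at hd
  field_simp
  ring

lemma Geodesic.tendsto_pos_of_snd_eq (h g : Geodesic) (S : ℝ) (e : h.1.2 = g.1.2) :
    Tendsto (fun ζ => h.pos (g.fermi ζ)) (endFilter S) atTop := by
  have hc := (h.rel_spec g).2.1.2 e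
  have hd := (h.rel g).det_pos
  have hdet : (h.rel g).det = (h.rel g).a * (h.rel g).d := by rw [Moebius.det, hc]; ring
  simp only [hc, mul_zero, sub_zero] at hd
  have h2 : (h.rel g).d ≠ 0 := fun k => by simp [k] at hd
  set c := (h.rel g).a * (h.rel g).d / (h.rel g).d ^ 2
  have hcpos : 0 < c := by positivity
  refine tendsto_atTop_mono (f := fun ζ : ℂ => Real.log c + ζ.im) (fun ζ => ?_)
    (tendsto_atTop_add_const_left _ _ (tendsto_im_endFilter S))
  have h3 : ((h.rel g).app (strip ζ)).im = c * Real.exp ζ.im := by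
    rw [Moebius.im_app, hdet, hc]
    simp only [Complex.ofReal_zero, zero_mul, zero_add, Complex.normSq_ofReal, strip_im, c]
    field_simp
  rw [h.pos_fermi_eq, ← Real.log_exp ζ.im, ← Real.log_mul hcpos.ne' (Real.exp_pos _).ne', ← h3]
  exact Real.log_le_log ((h.rel g).im_app_pos (strip_im_pos ζ))
    ((le_abs_self _).trans (Complex.abs_im_le_norm _))

lemma Geodesic.tendsto_pos_of_fst_eq (h g : Geodesic) (S : ℝ) (e : h.1.1 = g.1.2) :
    Tendsto (fun ζ => h.pos (g.fermi ζ)) (endFilter S) atBot := by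
  have ha := (h.rel_spec g).1.2 e
  have hd := (h.rel g).det_pos
  simp only [ha, zero_mul, zero_sub] at hd
  have h1 : (h.rel g).b ≠ 0 := fun k => by simp [k] at hd
  have h2 : (h.rel g).c ≠ 0 := fun k => by simp [k] at hd
  set c := |(h.rel g).b| / |(h.rel g).c|
  have hcpos : 0 < c := by positivity
  refine tendsto_atBot_mono (f := fun ζ : ℂ => Real.log c + -ζ.im) (fun ζ => ?_)
    (tendsto_atBot_add_const_left _ _ (tendsto_neg_atTop_atBot.comp (tendsto_im_endFilter S)))
  rw [h.pos_fermi_eq, ← Real.log_exp (-ζ.im), ← Real.log_mul hcpos.ne' (Real.exp_pos _).ne']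
  apply Real.log_le_log
  · exact norm_pos_iff.2 fun k => by
      have := (h.rel g).im_app_pos (strip_im_pos ζ)
      rw [k] at this; simp at this
  · rw [Moebius.app, ha, norm_div]
    simp only [Complex.ofReal_zero, zero_mul, zero_add, Complex.norm_real, Real.norm_eq_abs, c]
    rw [Real.exp_neg, ← div_eq_mul_inv, div_div]
    have h4 : |(h.rel g).c| * Real.exp ζ.im ≤ ‖((h.rel g).c : ℂ) * strip ζ + (h.rel g).d‖ := by
      refine le_trans ?_ (Complex.abs_im_le_norm _)
      simp [abs_mul]
    gcongr

/-- The term `A e^τ (1 + s²)` has a nonzero coefficient, with the sign of `a c`, and dominates the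
other two terms, which stay bounded in the tube. -/
lemma Geodesic.eventually_height_of_ne (h g : Geodesic) (S M : ℝ) (e1 : h.1.1 ≠ g.1.2)
    (e2 : h.1.2 ≠ g.1.2) :
    (orient g.1.2 h.1.2 h.1.1 = 1 ∧ ∀ᶠ ζ in endFilter S, M ≤ h.height (g.fermi ζ)) ∨
    (orient g.1.2 h.1.2 h.1.1 = -1 ∧ ∀ᶠ ζ in endFilter S, h.height (g.fermi ζ) ≤ -M) := by
  obtain ⟨h1, h2, h3⟩ := h.rel_spec g
  have ha : (h.rel g).a ≠ 0 := fun k => e1 (h1.1 k)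
  have hc : (h.rel g).c ≠ 0 := fun k => e2 (h2.1 k)
  have hd : 0 < (h.rel g).det := (h.rel g).det_pos
  set A := (h.rel g).a * (h.rel g).c / (h.rel g).det with hA
  set B := ((h.rel g).a * (h.rel g).d + (h.rel g).b * (h.rel g).c) / (h.rel g).det
  set C := (h.rel g).b * (h.rel g).d / (h.rel g).det
  have key : ∀ ζ, h.height (g.fermi ζ) =
      A * (Real.exp ζ.im * (1 + ζ.re ^ 2)) + B * ζ.re + C * Real.exp (-ζ.im) := by
    intro ζ
    rw [h.height_fermi_eq]
    simp only [A, B, C]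
    field_simp
  have hA0 : A ≠ 0 := div_ne_zero (mul_ne_zero ha hc) hd.ne'
  have hlarge : Tendsto (fun ζ : ℂ => |A| * Real.exp ζ.im) (endFilter S) atTop :=
    (Real.tendsto_exp_atTop.comp (tendsto_im_endFilter S)).const_mul_atTop (abs_pos.2 hA0)
  have hmem : ∀ᶠ ζ in endFilter S, |ζ.re| ≤ S := by
    rw [endFilter, eventually_inf_principal]; exact Eventually.of_forall fun _ h => h
  have hbound : ∀ᶠ ζ in endFilter S, M ≤ |A| * (Real.exp ζ.im * (1 + ζ.re ^ 2))
      - |B * ζ.re + C * Real.exp (-ζ.im)| := by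
    filter_upwards [hlarge.eventually_ge_atTop (M + (|B| * S + |C|)), hmem,
      (tendsto_im_endFilter S).eventually_ge_atTop 0] with ζ hζ1 hζ2 hζ3
    have e1 : |B * ζ.re + C * Real.exp (-ζ.im)| ≤ |B| * S + |C| := by
      refine (abs_add_le _ _).trans ?_
      rw [abs_mul, abs_mul, Real.abs_exp]
      have : Real.exp (-ζ.im) ≤ 1 := Real.exp_le_one_iff.2 (by linarith)
      have h5 := mul_le_mul_of_nonneg_left hζ2 (abs_nonneg B)
      have h6 := mul_le_mul_of_nonneg_left this (abs_nonneg C)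
      linarith
    have e2 : |A| * Real.exp ζ.im ≤ |A| * (Real.exp ζ.im * (1 + ζ.re ^ 2)) := by
      apply mul_le_mul_of_nonneg_left _ (abs_nonneg A)
      exact le_mul_of_one_le_right (Real.exp_pos _).le (by nlinarith [sq_nonneg ζ.re])
    linarith
  have hsign : 0 < A ↔ 0 < (h.rel g).a * (h.rel g).c := by
    rw [hA, div_pos_iff_of_pos_right hd]
  rcases lt_or_gt_of_ne hA0 with hneg | hpos
  · right
    have hs : (h.rel g).a * (h.rel g).c < 0 := by
      refine lt_of_le_of_ne (not_lt.1 fun k => ?_) (mul_ne_zero ha hc)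
      exact absurd (hsign.2 k) hneg.not_gt
    refine ⟨by rw [h3, sign_neg hs]; simp, ?_⟩
    filter_upwards [hbound] with ζ hζ
    rw [key, add_assoc]
    rw [abs_of_neg hneg] at hζ
    linarith [le_abs_self (B * ζ.re + C * Real.exp (-ζ.im))]
  · left
    refine ⟨by rw [h3, sign_pos (hsign.1 hpos)]; simp, ?_⟩
    filter_upwards [hbound] with ζ hζ
    rw [key, add_assoc]
    rw [abs_of_pos hpos] at hζ
    linarith [neg_abs_le (B * ζ.re + C * Real.exp (-ζ.im))]

/-- The derivative of `fermi`. -/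
def Geodesic.fermi' (g : Geodesic) (ζ : ℂ) : ℂ →L[ℝ] ℂ :=
  ((g.chart.det / (g.chart.c * strip ζ + g.chart.d) ^ 2 : ℂ) * (Real.exp ζ.im : ℂ)) •
    (Complex.ofRealCLM.comp Complex.reCLM +
      ((ζ.re : ℂ) + Complex.I) • Complex.ofRealCLM.comp Complex.imCLM)

lemma hasFDerivAt_strip (ζ : ℂ) : HasFDerivAt strip ((Real.exp ζ.im : ℂ) •
    (Complex.ofRealCLM.comp Complex.reCLM +
      ((ζ.re : ℂ) + Complex.I) • Complex.ofRealCLM.comp Complex.imCLM)) ζ := by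
  have h1 : HasFDerivAt (fun ζ : ℂ => (Real.exp ζ.im : ℂ))
      (Complex.ofRealCLM.comp (Real.exp ζ.im • Complex.imCLM)) ζ :=
    Complex.ofRealCLM.hasFDerivAt.comp ζ (Complex.imCLM.hasFDerivAt.exp)
  have h2 : HasFDerivAt (fun ζ : ℂ => (ζ.re : ℂ) + Complex.I)
      (Complex.ofRealCLM.comp Complex.reCLM) ζ :=
    (Complex.ofRealCLM.hasFDerivAt.comp ζ Complex.reCLM.hasFDerivAt).add_const _
  refine (h1.mul h2).congr_fderiv ?_
  ext <;> simp [-Complex.ofReal_exp]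
  ring

lemma Geodesic.hasFDerivAt_fermi (g : Geodesic) (ζ : ℂ) :
    HasFDerivAt g.fermi (g.fermi' ζ) ζ := by
  have h1 := (g.chart.hasDerivAt_app (strip_im_pos ζ)).hasFDerivAt.restrictScalars ℝ
  refine (h1.comp ζ (hasFDerivAt_strip ζ)).congr_fderiv ?_
  ext <;> simp [Geodesic.fermi', -Complex.ofReal_exp] <;> ring

lemma Geodesic.continuous_fermi (g : Geodesic) : Continuous g.fermi :=
  continuous_iff_continuousAt.2 fun ζ => (g.hasFDerivAt_fermi ζ).continuousAt

/-- A smooth closed form which coincides far away with the geodesic form of `g'` near `g'⁻` plus the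
geodesic form of `g` near `g⁺`. -/
structure HasGeodesicEnds (f : CutoffProfile) (x : ℍ) (g' g : Geodesic) (ω : Form) : Prop
    extends IsSmoothClosed ω where
  ends : ∃ R : ℝ, ∀ z : ℍ, R < dist x z →
    ω z = (if g'.pos z < g'.pos x then geodesicForm f g' z else 0) +
      (if g.pos x < g.pos z then geodesicForm f g z else 0)

lemma IsPolygonalArcForm.hasGeodesicEnds {f : CutoffProfile} {x : ℍ} {g' g : Geodesic} {ω : Form}
    (h : IsPolygonalArcForm f x g' g ω) : HasGeodesicEnds f x g' g ω :=
  ⟨⟨h.smooth, h.closed⟩, h.ends⟩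

lemma geodesicForm_eq_zero (f : CutoffProfile) (g : Geodesic) {z : ℂ} (hz : 0 < z.im)
    (h : Real.sinh 1 ≤ |g.height z|) : geodesicForm f g z = 0 := by
  rw [geodesicForm_eq f g hz, f.kernel_eq_zero_of_le_abs h, zero_smul]

namespace HasGeodesicEnds

open Classical

variable {f : CutoffProfile} {x : ℍ} {g' g : Geodesic} {ω : Form} {φ : ℂ → ℝ}

lemma _root_.Ghost.geodesicForm_fermi_eventually (f : CutoffProfile) (h g : Geodesic) (S : ℝ)
    (e1 : h.1.1 ≠ g.1.2) (e2 : h.1.2 ≠ g.1.2) :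
    ∀ᶠ ζ in endFilter S, geodesicForm f h (g.fermi ζ) = 0 := by
  obtain ⟨-, h⟩ | ⟨-, h⟩ := h.eventually_height_of_ne g S (Real.sinh 1) e1 e2
  · filter_upwards [h] with ζ hζ
    exact geodesicForm_eq_zero f _ (g.fermi_im_pos ζ) (hζ.trans (le_abs_self _))
  · filter_upwards [h] with ζ hζ
    exact geodesicForm_eq_zero f _ (g.fermi_im_pos ζ) ((by linarith : _ ≤ _).trans (neg_le_abs _))

/-- Inside the tube both conditions on the position are eventually decided. If `γ⁺` is an end of the
geodesic in question, the position tends to `+∞` or `-∞` according to which end it is; otherwise the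
height eventually exceeds `sinh 1` and the geodesic form vanishes. -/
lemma eventually_eq (h : HasGeodesicEnds f x g' g ω) (γ : Geodesic) (S : ℝ) :
    ∀ᶠ ζ in endFilter S, ω (γ.fermi ζ) =
      (if g'.1.1 = γ.1.2 then (1 : ℝ) else 0) • geodesicForm f g' (γ.fermi ζ) +
      (if g.1.2 = γ.1.2 then (1 : ℝ) else 0) • geodesicForm f g (γ.fermi ζ) := by
  obtain ⟨R, hR⟩ := h.ends
  have h1 : ∀ᶠ ζ in endFilter S,
      (if g'.pos (γ.fermi ζ) < g'.pos x then geodesicForm f g' (γ.fermi ζ) else 0) =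
      (if g'.1.1 = γ.1.2 then (1 : ℝ) else 0) • geodesicForm f g' (γ.fermi ζ) := by
    by_cases e1 : g'.1.1 = γ.1.2
    · filter_upwards [(g'.tendsto_pos_of_fst_eq γ S e1).eventually_lt_atBot (g'.pos x)] with ζ hζ
      rw [if_pos hζ, if_pos e1, one_smul]
    · by_cases e2 : g'.1.2 = γ.1.2
      · filter_upwards [(g'.tendsto_pos_of_snd_eq γ S e2).eventually_gt_atTop (g'.pos x)] with ζ hζ
        rw [if_neg hζ.not_gt, if_neg e1, zero_smul]
      · filter_upwards [geodesicForm_fermi_eventually f g' γ S e1 e2] with ζ hζ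
        simp [hζ]
  have h2 : ∀ᶠ ζ in endFilter S,
      (if g.pos x < g.pos (γ.fermi ζ) then geodesicForm f g (γ.fermi ζ) else 0) =
      (if g.1.2 = γ.1.2 then (1 : ℝ) else 0) • geodesicForm f g (γ.fermi ζ) := by
    by_cases e1 : g.1.2 = γ.1.2
    · filter_upwards [(g.tendsto_pos_of_snd_eq γ S e1).eventually_gt_atTop (g.pos x)] with ζ hζ
      rw [if_pos hζ, if_pos e1, one_smul]
    · by_cases e2 : g.1.1 = γ.1.2
      · filter_upwards [(g.tendsto_pos_of_fst_eq γ S e2).eventually_lt_atBot (g.pos x)] with ζ hζ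
        rw [if_neg hζ.not_gt, if_neg e1, zero_smul]
      · filter_upwards [geodesicForm_fermi_eventually f g γ S e2 e1] with ζ hζ
        simp [hζ]
  filter_upwards [h1, h2, γ.eventually_dist_fermiH S x R] with ζ e1 e2 e3
  rw [← e1, ← e2]
  exact hR (γ.fermiH ζ) e3

/-- The expansion of a primitive at the end of a geodesic. -/
lemma exists_expansion (h : HasGeodesicEnds f x g' g ω) (hφ : ∀ z ∈ upper, HasFDerivAt φ (ω z) z)
    (γ : Geodesic) (S : ℝ) : ∃ C e₁ e₂ C₁ C₂ : ℝ, ∀ᶠ ζ in endFilter S, φ (γ.fermi ζ) =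
      C + e₁ * f.step (-ζ.re + C₁ * Real.exp (-ζ.im)) +
        e₂ * f.step (ζ.re + C₂ * Real.exp (-ζ.im)) := by
  obtain ⟨T, hT⟩ := eventually_endFilter.1 (h.eventually_eq γ S)
  set e₁ : ℝ := if g'.1.1 = γ.1.2 then (1 : ℝ) else 0 with he₁
  set e₂ : ℝ := if g.1.2 = γ.1.2 then (1 : ℝ) else 0 with he₂
  have k1 : ∃ C₁, ∀ ζ, e₁ * g'.potential f (γ.fermi ζ) =
      e₁ * f.step (-ζ.re + C₁ * Real.exp (-ζ.im)) := by
    by_cases e : g'.1.1 = γ.1.2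
    · obtain ⟨C₁, hC⟩ := g'.height_fermi_of_fst_eq γ e
      exact ⟨C₁, fun ζ => by rw [Geodesic.potential, hC]⟩
    · exact ⟨0, fun ζ => by simp [he₁, e]⟩
  have k2 : ∃ C₂, ∀ ζ, e₂ * g.potential f (γ.fermi ζ) =
      e₂ * f.step (ζ.re + C₂ * Real.exp (-ζ.im)) := by
    by_cases e : g.1.2 = γ.1.2
    · obtain ⟨C₂, hC⟩ := g.height_fermi_of_snd_eq γ e
      exact ⟨C₂, fun ζ => by rw [Geodesic.potential, hC]⟩
    · exact ⟨0, fun ζ => by simp [he₂, e]⟩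
  obtain ⟨C₁, k1⟩ := k1
  obtain ⟨C₂, k2⟩ := k2
  set A : Set ℂ := {ζ | T ≤ ζ.im} ∩ {ζ | |ζ.re| ≤ S}
  have hA : Convex ℝ A := by
    refine (convex_halfSpace_im_ge T).inter ?_
    have : {ζ : ℂ | |ζ.re| ≤ S} = {ζ : ℂ | -S ≤ ζ.re} ∩ {ζ : ℂ | ζ.re ≤ S} := by
      ext ζ
      simp only [Set.mem_ofPred_eq, abs_le, mem_inter_iff]
    rw [this]
    exact (convex_halfSpace_re_ge _).inter (convex_halfSpace_re_le _)
  -- Far out in the tube `φ` and the combination of potentials have the same derivative, so `F` is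
  -- constant on the convex set `A`.
  set F : ℂ → ℝ := fun ζ => φ (γ.fermi ζ) - (e₁ * g'.potential f (γ.fermi ζ) +
    e₂ * g.potential f (γ.fermi ζ)) with hF
  have hd : ∀ ζ ∈ A, HasFDerivWithinAt F (0 : ℂ →L[ℝ] ℝ) A ζ := by
    intro ζ hζ
    have d0 := (hφ _ (γ.fermi_im_pos ζ)).comp ζ (γ.hasFDerivAt_fermi ζ)
    have d1 := ((hasFDerivAt_potential f g' (γ.fermi_im_pos ζ)).comp ζ
      (γ.hasFDerivAt_fermi ζ)).const_mul e₁
    have d2 := ((hasFDerivAt_potential f g (γ.fermi_im_pos ζ)).comp ζ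
      (γ.hasFDerivAt_fermi ζ)).const_mul e₂
    refine (((d0.sub (d1.add d2)).congr_fderiv ?_).hasFDerivWithinAt :)
    rw [hT ζ hζ.1 hζ.2]
    ext <;> simp
  by_cases hS : 0 ≤ S
  swap
  -- For `S < 0` the tube is empty and any constants will do.
  · refine ⟨0, 0, 0, 0, 0, eventually_endFilter.2 ⟨0, fun ζ _ h => ?_⟩⟩
    exact absurd ((abs_nonneg _).trans h) hS
  refine ⟨F ⟨0, T⟩, e₁, e₂, C₁, C₂, eventually_endFilter.2 ⟨T, fun ζ h1 h2 => ?_⟩⟩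
  have h0 : (⟨0, T⟩ : ℂ) ∈ A := ⟨le_refl T, by simpa using hS⟩
  have := hA.norm_image_sub_le_of_norm_hasFDerivWithin_le (C := 0) hd (by simp) h0
    (show ζ ∈ A from ⟨h1, h2⟩)
  simp only [zero_mul, norm_le_zero_iff, sub_eq_zero] at this
  rw [← this, hF, add_assoc, ← k1, ← k2]
  ring

end HasGeodesicEnds

/-! ### Reversal, and boundary values of primitives -/

def Geodesic.rev (g : Geodesic) : Geodesic := ⟨(g.1.2, g.1.1), g.2.symm⟩

lemma Geodesic.height_rev (g : Geodesic) (z : ℂ) : g.rev.height z = -g.height z := by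
  induction g using Geodesic.rec_cases with
  | h1 a b h k =>
    change _ / (z.im * (a - b)) = -(_ / (z.im * (b - a)))
    rw [← neg_sub b a, mul_neg, div_neg]; congr 2; ring
  | h2 a b h k =>
    change _ / (z.im * (a - b)) = -(_ / (z.im * (b - a)))
    rw [← neg_sub b a, mul_neg, div_neg]; congr 2; ring
  | h3 a h =>
    change (a - z.re) / z.im = -((z.re - a) / z.im)
    ring
  | h4 a h =>
    change (z.re - a) / z.im = -((a - z.re) / z.im)
    ring

lemma Geodesic.pos_rev (g : Geodesic) (z : ℂ) : g.rev.pos z = -g.pos z := by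
  induction g using Geodesic.rec_cases with
  | h1 a b h k =>
    change Real.log (‖z - b‖ / ‖z - a‖) = -Real.log (‖z - a‖ / ‖z - b‖)
    rw [← Real.log_inv, inv_div]
  | h2 a b h k =>
    change Real.log (‖z - b‖ / ‖z - a‖) = -Real.log (‖z - a‖ / ‖z - b‖)
    rw [← Real.log_inv, inv_div]
  | h3 a h => rfl
  | h4 a h => exact (neg_neg _).symm

lemma Geodesic.point_rev (g : Geodesic) (t : ℝ) : g.rev.point t = g.point (-t) := by
  have key : ∀ a b : ℝ, pointC (b : OnePoint ℝ) (a : OnePoint ℝ) t =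
      pointC (a : OnePoint ℝ) (b : OnePoint ℝ) (-t) := fun a b => by
    have := Real.exp_pos t
    change (⟨(b + a * Real.exp t ^ 2) / (1 + Real.exp t ^ 2),
        |a - b| * Real.exp t / (1 + Real.exp t ^ 2)⟩ : ℂ) =
      ⟨(a + b * Real.exp (-t) ^ 2) / (1 + Real.exp (-t) ^ 2),
        |b - a| * Real.exp (-t) / (1 + Real.exp (-t) ^ 2)⟩
    rw [abs_sub_comm, Real.exp_neg]
    congr 1 <;> field_simp <;> ring
  apply UpperHalfPlane.ext
  induction g using Geodesic.rec_cases with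
  | h1 a b h k => exact key a b
  | h2 a b h k => exact key a b
  | h3 a h => rfl
  | h4 a h =>
    change (⟨a, Real.exp t⟩ : ℂ) = ⟨a, Real.exp (- -t)⟩
    rw [neg_neg]

lemma geodesicForm_rev (f : CutoffProfile) (g : Geodesic) (z : ℂ) :
    geodesicForm f g.rev z = -geodesicForm f g z := by
  have : g.rev.signedDist = fun z => -g.signedDist z := funext fun z => by
    have := g.height_rev z
    simp only [Geodesic.height] at this
    simp only [Geodesic.signedDist, this, Real.arsinh_neg]
  simp only [geodesicForm, this, abs_neg, fderiv_fun_neg, smul_neg]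

lemma norm_strip_le (ζ : ℂ) : ‖strip ζ‖ ≤ Real.exp ζ.im * (1 + |ζ.re|) := by
  rw [strip, norm_mul, Complex.norm_real, Real.norm_of_nonneg (Real.exp_pos _).le]
  gcongr
  refine (norm_add_le _ _).trans ?_
  simp [add_comm]

lemma Geodesic.le_pos_fermi (g : Geodesic) (ζ : ℂ) : ζ.im ≤ g.pos (g.fermi ζ) := by
  rw [g.pos_fermi, ← Real.log_exp ζ.im, ← strip_im]
  exact Real.log_le_log (strip_im_pos ζ) ((le_abs_self _).trans (Complex.abs_im_le_norm _))

lemma Geodesic.pos_fermi_le (g : Geodesic) (ζ : ℂ) :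
    g.pos (g.fermi ζ) ≤ ζ.im + Real.log (1 + |ζ.re|) := by
  rw [g.pos_fermi, ← Real.log_exp ζ.im, ← Real.log_mul (Real.exp_pos _).ne' (by positivity)]
  refine Real.log_le_log (norm_pos_iff.2 fun h => ?_) (norm_strip_le ζ)
  have := strip_im_pos ζ
  simp [h] at this

lemma Geodesic.exists_dist_le (g : Geodesic) (x : ℍ) (S T₁ T₂ : ℝ) :
    ∃ R, ∀ ζ : ℂ, |ζ.re| ≤ S → T₁ ≤ ζ.im → ζ.im ≤ T₂ → dist x (g.fermiH ζ) ≤ R := by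
  have hc : Continuous g.fermiH :=
    UpperHalfPlane.isEmbedding_coe.continuous_iff.2 g.continuous_fermi
  obtain ⟨R, hR⟩ := (isCompact_Icc.reProdIm (s := Icc (-S) S)
    (isCompact_Icc (a := T₁) (b := T₂))).bddAbove_image
    (continuous_const.dist hc : Continuous fun ζ => dist x (g.fermiH ζ)).continuousOn
  exact ⟨R, fun ζ h1 h2 h3 => hR ⟨ζ, ⟨abs_le.1 h1, h2, h3⟩, rfl⟩⟩

/-- The two rays miss only the perpendicular to `g` through `x`. The form vanishes there at height
at least `sinh 1`, and what remains of the perpendicular is bounded. -/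
lemma geodesicForm_hasGeodesicEnds (f : CutoffProfile) (x : ℍ) (g : Geodesic) :
    HasGeodesicEnds f x g g (geodesicForm f g) := by
  refine ⟨isSmoothClosed_geodesicForm f g, ?_⟩
  -- In the tube the position exceeds the logarithmic coordinate by at most `log (1 + sinh 1)`.
  obtain ⟨R, hR⟩ := g.exists_dist_le x (Real.sinh 1)
    (g.pos x - Real.log (1 + Real.sinh 1)) (g.pos x)
  refine ⟨R, fun z hz => ?_⟩
  rcases lt_trichotomy (g.pos z) (g.pos x) with h | h | h
  · simp [h, h.not_gt]
  · simp only [h, lt_irrefl, if_false, add_zero]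
    apply geodesicForm_eq_zero f g z.im_pos
    by_contra h1
    have e := g.fermi_unfermi z.im_pos
    have e' : g.fermiH (g.unfermi z) = z := UpperHalfPlane.ext e
    have h2 := g.le_pos_fermi (g.unfermi z)
    have h3 := g.pos_fermi_le (g.unfermi z)
    rw [e, h] at h2 h3
    have h4 : |(g.unfermi z).re| ≤ Real.sinh 1 := (not_le.1 h1).le
    have h5 : Real.log (1 + |(g.unfermi z).re|) ≤ Real.log (1 + Real.sinh 1) :=
      Real.log_le_log (by positivity) (by linarith)
    have := hR (g.unfermi z) h4 (by linarith) h2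
    rw [e'] at this
    exact absurd hz this.not_gt
  · simp [h, h.not_gt]

/-- The height of `δ` above `γ` decays like `e^{-t}`, so `δ` eventually enters every tube around
`γ`; there the logarithmic coordinate differs from the position along `γ` by a bounded amount, so it
tends to infinity too. -/
lemma tendsto_endFilter_of_asymptotic (γ δ : Geodesic) (h : γ.1.2 = δ.1.2) {S : ℝ} (hS : 0 < S) :
    Tendsto (fun t => γ.unfermi (δ.point t)) atTop (endFilter S) ∧
    Tendsto (fun t => (γ.unfermi (δ.point t)).re) atTop (𝓝 0) := by
  obtain ⟨C, hC⟩ := γ.height_fermi_of_snd_eq δ h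
  have h1 : ∀ t, (γ.unfermi (δ.point t)).re = C * Real.exp (-t) := fun t => by
    change γ.height _ = _
    rw [δ.coe_point_eq_fermi, hC]
    simp
  have h2 : Tendsto (fun t => (γ.unfermi (δ.point t)).re) atTop (𝓝 0) := by
    simp only [h1]
    simpa using (Real.tendsto_exp_neg_atTop_nhds_zero.const_mul C)
  have h3 : ∀ᶠ t in atTop, |(γ.unfermi (δ.point t)).re| ≤ S := by
    have := h2.abs
    rw [abs_zero] at this
    exact (this.eventually_lt_const hS).mono fun _ h => h.le
  refine ⟨tendsto_inf.2 ⟨tendsto_comap_iff.2 ?_, tendsto_principal.2 h3⟩, h2⟩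
  have h4 : Tendsto (fun t : ℝ => γ.pos (δ.point t) - Real.log (1 + S)) atTop atTop := by
    have h5 : Tendsto (fun t : ℝ => (⟨0, t⟩ : ℂ)) atTop (endFilter 0) :=
      tendsto_inf.2 ⟨tendsto_comap_iff.2 tendsto_id, tendsto_principal.2 (by simp)⟩
    have := (γ.tendsto_pos_of_snd_eq δ 0 h).comp h5
    simp only [Function.comp_def, ← δ.coe_point_eq_fermi] at this
    exact tendsto_atTop_add_const_right _ _ this
  refine tendsto_atTop_mono' _ ?_ h4
  filter_upwards [h3] with t ht
  have h6 := γ.pos_fermi_le (γ.unfermi (δ.point t))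
  rw [γ.fermi_unfermi (δ.point t).im_pos] at h6
  have h7 : Real.log (1 + |(γ.unfermi (δ.point t)).re|) ≤ Real.log (1 + S) :=
    Real.log_le_log (by positivity) (by linarith)
  simp only [Function.comp]
  linarith

lemma exists_geodesic_to (a : OnePoint ℝ) : ∃ γ : Geodesic, γ.1.2 = a := by
  cases a using OnePoint.rec with
  | infty => exact ⟨⟨((0 : ℝ), OnePoint.infty), OnePoint.coe_ne_infty _⟩, rfl⟩
  | coe a => exact ⟨⟨(OnePoint.infty, a), OnePoint.infty_ne_coe _⟩, rfl⟩

/-- The function `c` on the boundary gives the limits of `φ` at the ends of geodesics. -/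
def IsBoundaryValue (f : CutoffProfile) (φ : ℂ → ℝ) (c : OnePoint ℝ → ℝ) : Prop :=
  ∀ (γ : Geodesic) (S : ℝ), ∃ e₁ e₂ C₁ C₂ : ℝ, ∀ᶠ ζ in endFilter S, φ (γ.fermi ζ) =
    c γ.1.2 + e₁ * f.step (-ζ.re + C₁ * Real.exp (-ζ.im)) +
      e₂ * f.step (ζ.re + C₂ * Real.exp (-ζ.im))

/-- The step function is identically `0` near `0`, and `δ` approaches the core of the tube; both
step terms therefore vanish after some time, and the constant is attained exactly, not only in the
limit. -/
lemma eventually_eq_of_expansion {f : CutoffProfile} {φ : ℂ → ℝ} {γ : Geodesic} {S : ℝ}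
    {C e₁ e₂ C₁ C₂ : ℝ} (h : ∀ᶠ ζ in endFilter S, φ (γ.fermi ζ) =
      C + e₁ * f.step (-ζ.re + C₁ * Real.exp (-ζ.im)) +
      e₂ * f.step (ζ.re + C₂ * Real.exp (-ζ.im))) (hS : 0 < S) {δ : Geodesic}
    (hδ : γ.1.2 = δ.1.2) : ∀ᶠ t in atTop, φ (δ.point t) = C := by
  obtain ⟨h1, h2⟩ := tendsto_endFilter_of_asymptotic γ δ hδ hS
  have h3 : Tendsto (fun t => Real.exp (-(γ.unfermi (δ.point t)).im)) atTop (𝓝 0) :=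
    Real.tendsto_exp_neg_atTop_nhds_zero.comp ((tendsto_im_endFilter S).comp h1)
  have hpos : 0 < Real.sinh (1 / 2) := Real.sinh_pos_iff.2 (by norm_num)
  have h4 := (h2.neg.add (h3.const_mul C₁)).abs
  have h5 := (h2.add (h3.const_mul C₂)).abs
  simp only [neg_zero, mul_zero, add_zero, abs_zero] at h4 h5
  filter_upwards [h1.eventually h, h4.eventually_lt_const hpos,
    h5.eventually_lt_const hpos] with t e k1 k2
  rw [γ.fermi_unfermi (δ.point t).im_pos] at e
  rw [e, f.step_eq_zero k1.le, f.step_eq_zero k2.le]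
  ring

namespace IsBoundaryValue

variable {f : CutoffProfile} {φ : ℂ → ℝ} {c : OnePoint ℝ → ℝ}

lemma eventually_atTop (h : IsBoundaryValue f φ c) (γ : Geodesic) :
    ∀ᶠ t in atTop, φ (γ.point t) = c γ.1.2 := by
  obtain ⟨e₁, e₂, C₁, C₂, hφ⟩ := h γ 1
  exact eventually_eq_of_expansion hφ one_pos rfl

lemma eventually_atBot (h : IsBoundaryValue f φ c) (γ : Geodesic) :
    ∀ᶠ t in atBot, φ (γ.point t) = c γ.1.1 := by
  have := tendsto_neg_atBot_atTop.eventually (h.eventually_atTop γ.rev)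
  filter_upwards [this] with t ht
  rw [γ.point_rev, neg_neg] at ht
  exact ht

end IsBoundaryValue

/-- The constant of an expansion depends only on the endpoint: it can be read on one geodesic chosen
once and for all for this endpoint. -/
lemma HasGeodesicEnds.exists_boundaryValue {f : CutoffProfile} {x : ℍ} {g' g : Geodesic} {ω : Form}
    {φ : ℂ → ℝ} (h : HasGeodesicEnds f x g' g ω) (hφ : ∀ z ∈ upper, HasFDerivAt φ (ω z) z) :
    ∃ c, IsBoundaryValue f φ c := by
  choose δ hδ using exists_geodesic_to
  choose C e₁ e₂ C₁ C₂ hC using fun a => h.exists_expansion hφ (δ a) 1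
  refine ⟨C, fun γ S => ?_⟩
  -- Comparing the constants requires a tube of positive width; the expansion is restricted to the
  -- width `S` at the end.
  obtain ⟨D, e₁', e₂', D₁, D₂, hD⟩ := h.exists_expansion hφ γ (max S 1)
  have hS : 0 < max S 1 := by positivity
  have hCD : D = C γ.1.2 := by
    have k1 : ∀ᶠ t in atTop, φ ((δ γ.1.2).point t) = D :=
      eventually_eq_of_expansion hD hS (hδ _).symm
    have k2 : ∀ᶠ t in atTop, φ ((δ γ.1.2).point t) = C γ.1.2 :=
      eventually_eq_of_expansion (hC γ.1.2) one_pos rfl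
    obtain ⟨t, e1, e2⟩ := (k1.and k2).exists
    rw [← e1, e2]
  refine ⟨e₁', e₂', D₁, D₂, ?_⟩
  rw [← hCD]
  obtain ⟨T, hT⟩ := eventually_endFilter.1 hD
  exact eventually_endFilter.2 ⟨T, fun ζ k1 k2 => hT ζ k1 (k2.trans (le_max_left _ _))⟩

/-- The boundary values of the potential of a geodesic. -/
lemma isBoundaryValue_potential (f : CutoffProfile) (g : Geodesic) :
    IsBoundaryValue f (g.potential f) fun a => orient a g.1.2 g.1.1 / 2 := by
  intro γ S
  by_cases h1 : g.1.1 = γ.1.2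
  · obtain ⟨C, hC⟩ := g.height_fermi_of_fst_eq γ h1
    refine ⟨1, 0, C, 0, Eventually.of_forall fun ζ => ?_⟩
    have : orient γ.1.2 g.1.2 γ.1.2 = 0 := by
      rw [← orient_rotate, ← orient_rotate, orient_self_left]
    simp [Geodesic.potential, hC, h1, this]
  by_cases h2 : g.1.2 = γ.1.2
  · obtain ⟨C, hC⟩ := g.height_fermi_of_snd_eq γ h2
    refine ⟨0, 1, 0, C, Eventually.of_forall fun ζ => ?_⟩
    simp [Geodesic.potential, hC, h2, orient_self_left]
  refine ⟨0, 0, 0, 0, ?_⟩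
  obtain ⟨e, h⟩ | ⟨e, h⟩ := g.eventually_height_of_ne γ S (Real.sinh 1) h1 h2
  · filter_upwards [h] with ζ hζ
    rw [Geodesic.potential, f.step_of_sinh_le hζ, e]
    simp
  · filter_upwards [h] with ζ hζ
    rw [Geodesic.potential, f.step_of_le_neg_sinh hζ, e]
    norm_num

/-! ### The integral over the hyperbolic plane of a product of closed forms -/

/-- The coefficient of `a ∧ b`. -/
def wedge (a b : ℂ →L[ℝ] ℝ) : ℝ := a 1 * b Complex.I - a Complex.I * b 1

lemma det_complex (L : ℂ →L[ℝ] ℂ) :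
    L.det = (L 1).re * (L Complex.I).im - (L 1).im * (L Complex.I).re := by
  rw [ContinuousLinearMap.det, ← LinearMap.det_toMatrix Complex.basisOneI, Matrix.det_fin_two]
  simp [LinearMap.toMatrix_apply]
  ring

lemma apply_eq_re_im (a : ℂ →L[ℝ] ℝ) (v : ℂ) : a v = v.re * a 1 + v.im * a Complex.I := by
  have : v = v.re • (1 : ℂ) + v.im • Complex.I := by apply Complex.ext <;> simp
  conv_lhs => rw [this]
  rw [map_add, map_smul, map_smul, smul_eq_mul, smul_eq_mul]

lemma wedge_comp (a b : ℂ →L[ℝ] ℝ) (L : ℂ →L[ℝ] ℂ) :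
    wedge (a.comp L) (b.comp L) = L.det * wedge a b := by
  simp only [wedge, ContinuousLinearMap.comp_apply, det_complex]
  rw [apply_eq_re_im a (L 1), apply_eq_re_im a (L Complex.I), apply_eq_re_im b (L 1),
    apply_eq_re_im b (L Complex.I)]
  ring

/-- The derivative is the shear `1 ↦ 1`, `i ↦ s + i`, of determinant `1`, followed by multiplication
by a nonzero complex number `κ`; the determinant is `|κ|²`. -/
lemma Geodesic.det_fermi'_pos (g : Geodesic) (ζ : ℂ) : 0 < (g.fermi' ζ).det := by
  have h : g.chart.det ≠ 0 := g.chart.det_pos.ne'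
  have h1 := g.chart.denom_ne (strip_im_pos ζ)
  set κ : ℂ := (g.chart.det / (g.chart.c * strip ζ + g.chart.d) ^ 2 : ℂ) * (Real.exp ζ.im : ℂ)
    with hκ
  have hκ0 : κ ≠ 0 := by
    refine mul_ne_zero (div_ne_zero (by exact_mod_cast h) (pow_ne_zero _ h1)) ?_
    exact_mod_cast (Real.exp_pos _).ne'
  have : (g.fermi' ζ).det = Complex.normSq κ := by
    rw [det_complex, Geodesic.fermi', ← hκ]
    simp [Complex.normSq_apply]
    ring
  rw [this]
  exact Complex.normSq_pos.2 hκ0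

lemma Geodesic.image_fermi (g : Geodesic) : g.fermi '' univ = upper := by
  ext z
  constructor
  · rintro ⟨ζ, -, rfl⟩; exact g.fermi_im_pos ζ
  · exact fun hz => ⟨g.unfermi z, mem_univ _, g.fermi_unfermi hz⟩

lemma Geodesic.injective_fermi (g : Geodesic) : Function.Injective g.fermi :=
  Function.LeftInverse.injective g.unfermi_fermi

lemma Geodesic.integral_fermi (g : Geodesic) (F : ℂ → ℝ) :
    (IntegrableOn F upper ↔
      Integrable fun q : ℝ × ℝ => (g.fermi' ⟨q.1, q.2⟩).det * F (g.fermi ⟨q.1, q.2⟩)) ∧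
    ∫ z in upper, F z =
      ∫ q : ℝ × ℝ, (g.fermi' ⟨q.1, q.2⟩).det * F (g.fermi ⟨q.1, q.2⟩) := by
  have hd : ∀ ζ ∈ (univ : Set ℂ), HasFDerivWithinAt g.fermi (g.fermi' ζ) univ ζ :=
    fun ζ _ => (g.hasFDerivAt_fermi ζ).hasFDerivWithinAt
  have hi : InjOn g.fermi univ := g.injective_fermi.injOn
  have h1 := integrableOn_image_iff_integrableOn_abs_det_fderiv_smul volume MeasurableSet.univ hd hi F
  have h2 := integral_image_eq_integral_abs_det_fderiv_smul volume MeasurableSet.univ hd hi F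
  have e : ∀ ζ, |(g.fermi' ζ).det| = (g.fermi' ζ).det := fun ζ => abs_of_pos (g.det_fermi'_pos ζ)
  rw [g.image_fermi] at h1 h2
  simp only [e, smul_eq_mul, integrableOn_univ, setIntegral_univ] at h1 h2
  have hv := Complex.volume_preserving_equiv_real_prod.symm
  rw [h1, h2]
  constructor
  · rw [← hv.integrable_comp_emb (MeasurableEquiv.measurableEmbedding _)]; rfl
  · rw [← hv.integral_comp']; rfl

lemma CutoffProfile.abs_step_le (f : CutoffProfile) (s : ℝ) : |f.step s| ≤ 1 / 2 := by
  have h : ∀ s, 0 ≤ s → |f.step s| ≤ 1 / 2 := fun s hs => by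
    have := f.mem_Icc _ (Real.arsinh_nonneg_iff.2 hs)
    rw [f.step_of_nonneg hs, abs_le]
    constructor <;> linarith [this.1, this.2]
  rcases le_total 0 s with hs | hs
  · exact h s hs
  · rw [← abs_neg, ← f.step_neg]; exact h _ (by linarith)

/-! ### The contribution of one end of a geodesic -/

section Ends

open Real (smoothTransition)

lemma deriv_smoothTransition_eq_zero {x : ℝ} (h : x < 0 ∨ 1 < x) :
    deriv smoothTransition x = 0 := by
  rcases h with h | h
  · have : smoothTransition =ᶠ[𝓝 x] fun _ => 0 := by
      filter_upwards [eventually_lt_nhds h] with y hy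
      exact smoothTransition.zero_of_nonpos hy.le
    rw [this.deriv_eq]; simp
  · have : smoothTransition =ᶠ[𝓝 x] fun _ => 1 := by
      filter_upwards [eventually_gt_nhds h] with y hy
      exact smoothTransition.one_of_one_le hy.le
    rw [this.deriv_eq]; simp

lemma contDiff_smoothTransition {n : ℕ∞} : ContDiff ℝ n smoothTransition :=
  smoothTransition.contDiff

lemma hasDerivAt_smoothTransition (x : ℝ) :
    HasDerivAt smoothTransition (deriv smoothTransition x) x :=
  ((contDiff_smoothTransition (n := 1)).differentiable (by simp) x).hasDerivAt

lemma continuous_deriv_smoothTransition : Continuous (deriv smoothTransition) :=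
  (contDiff_smoothTransition (n := 1)).continuous_deriv (by simp)

lemma exists_deriv_smoothTransition_le : ∃ M, ∀ x, |deriv smoothTransition x| ≤ M := by
  have : HasCompactSupport (deriv smoothTransition) :=
    HasCompactSupport.of_support_subset_isCompact (isCompact_Icc (a := 0) (b := 1)) fun x hx => by
      by_contra h
      rw [Set.mem_Icc, not_and_or, not_le, not_le] at h
      exact hx (deriv_smoothTransition_eq_zero h)
  exact this.exists_bound_of_continuous continuous_deriv_smoothTransition

/-- The value at the point of coordinates `s, τ` of an expansion at the end of a geodesic. -/
def expansion (f : CutoffProfile) (C e₁ e₂ C₁ C₂ s τ : ℝ) : ℝ :=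
  C + e₁ * f.step (-s + C₁ * Real.exp (-τ)) + e₂ * f.step (s + C₂ * Real.exp (-τ))

def expansionDeriv (f : CutoffProfile) (e₁ e₂ C₁ C₂ s τ : ℝ) : ℝ :=
  e₁ * (f.kernel (-s + C₁ * Real.exp (-τ)) * (C₁ * -Real.exp (-τ))) +
    e₂ * (f.kernel (s + C₂ * Real.exp (-τ)) * (C₂ * -Real.exp (-τ)))

variable (f : CutoffProfile) (C e₁ e₂ C₁ C₂ T : ℝ)

lemma hasDerivAt_expansion (s τ : ℝ) :
    HasDerivAt (expansion f C e₁ e₂ C₁ C₂ s) (expansionDeriv f e₁ e₂ C₁ C₂ s τ) τ := by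
  have h0 : HasDerivAt (fun τ : ℝ => Real.exp (-τ)) (-Real.exp (-τ)) τ := by
    simpa using (hasDerivAt_neg τ).exp
  have h1 := (f.hasDerivAt_step _).comp τ ((h0.const_mul C₁).const_add (-s))
  have h2 := (f.hasDerivAt_step _).comp τ ((h0.const_mul C₂).const_add s)
  exact ((h1.const_mul e₁).const_add C).add (h2.const_mul e₂)

def cutExpansionDeriv (s τ : ℝ) : ℝ :=
  deriv smoothTransition (τ - T) * expansion f C e₁ e₂ C₁ C₂ s τ +
    smoothTransition (τ - T) * expansionDeriv f e₁ e₂ C₁ C₂ s τ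

lemma hasDerivAt_cutExpansion (s τ : ℝ) :
    HasDerivAt (fun τ => smoothTransition (τ - T) * expansion f C e₁ e₂ C₁ C₂ s τ)
      (cutExpansionDeriv f C e₁ e₂ C₁ C₂ T s τ) τ := by
  have h1 : HasDerivAt (fun τ => smoothTransition (τ - T)) (deriv smoothTransition (τ - T)) τ := by
    simpa using (hasDerivAt_smoothTransition (τ - T)).comp_sub_const τ T
  exact h1.mul (hasDerivAt_expansion f C e₁ e₂ C₁ C₂ s τ)

lemma continuous_cutExpansionDeriv :
    Continuous fun q : ℝ × ℝ => cutExpansionDeriv f C e₁ e₂ C₁ C₂ T q.1 q.2 := by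
  have h1 := f.continuous_step
  have h2 := f.continuous_kernel
  have h3 := continuous_deriv_smoothTransition
  have h4 : Continuous smoothTransition := smoothTransition.continuous
  unfold cutExpansionDeriv expansion expansionDeriv
  fun_prop

/-- An integrable bound, uniform in `s`, which justifies Fubini's theorem and the integration in
`τ`. -/
lemma exists_cutExpansionDeriv_le : ∃ M, ∀ s τ, |cutExpansionDeriv f C e₁ e₂ C₁ C₂ T s τ| ≤
    (Ici T).indicator (fun τ => M * Real.exp (-τ)) τ := by
  obtain ⟨M₁, hM₁⟩ := exists_deriv_smoothTransition_le
  obtain ⟨M₂, hM₂0, hM₂⟩ := f.exists_kernel_le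
  have hM₁0 : 0 ≤ M₁ := (abs_nonneg _).trans (hM₁ 0)
  set A := |C| + |e₁| + |e₂|
  set B := |e₁| * (M₂ * |C₁|) + |e₂| * (M₂ * |C₂|)
  have hE : ∀ s τ, |expansion f C e₁ e₂ C₁ C₂ s τ| ≤ A := fun s τ => by
    refine (abs_add_three _ _ _).trans ?_
    rw [abs_mul, abs_mul]
    have h1 := mul_le_mul_of_nonneg_left (f.abs_step_le (-s + C₁ * Real.exp (-τ))) (abs_nonneg e₁)
    have h2 := mul_le_mul_of_nonneg_left (f.abs_step_le (s + C₂ * Real.exp (-τ))) (abs_nonneg e₂)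
    have := abs_nonneg e₁
    have := abs_nonneg e₂
    simp only [A]
    linarith
  have hE' : ∀ s τ, |expansionDeriv f e₁ e₂ C₁ C₂ s τ| ≤ B * Real.exp (-τ) := fun s τ => by
    refine (abs_add_le _ _).trans ?_
    simp only [abs_mul, abs_neg, Real.abs_exp, B, add_mul, ← mul_assoc]
    gcongr <;> exact hM₂ _
  -- The derivative of the cutoff lives on `[T, T + 1]`, where `e^{T + 1} e^{-τ} ≥ 1`; the
  -- derivative of the expansion itself is at most `B e^{-τ}`.
  refine ⟨M₁ * A * Real.exp (T + 1) + B, fun s τ => ?_⟩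
  by_cases hτ : τ < T
  · rw [cutExpansionDeriv, deriv_smoothTransition_eq_zero (Or.inl (by linarith)),
      smoothTransition.zero_of_nonpos (by linarith), indicator_of_notMem (by simpa using hτ)]
    simp
  · rw [indicator_of_mem (by simpa using hτ), add_mul]
    refine (abs_add_le _ _).trans (add_le_add ?_ ?_)
    · by_cases h : 1 < τ - T
      · rw [deriv_smoothTransition_eq_zero (Or.inr h)]
        simp only [zero_mul, abs_zero]
        positivity
      · rw [abs_mul, mul_assoc, ← Real.exp_add]
        have h1 : 1 ≤ Real.exp (T + 1 + -τ) := Real.one_le_exp (by linarith)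
        have h2 := mul_le_mul (hM₁ (τ - T)) (hE s τ) (abs_nonneg _) hM₁0
        exact h2.trans (le_mul_of_one_le_right (by positivity) h1)
    · rw [abs_mul, abs_of_nonneg (smoothTransition.nonneg _)]
      refine (mul_le_of_le_one_left (abs_nonneg _) (smoothTransition.le_one _)).trans (hE' s τ)

lemma integrable_indicator_exp (M : ℝ) :
    Integrable ((Ici T).indicator fun τ => M * Real.exp (-τ)) := by
  rw [integrable_indicator_iff measurableSet_Ici, integrableOn_Ici_iff_integrableOn_Ioi]
  have := (exp_neg_integrableOn_Ioi T one_pos).const_mul M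
  simpa [IntegrableOn] using this

/-- The cut-off expansion goes from `0` for `τ ≤ T` to its limit at `τ = ∞`, where the exponentially
small shifts inside the step functions have disappeared. -/
lemma integral_cutExpansionDeriv (s : ℝ) :
    ∫ τ, cutExpansionDeriv f C e₁ e₂ C₁ C₂ T s τ = C + e₁ * f.step (-s) + e₂ * f.step s := by
  obtain ⟨M, hM⟩ := exists_cutExpansionDeriv_le f C e₁ e₂ C₁ C₂ T
  have hint : Integrable (cutExpansionDeriv f C e₁ e₂ C₁ C₂ T s) := by
    refine (integrable_indicator_exp T M).mono' ?_ (Eventually.of_forall (hM s))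
    exact ((continuous_cutExpansionDeriv f C e₁ e₂ C₁ C₂ T).comp
      (Continuous.prodMk_right s)).aestronglyMeasurable
  rw [integral_of_hasDerivAt_of_tendsto (hasDerivAt_cutExpansion f C e₁ e₂ C₁ C₂ T s) hint
    (m := 0) (n := C + e₁ * f.step (-s) + e₂ * f.step s), sub_zero]
  · refine tendsto_const_nhds.congr' ?_
    filter_upwards [eventually_le_atBot T] with τ hτ
    rw [smoothTransition.zero_of_nonpos (by linarith), zero_mul]
  · have h0 : Tendsto (expansion f C e₁ e₂ C₁ C₂ s) atTop
        (𝓝 (C + e₁ * f.step (-s + C₁ * 0) + e₂ * f.step (s + C₂ * 0))) := by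
      have h1 := Real.tendsto_exp_neg_atTop_nhds_zero
      refine Tendsto.add (Tendsto.add tendsto_const_nhds ?_) ?_
      · exact ((f.continuous_step.tendsto _).comp ((h1.const_mul C₁).const_add (-s))).const_mul e₁
      · exact ((f.continuous_step.tendsto _).comp ((h1.const_mul C₂).const_add s)).const_mul e₂
    simp only [mul_zero, add_zero] at h0
    refine h0.congr' ?_
    filter_upwards [eventually_ge_atTop (T + 1)] with τ hτ
    rw [smoothTransition.one_of_one_le (by linarith), one_mul]

/-- Integrating first in `τ` leaves `C` plus an odd function of `s`. Against the even kernel, of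
integral `1`, the odd function contributes nothing. -/
lemma integral_kernel_mul_cutExpansionDeriv :
    Integrable (fun q : ℝ × ℝ => -(f.kernel q.1 * cutExpansionDeriv f C e₁ e₂ C₁ C₂ T q.1 q.2)) ∧
    ∫ q : ℝ × ℝ, -(f.kernel q.1 * cutExpansionDeriv f C e₁ e₂ C₁ C₂ T q.1 q.2) = -C := by
  obtain ⟨M, hM⟩ := exists_cutExpansionDeriv_le f C e₁ e₂ C₁ C₂ T
  have hint : Integrable
      fun q : ℝ × ℝ => -(f.kernel q.1 * cutExpansionDeriv f C e₁ e₂ C₁ C₂ T q.1 q.2) := by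
    refine (f.integrable_kernel.norm.mul_prod (integrable_indicator_exp T M)).mono' ?_ ?_
    · exact (((f.continuous_kernel.comp continuous_fst).mul
        (continuous_cutExpansionDeriv f C e₁ e₂ C₁ C₂ T)).neg).aestronglyMeasurable
    · refine Eventually.of_forall fun q => ?_
      rw [norm_neg, norm_mul]
      exact mul_le_mul_of_nonneg_left (hM q.1 q.2) (norm_nonneg _)
  refine ⟨hint, ?_⟩
  rw [Measure.volume_eq_prod, integral_prod _ hint]
  simp only [integral_neg, integral_const_mul, integral_cutExpansionDeriv]
  have e : ∀ s, f.kernel s * (C + e₁ * f.step (-s) + e₂ * f.step s) =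
      C * f.kernel s + (e₂ - e₁) * (f.kernel s * f.step s) := fun s => by
    rw [f.step_neg]; ring
  simp only [e]
  rw [integral_add (f.integrable_kernel.const_mul C)
    ((f.integrable_kernel_mul f.continuous_step).const_mul _), integral_const_mul,
    integral_const_mul, f.integral_kernel, f.integral_kernel_mul_step]
  ring

/-- The cutoff along `g`. -/
def Geodesic.cut (g : Geodesic) (T : ℝ) (z : ℂ) : ℝ := smoothTransition ((g.unfermi z).im - T)

lemma Geodesic.contDiffOn_cut (g : Geodesic) (T : ℝ) :
    ContDiffOn ℝ (⊤ : ℕ∞) (g.cut T) upper := by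
  refine contDiff_smoothTransition.comp_contDiffOn (ContDiffOn.sub ?_ contDiffOn_const)
  refine ContDiffOn.log ?_ fun z hz => (g.chart.inv.im_app_pos hz).ne'
  exact Complex.imCLM.contDiff.comp_contDiffOn g.chart.inv.contDiffOn_app

variable {f C e₁ e₂ C₁ C₂ T}

/-- In coordinates along `γ` the geodesic form is `kernel s ds`, so the product only sees the
derivative in `τ` of the cut-off primitive. -/
lemma integral_wedge_cut {γ : Geodesic} {φ : ℂ → ℝ} {u' : Form}
    (hφ : ∀ ζ : ℂ, T ≤ ζ.im → |ζ.re| ≤ Real.sinh 1 →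
      φ (γ.fermi ζ) = expansion f C e₁ e₂ C₁ C₂ ζ.re ζ.im)
    (hu : ∀ z ∈ upper, HasFDerivAt (fun z => γ.cut T z * φ z) (u' z) z) :
    IntegrableOn (fun z => wedge (u' z) (geodesicForm f γ z)) upper ∧
    ∫ z in upper, wedge (u' z) (geodesicForm f γ z) = -C := by
  have key : ∀ q : ℝ × ℝ, (γ.fermi' ⟨q.1, q.2⟩).det *
      wedge (u' (γ.fermi ⟨q.1, q.2⟩)) (geodesicForm f γ (γ.fermi ⟨q.1, q.2⟩)) =
      -(f.kernel q.1 * cutExpansionDeriv f C e₁ e₂ C₁ C₂ T q.1 q.2) := by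
    rintro ⟨s, τ⟩
    set ζ : ℂ := ⟨s, τ⟩
    have h1 := (hasFDerivAt_potential f γ (γ.fermi_im_pos ζ)).comp ζ (γ.hasFDerivAt_fermi ζ)
    have h2 : HasFDerivAt (γ.potential f ∘ γ.fermi) (f.kernel s • Complex.reCLM) ζ := by
      have : γ.potential f ∘ γ.fermi = fun ζ => f.step (Complex.reCLM ζ) := funext fun ζ => by
        simp [Geodesic.potential, γ.height_fermi]
      rw [this]
      exact (f.hasDerivAt_step s).comp_hasFDerivAt ζ Complex.reCLM.hasFDerivAt
    have h3 := h1.unique h2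
    rw [← wedge_comp, h3]
    have h4 : wedge ((u' (γ.fermi ζ)).comp (γ.fermi' ζ)) (f.kernel s • Complex.reCLM) =
        -(f.kernel s * ((u' (γ.fermi ζ)).comp (γ.fermi' ζ) Complex.I)) := by
      simp [wedge]
      ring
    rw [h4]
    -- The expansion of `φ` is only known for `|s| ≤ sinh 1`; beyond, the kernel vanishes.
    by_cases hs : Real.sinh 1 ≤ |s|
    · simp [f.kernel_eq_zero_of_le_abs hs]
    congr 2
    have h5 := (hu _ (γ.fermi_im_pos ζ)).comp ζ (γ.hasFDerivAt_fermi ζ)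
    have h6 : HasDerivAt (fun τ : ℝ => (⟨s, τ⟩ : ℂ)) Complex.I τ := by
      have : (fun τ : ℝ => (⟨s, τ⟩ : ℂ)) = fun τ : ℝ => (s : ℂ) + (τ : ℂ) * Complex.I :=
        funext fun τ => by apply Complex.ext <;> simp
      rw [this]
      simpa using ((Complex.ofRealCLM.hasDerivAt (x := τ)).mul_const Complex.I).const_add (s : ℂ)
    have h7 := HasFDerivAt.comp_hasDerivAt τ (f := fun τ : ℝ => (⟨s, τ⟩ : ℂ)) h5 h6
    refine h7.unique ((hasDerivAt_cutExpansion f C e₁ e₂ C₁ C₂ T s τ).congr_of_eventuallyEq ?_)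
    refine Eventually.of_forall fun τ => ?_
    simp only [Function.comp, Geodesic.cut, γ.unfermi_fermi]
    by_cases hτ : T ≤ τ
    · rw [hφ _ hτ (not_le.1 hs).le]
    · rw [smoothTransition.zero_of_nonpos (by linarith), zero_mul, zero_mul]
  obtain ⟨h1, h2⟩ := γ.integral_fermi fun z => wedge (u' z) (geodesicForm f γ z)
  rw [h1, h2]
  simp only [key]
  exact integral_kernel_mul_cutExpansionDeriv f C e₁ e₂ C₁ C₂ T

end Ends

/-! ### Stokes' theorem and the splitting of a form into its ends and a compact part -/

/-- The coefficient of the exterior derivative. -/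
def curl (V : Form) (z : ℂ) : ℝ := fderiv ℝ V z 1 Complex.I - fderiv ℝ V z Complex.I 1

lemma curl_congr {V W : Form} (h : EqOn V W upper) {z : ℂ} (hz : z ∈ upper) :
    curl V z = curl W z := by
  have : V =ᶠ[𝓝 z] W := by
    filter_upwards [upper_mem_nhds hz] with w hw using h hw
  simp only [curl, this.fderiv_eq]

lemma curl_smul {u : ℂ → ℝ} {V : Form} {u' : ℂ →L[ℝ] ℝ} {z : ℂ} (hu : HasFDerivAt u u' z)
    (hV : DifferentiableAt ℝ V z) (hc : curl V z = 0) :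
    curl (fun z => u z • V z) z = wedge u' (V z) := by
  have := (hu.smul hV.hasFDerivAt).fderiv
  unfold curl at *
  change fderiv ℝ (fun z => u z • V z) z = _ at this
  rw [this]
  simp only [_root_.add_apply, _root_.smul_apply,
    ContinuousLinearMap.smulRight_apply, smul_eq_mul, wedge]
  linear_combination u z * hc

lemma curl_add {V W : Form} {z : ℂ} (hV : DifferentiableAt ℝ V z) (hW : DifferentiableAt ℝ W z) :
    curl (fun z => V z + W z) z = curl V z + curl W z := by
  unfold curl
  rw [fderiv_fun_add hV hW]
  simp only [_root_.add_apply]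
  ring

lemma curl_sub {V W : Form} {z : ℂ} (hV : DifferentiableAt ℝ V z) (hW : DifferentiableAt ℝ W z) :
    curl (fun z => V z - W z) z = curl V z - curl W z := by
  unfold curl
  rw [fderiv_fun_sub hV hW]
  simp only [_root_.sub_apply]
  ring

lemma IsSmoothClosed.curl_eq_zero {ω : Form} (h : IsSmoothClosed ω) {z : ℂ} (hz : z ∈ upper) :
    curl ω z = 0 := sub_eq_zero.2 (h.closed ⟨z, hz⟩ 1 Complex.I)

lemma IsSmoothClosed.differentiableAt {ω : Form} (h : IsSmoothClosed ω) {z : ℂ} (hz : z ∈ upper) :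
    DifferentiableAt ℝ ω z :=
  (h.smooth.contDiffAt (upper_mem_nhds hz)).differentiableAt (by simp)

/-- Integration by parts against the constant function `1`. -/
lemma integral_fderiv_eq_zero {P : ℂ → ℝ} (hP : ContDiff ℝ 1 P) (hc : HasCompactSupport P) (v : ℂ) :
    Integrable (fun z => fderiv ℝ P z v) ∧ ∫ z, fderiv ℝ P z v = 0 := by
  have h1 : Continuous fun z => fderiv ℝ P z v :=
    (hP.continuous_fderiv (by simp)).clm_apply continuous_const
  have h2 : HasCompactSupport fun z => fderiv ℝ P z v := by
    refine (hc.fderiv ℝ).mono fun z hz h => hz ?_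
    simp [h]
  have h3 := h1.integrable_of_hasCompactSupport (μ := volume) h2
  refine ⟨h3, ?_⟩
  have := integral_mul_fderiv_eq_neg_fderiv_mul_of_integrable (𝕜 := ℝ) (μ := (volume : Measure ℂ))
    (f := fun _ => (1 : ℝ)) (g := P) (v := v) (by simp) (by simpa using h3)
    (by simpa using hP.continuous.integrable_of_hasCompactSupport hc)
    (fun _ _ => differentiableAt_const _) (fun x _ => hP.differentiable (by simp) x)
  simpa using this

/-- Stokes' theorem without boundary term. Since `K` is compact in the open half-plane, the form
extended by `0` is of class `C¹` on the whole plane, and each partial derivative has integral `0`.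
-/
lemma integral_curl_eq_zero {V : Form} (hV : ContDiffOn ℝ 1 V upper) {K : Set ℂ}
    (hK : IsCompact K) (hKu : K ⊆ upper) (h0 : ∀ z ∈ upper, z ∉ K → V z = 0) :
    IntegrableOn (curl V) upper ∧ ∫ z in upper, curl V z = 0 := by
  set W : Form := upper.indicator V with hW
  have hVW : EqOn V W upper := fun z hz => (indicator_of_mem hz V).symm
  have hW0 : ∀ z, z ∉ K → W z = 0 := fun z hz => by
    by_cases h : z ∈ upper
    · rw [hW, indicator_of_mem h, h0 z h hz]
    · rw [hW, indicator_of_notMem h]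
  have hWs : ContDiff ℝ 1 W := by
    rw [contDiff_iff_contDiffAt]
    intro z
    by_cases h : z ∈ upper
    · refine (hV.contDiffAt (upper_mem_nhds h)).congr_of_eventuallyEq ?_
      filter_upwards [upper_mem_nhds h] with w hw using (hVW hw).symm
    · refine (contDiffAt_const (c := 0)).congr_of_eventuallyEq ?_
      filter_upwards [hK.isClosed.isOpen_compl.mem_nhds fun k => h (hKu k)] with w hw using hW0 w hw
  have key : ∀ w v : ℂ, Integrable (fun z => fderiv ℝ W z v w) ∧ ∫ z, fderiv ℝ W z v w = 0 := by
    intro w v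
    have h1 : ContDiff ℝ 1 fun z => W z w := hWs.clm_apply contDiff_const
    have h2 : HasCompactSupport fun z => W z w := by
      refine HasCompactSupport.of_support_subset_isCompact hK fun z hz => ?_
      by_contra h
      exact hz (by simp [hW0 z h])
    have h3 : ∀ z, fderiv ℝ (fun z => W z w) z v = fderiv ℝ W z v w := fun z => by
      rw [fderiv_clm_apply (hWs.differentiable (by simp) z) (differentiableAt_const w)]
      simp
    have := integral_fderiv_eq_zero h1 h2 v
    simpa only [h3] using this
  have e : EqOn (curl V) (curl W) upper := fun z hz => curl_congr hVW hz
  have hout : ∀ z, z ∉ upper → curl W z = 0 := fun z hz => by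
    have : W =ᶠ[𝓝 z] fun _ => 0 := by
      filter_upwards [hK.isClosed.isOpen_compl.mem_nhds fun k => hz (hKu k)] with w hw using hW0 w hw
    simp [curl, this.fderiv_eq]
  have hint : Integrable (curl W) := (key _ _).1.sub (key _ _).1
  refine ⟨(integrableOn_congr_fun e isOpen_upper.measurableSet).2 hint.integrableOn, ?_⟩
  rw [setIntegral_congr_fun isOpen_upper.measurableSet e,
    setIntegral_eq_integral_of_forall_compl_eq_zero hout]
  simp only [curl]
  rw [integral_sub (key _ _).1 (key _ _).1, (key _ _).2, (key _ _).2, sub_zero]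

/-- The part of the geodesic form near the end of the geodesic. -/
def endForm (f : CutoffProfile) (g : Geodesic) (T : ℝ) : Form := fun z =>
  g.cut T z • geodesicForm f g z

lemma contDiffOn_endForm (f : CutoffProfile) (g : Geodesic) (T : ℝ) :
    ContDiffOn ℝ (⊤ : ℕ∞) (endForm f g T) upper :=
  (g.contDiffOn_cut T).smul (isSmoothClosed_geodesicForm f g).smooth

/-- A sharp cut at the projection of `x` and a smooth cut at time `T` differ only in a bounded part
of the tube that carries the geodesic form. -/
lemma endForm_eventually (f : CutoffProfile) (g : Geodesic) (T : ℝ) (x : ℍ) :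
    ∃ R, ∀ z : ℍ, R < dist x z →
      (if g.pos x < g.pos z then geodesicForm f g z else 0) = endForm f g T z := by
  -- Beyond `±A` the cutoff is already `0` or `1`, and the comparison of positions has the
  -- corresponding outcome, even after the error `log (1 + sinh 1)` between the position and the
  -- logarithmic coordinate.
  set A := |g.pos x| + |T| + 1 + Real.log (1 + Real.sinh 1) with hA
  have hlog : 0 ≤ Real.log (1 + Real.sinh 1) :=
    Real.log_nonneg (by linarith [Real.sinh_nonneg_iff.2 zero_le_one])
  obtain ⟨R, hR⟩ := g.exists_dist_le x (Real.sinh 1) (-A) A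
  refine ⟨R, fun z hz => ?_⟩
  by_cases h1 : Real.sinh 1 ≤ |g.height z|
  · simp [endForm, geodesicForm_eq_zero f g z.im_pos h1]
  have h4 : |(g.unfermi z).re| ≤ Real.sinh 1 := (not_le.1 h1).le
  have e := g.fermi_unfermi z.im_pos
  have e' : g.fermiH (g.unfermi z) = z := UpperHalfPlane.ext e
  have h2 := g.le_pos_fermi (g.unfermi z)
  have h3 := g.pos_fermi_le (g.unfermi z)
  rw [e] at h2 h3
  have h5 : Real.log (1 + |(g.unfermi z).re|) ≤ Real.log (1 + Real.sinh 1) :=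
    Real.log_le_log (by positivity) (by linarith)
  have a1 := neg_abs_le (g.pos x)
  have a2 := neg_abs_le T
  have a3 := le_abs_self (g.pos x)
  have a4 := le_abs_self T
  have a5 := abs_nonneg (g.pos x)
  have a6 := abs_nonneg T
  rcases lt_or_ge (g.unfermi z).im (-A) with k | k
  · rw [if_neg (by linarith), endForm, Geodesic.cut,
      Real.smoothTransition.zero_of_nonpos (by linarith), zero_smul]
  rcases lt_or_ge A (g.unfermi z).im with k' | k'
  · rw [if_pos (by linarith), endForm, Geodesic.cut,
      Real.smoothTransition.one_of_one_le (by linarith), one_smul]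
  · have := hR (g.unfermi z) h4 k k'
    rw [e'] at this
    exact absurd hz this.not_gt

lemma contDiffOn_of_hasFDerivAt {φ : ℂ → ℝ} {ω : Form} (hω : ContDiffOn ℝ (⊤ : ℕ∞) ω upper)
    (hφ : ∀ z ∈ upper, HasFDerivAt φ (ω z) z) : ContDiffOn ℝ 1 φ upper := by
  rw [show (1 : WithTop ℕ∞) = 0 + 1 from rfl, contDiffOn_succ_iff_fderiv_of_isOpen isOpen_upper]
  refine ⟨fun z hz => (hφ z hz).differentiableAt.differentiableWithinAt, by simp, ?_⟩
  rw [contDiffOn_zero]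
  exact hω.continuousOn.congr fun z hz => (hφ z hz).fderiv

/-- The cutoff is moved from the form to the primitive: `φ (cut ω_γ) = (cut φ) ω_γ`. As `ω_γ` is
closed, the exterior derivative is `d(cut φ) ∧ ω_γ`, already integrated in coordinates along `γ`. -/
lemma integral_curl_endForm {f : CutoffProfile} {φ : ℂ → ℝ} {ω : Form} {c : OnePoint ℝ → ℝ}
    (hφ : ∀ z ∈ upper, HasFDerivAt φ (ω z) z)
    (hc : IsBoundaryValue f φ c) (γ : Geodesic) :
    ∃ T, IntegrableOn (curl fun z => φ z • endForm f γ T z) upper ∧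
      ∫ z in upper, curl (fun z => φ z • endForm f γ T z) z = -c γ.1.2 := by
  obtain ⟨e₁, e₂, C₁, C₂, hE⟩ := hc γ (Real.sinh 1)
  obtain ⟨T, hT⟩ := eventually_endFilter.1 hE
  refine ⟨T, ?_⟩
  have hu : ∀ z ∈ upper, HasFDerivAt (fun z => γ.cut T z * φ z)
      (fderiv ℝ (fun z => γ.cut T z * φ z) z) z := fun z hz => by
    have h1 := ((γ.contDiffOn_cut T).contDiffAt (upper_mem_nhds hz)).differentiableAt (by simp)
    exact (h1.mul (hφ z hz).differentiableAt).hasFDerivAt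
  obtain ⟨h1, h2⟩ := integral_wedge_cut (f := f) (C := c γ.1.2) hT hu
  have hg := isSmoothClosed_geodesicForm f γ
  have e : EqOn (curl fun z => φ z • endForm f γ T z) (fun z => wedge
      (fderiv ℝ (fun z => γ.cut T z * φ z) z) (geodesicForm f γ z)) upper := fun z hz => by
    have : (fun z => φ z • endForm f γ T z) =
        fun z => (γ.cut T z * φ z) • geodesicForm f γ z := funext fun z => by
      rw [endForm, smul_smul, mul_comm]
    simp only [this]
    exact curl_smul (hu z hz) (hg.differentiableAt hz) (hg.curl_eq_zero hz)
  rw [integrableOn_congr_fun e isOpen_upper.measurableSet,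
    setIntegral_congr_fun isOpen_upper.measurableSet e]
  exact ⟨h1, h2⟩

lemma isCompact_image_closedBall (x : ℍ) (R : ℝ) :
    IsCompact ((fun z : ℍ => (z : ℂ)) '' Metric.closedBall x R) :=
  (isCompact_closedBall x R).image UpperHalfPlane.continuous_coe

/-- The integral of the product of a closed form with a form having geodesic ends. -/
lemma integral_wedge_eq_boundary {f : CutoffProfile} {φ : ℂ → ℝ} {α β : Form}
    {c : OnePoint ℝ → ℝ} {y : ℍ} {h' h : Geodesic} (hα : ContDiffOn ℝ (⊤ : ℕ∞) α upper)
    (hφ : ∀ z ∈ upper, HasFDerivAt φ (α z) z) (hc : IsBoundaryValue f φ c)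
    (hβ : HasGeodesicEnds f y h' h β) :
    IntegrableOn (fun z => wedge (α z) (β z)) upper ∧
      ∫ z in upper, wedge (α z) (β z) = c h'.1.1 - c h.1.2 := by
  obtain ⟨T, i1, v1⟩ := integral_curl_endForm hφ hc h
  obtain ⟨T', i2, v2⟩ := integral_curl_endForm hφ hc h'.rev
  have hφs := contDiffOn_of_hasFDerivAt hα hφ
  have sβ : ContDiffOn ℝ 1 β upper := hβ.smooth.of_le (by simp)
  have s1 : ContDiffOn ℝ 1 (endForm f h T) upper := (contDiffOn_endForm f h T).of_le (by simp)
  have s2 : ContDiffOn ℝ 1 (endForm f h'.rev T') upper :=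
    (contDiffOn_endForm f h'.rev T').of_le (by simp)
  -- The end at `h'⁻` is the positive end of the reversed geodesic, whose form is `-ω_{h'}`; this
  -- explains the plus sign. Far away `β₀` vanishes.
  set β₀ : Form := fun z => β z - endForm f h T z + endForm f h'.rev T' z with hβ₀
  have s0 : ContDiffOn ℝ 1 β₀ upper := (sβ.sub s1).add s2
  obtain ⟨R₀, hR₀⟩ := hβ.ends
  obtain ⟨R₁, hR₁⟩ := endForm_eventually f h T y
  obtain ⟨R₂, hR₂⟩ := endForm_eventually f h'.rev T' y
  have hz : ∀ z ∈ upper, z ∉ (fun z : ℍ => (z : ℂ)) '' Metric.closedBall y (max R₀ (max R₁ R₂)) →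
      φ z • β₀ z = 0 := fun z hz hK => by
    have hd : max R₀ (max R₁ R₂) < dist y ⟨z, hz⟩ := by
      rw [dist_comm]
      by_contra k
      exact hK ⟨⟨z, hz⟩, not_lt.1 k, rfl⟩
    rw [max_lt_iff, max_lt_iff] at hd
    have e0 := hR₀ _ hd.1
    have e1 := hR₁ _ hd.2.1
    have e2 := hR₂ _ hd.2.2
    simp only [h'.pos_rev, geodesicForm_rev, neg_lt_neg_iff] at e2
    change β z = _ at e0
    change _ = endForm f h T z at e1
    change _ = endForm f h'.rev T' z at e2
    rw [hβ₀]
    simp only [e0, ← e1, ← e2]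
    split_ifs <;> simp
  have t0 : ContDiffOn ℝ 1 (fun z => φ z • β₀ z) upper := hφs.smul s0
  have t1 : ContDiffOn ℝ 1 (fun z => φ z • endForm f h T z) upper := hφs.smul s1
  have t2 : ContDiffOn ℝ 1 (fun z => φ z • endForm f h'.rev T' z) upper := hφs.smul s2
  have t01 : ContDiffOn ℝ 1 (fun z => φ z • β₀ z + φ z • endForm f h T z) upper := t0.add t1
  obtain ⟨i0, v0⟩ := integral_curl_eq_zero t0 (isCompact_image_closedBall y _)
    (by rintro _ ⟨z, -, rfl⟩; exact z.im_pos) hz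
  -- Since `β` is closed, `α ∧ β = d(φ β)`, and `β` is split into `β₀` and the two ends.
  have e : EqOn (fun z => wedge (α z) (β z)) (fun z => curl (fun z => φ z • β₀ z) z +
      curl (fun z => φ z • endForm f h T z) z - curl (fun z => φ z • endForm f h'.rev T' z) z)
      upper := fun z hz => by
    have d : ∀ {V : Form}, ContDiffOn ℝ 1 V upper → DifferentiableAt ℝ V z := fun hV =>
      (hV.contDiffAt (upper_mem_nhds hz)).differentiableAt (by simp)
    simp only
    rw [← curl_add (d t0) (d t1), ← curl_sub (d t01) (d t2),
      ← curl_smul (hφ z hz) (hβ.differentiableAt hz) (hβ.curl_eq_zero hz)]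
    congr 1
    funext w
    simp only [hβ₀, smul_add, smul_sub]
    abel
  rw [integrableOn_congr_fun e isOpen_upper.measurableSet,
    setIntegral_congr_fun isOpen_upper.measurableSet e]
  refine ⟨(i0.add i1).sub i2, ?_⟩
  rw [integral_sub (f := fun z => curl (fun z => φ z • β₀ z) z +
    curl (fun z => φ z • endForm f h T z) z) (i0.add i1) i2, integral_add i0 i1, v0, v1, v2]
  change 0 + -c h.1.2 - -c h'.1.1 = _
  ring

/-! ### Intersection numbers as integrals -/

section Intersection

variable {f : CutoffProfile} {x y : ℍ} {g' g h' h : Geodesic} {α β : Form} {φ : ℂ → ℝ}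
  {c : OnePoint ℝ → ℝ}

lemma wedge_swap (a b : ℂ →L[ℝ] ℝ) : wedge a b = -wedge b a := by simp only [wedge]; ring

/-- The variation of the boundary values of a primitive is an intersection number. -/
lemma HasGeodesicEnds.boundaryValue_sub (hα : HasGeodesicEnds f x g' g α)
    (hφ : ∀ z ∈ upper, HasFDerivAt φ (α z) z) (hc : IsBoundaryValue f φ c) (a b : OnePoint ℝ) :
    c b - c a = eps (a, b) (g'.1.1, g.1.2) := by
  by_cases hab : a = b
  · subst hab; rw [eps_phantom_left, sub_self]
  set γ : Geodesic := ⟨(a, b), hab⟩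
  -- The integral of `α ∧ ω_γ`, for `γ` from `a` to `b`, is computed twice: with the unknown
  -- boundary values of `φ`, and, exchanging the factors, with the explicit boundary values of the
  -- potential of `γ`.
  have h1 := (integral_wedge_eq_boundary hα.smooth hφ hc
    (geodesicForm_hasGeodesicEnds f x γ)).2
  have h2 := (integral_wedge_eq_boundary (isSmoothClosed_geodesicForm f γ).smooth
    (fun z hz => hasFDerivAt_potential f γ hz) (isBoundaryValue_potential f γ) hα).2
  have h3 : ∫ z in upper, wedge (α z) (geodesicForm f γ z) =
      -∫ z in upper, wedge (geodesicForm f γ z) (α z) := by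
    rw [← integral_neg]
    exact integral_congr_ae (Eventually.of_forall fun z => wedge_swap _ _)
  rw [h1, h2] at h3
  rw [eps_antisymm]
  simp only [eps]
  simp only [γ] at h3
  linarith

/-- The integral of the product of two closed forms with geodesic ends is the intersection number
of their ends. -/
lemma HasGeodesicEnds.integral_wedge (hα : HasGeodesicEnds f x g' g α)
    (hβ : HasGeodesicEnds f y h' h β) :
    IntegrableOn (fun z => wedge (α z) (β z)) upper ∧
      ∫ z in upper, wedge (α z) (β z) = eps (g'.1.1, g.1.2) (h'.1.1, h.1.2) := by
  obtain ⟨φ, hφ⟩ := hα.exists_primitive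
  obtain ⟨c, hc⟩ := hα.exists_boundaryValue hφ
  obtain ⟨h1, h2⟩ := integral_wedge_eq_boundary hα.smooth hφ hc hβ
  refine ⟨h1, ?_⟩
  rw [h2, eps_antisymm, ← hα.boundaryValue_sub hφ hc]
  ring

/-- A form with geodesic ends vanishes near the ends of any geodesic. -/
lemma continuous_line (hα : HasGeodesicEnds f x g' g α) (γ : Geodesic) :
    Continuous (fun t => α (γ.point t) (γ.velocity t)) ∧
    HasCompactSupport (fun t => α (γ.point t) (γ.velocity t)) ∧
    ∀ φ : ℂ → ℝ, (∀ z ∈ upper, HasFDerivAt φ (α z) z) →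
      ∀ t, HasDerivAt (fun t => φ (γ.point t)) (α (γ.point t) (γ.velocity t)) t := by
  have hp : ContDiff ℝ 1 fun t : ℝ => (γ.point t : ℂ) := by
    have h0 : (fun t : ℝ => (γ.point t : ℂ)) =
        fun t : ℝ => γ.chart.app (Real.exp t * Complex.I) := funext γ.coe_point
    rw [h0]
    have h1 : ContDiff ℝ 1 fun t : ℝ => (Real.exp t : ℂ) * Complex.I :=
      (Complex.ofRealCLM.contDiff.comp Real.contDiff_exp).mul contDiff_const
    refine γ.chart.contDiffOn_app.comp_contDiff h1 fun t => ?_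
    simp [-Complex.ofReal_exp, Real.exp_pos]
  have hv : ∀ t, HasDerivAt (fun t : ℝ => (γ.point t : ℂ)) (γ.velocity t) t := fun t =>
    (hp.differentiable (by simp) t).hasDerivAt
  have hcv : Continuous γ.velocity := hp.continuous_deriv (by simp)
  have hder : ∀ φ : ℂ → ℝ, (∀ z ∈ upper, HasFDerivAt φ (α z) z) →
      ∀ t, HasDerivAt (fun t => φ (γ.point t)) (α (γ.point t) (γ.velocity t)) t :=
    fun φ hφ t => HasFDerivAt.comp_hasDerivAt t (hφ _ (γ.point t).im_pos) (hv t)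
  refine ⟨?_, ?_, hder⟩
  · refine Continuous.clm_apply ?_ hcv
    exact hα.smooth.continuousOn.comp_continuous hp.continuous fun t => (γ.point t).im_pos
  · obtain ⟨φ, hφ⟩ := hα.exists_primitive
    obtain ⟨c, hc⟩ := hα.exists_boundaryValue hφ
    obtain ⟨T, hT⟩ := eventually_atTop.1 (hc.eventually_atTop γ)
    obtain ⟨T', hT'⟩ := eventually_atBot.1 (hc.eventually_atBot γ)
    refine HasCompactSupport.of_support_subset_isCompact (isCompact_Icc (a := T') (b := T))
      fun t ht => ?_
    by_contra k
    rw [Set.mem_Icc, not_and_or, not_le, not_le] at k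
    apply ht
    -- Outside `[T', T]` the primitive is constant along `γ`, so its derivative, which is the
    -- pairing of `α` with the velocity, vanishes.
    refine (hder φ hφ t).unique ?_
    rcases k with k | k
    · refine (hasDerivAt_const t (c γ.1.1)).congr_of_eventuallyEq ?_
      filter_upwards [eventually_lt_nhds k] with s hs using hT' s hs.le
    · refine (hasDerivAt_const t (c γ.1.2)).congr_of_eventuallyEq ?_
      filter_upwards [eventually_gt_nhds k] with s hs using hT s hs.le

end Intersection

/-! ### Existence of polygonal arc forms -/

/-- The real form `v ↦ Im (κ v)`. -/
def imForm (κ : ℂ) : ℂ →L[ℝ] ℝ := Complex.imCLM.comp (κ • ContinuousLinearMap.id ℝ ℂ)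

lemma imForm_add (κ κ' : ℂ) : imForm (κ + κ') = imForm κ + imForm κ' := by
  refine ContinuousLinearMap.ext fun v => ?_
  simp [imForm, add_mul]

lemma imForm_sub (κ κ' : ℂ) : imForm (κ - κ') = imForm κ - imForm κ' := by
  refine ContinuousLinearMap.ext fun v => ?_
  simp [imForm, sub_mul]

lemma hasFDerivAt_arg {F : ℂ → ℂ} {F' z : ℂ} (hF : HasDerivAt F F' z) (h : F z ∈ Complex.slitPlane) :
    HasFDerivAt (fun z => (F z).arg) (imForm (F' / F z)) z := by
  have h1 := (hF.clog h).hasFDerivAt.restrictScalars ℝ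
  have h2 := Complex.imCLM.hasFDerivAt.comp z h1
  have e : (Complex.imCLM ∘ fun z => Complex.log (F z)) = fun z => (F z).arg :=
    funext fun z => by simp [Complex.log_im]
  rw [e] at h2
  refine h2.congr_fderiv (ContinuousLinearMap.ext fun v => ?_)
  simp [imForm, mul_comm]

lemma contDiffAt_arg {F : ℂ → ℂ} {z : ℂ} (hF : ContDiffAt ℝ (⊤ : ℕ∞) F z)
    (h : F z ∈ Complex.slitPlane) : ContDiffAt ℝ (⊤ : ℕ∞) (fun z => (F z).arg) z := by
  have h1 : ContDiffAt ℝ (⊤ : ℕ∞) (fun z => Complex.log (F z)) z :=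
    ((Complex.contDiffAt_log h).restrict_scalars ℝ).comp z hF
  have e : (fun z => (F z).arg) = (Complex.imCLM ∘ fun z => Complex.log (F z)) :=
    funext fun z => by simp [Complex.log_im]
  rw [e]
  exact Complex.imCLM.contDiff.contDiffAt.comp z h1

/-- The hyperbolic cosine of the distance to `p`. -/
def coshDist (p : ℍ) (z : ℂ) : ℝ := 1 + Complex.normSq (z - p) / (2 * z.im * p.im)

lemma coshDist_eq (p z : ℍ) : coshDist p z = Real.cosh (dist z p) := by
  rw [UpperHalfPlane.cosh_dist, coshDist, Complex.dist_eq, Complex.sq_norm]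
  rfl

lemma contDiffAt_coshDist (p : ℍ) {z : ℂ} (hz : 0 < z.im) :
    ContDiffAt ℝ (⊤ : ℕ∞) (coshDist p) z := by
  have him : ContDiffAt ℝ (⊤ : ℕ∞) Complex.im z := Complex.imCLM.contDiff.contDiffAt
  have hre : ContDiffAt ℝ (⊤ : ℕ∞) Complex.re z := Complex.reCLM.contDiff.contDiffAt
  have : coshDist p = fun z => 1 + ((z.re - p.re) * (z.re - p.re) + (z.im - p.im) * (z.im - p.im)) /
      (2 * z.im * p.im) := by
    funext z; simp [coshDist, Complex.normSq_apply]
  rw [this]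
  refine contDiffAt_const.add (ContDiffAt.div ?_ ?_ ?_)
  · exact ((hre.sub contDiffAt_const).mul (hre.sub contDiffAt_const)).add
      ((him.sub contDiffAt_const).mul (him.sub contDiffAt_const))
  · exact (contDiffAt_const.mul him).mul contDiffAt_const
  · have := p.im_pos
    positivity

/-- A smooth function vanishing near the ball of radius `1/2` and equal to `1` outside the ball of
radius `1`. -/
def bump (p : ℍ) (z : ℂ) : ℝ :=
  Real.smoothTransition ((2 * coshDist p z - (Real.cosh 1 + Real.cosh (1 / 2))) /
    (Real.cosh 1 - Real.cosh (1 / 2)))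

lemma cosh_half_lt : Real.cosh (1 / 2) < Real.cosh 1 :=
  Real.cosh_lt_cosh.2 (by rw [abs_of_pos, abs_of_pos] <;> norm_num)

lemma bump_eventually_one {p z : ℍ} (h : 1 < dist z p) : bump p =ᶠ[𝓝 (z : ℂ)] fun _ => 1 := by
  have h1 : Real.cosh 1 < coshDist p z := by
    rw [coshDist_eq, Real.cosh_lt_cosh, abs_of_pos one_pos, abs_of_nonneg dist_nonneg]
    exact h
  filter_upwards [(contDiffAt_coshDist p z.im_pos).continuousAt.eventually_const_lt h1] with w hw
  refine Real.smoothTransition.one_of_one_le ?_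
  have := cosh_half_lt
  rw [one_le_div (by linarith)]
  linarith

lemma bump_eventually_zero {p z : ℍ} (h : dist z p ≤ 1 / 2) :
    bump p =ᶠ[𝓝 (z : ℂ)] fun _ => 0 := by
  have h0 := cosh_half_lt
  have h1 : coshDist p z < (Real.cosh 1 + Real.cosh (1 / 2)) / 2 := by
    have : coshDist p z ≤ Real.cosh (1 / 2) := by
      rw [coshDist_eq, Real.cosh_le_cosh, abs_of_nonneg dist_nonneg, abs_of_pos (by norm_num)]
      exact h
    linarith
  filter_upwards [(contDiffAt_coshDist p z.im_pos).continuousAt.eventually_lt_const h1] with w hw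
  refine Real.smoothTransition.zero_of_nonpos ?_
  exact div_nonpos_of_nonpos_of_nonneg (by linarith) (by linarith)

lemma contDiffAt_bump (p : ℍ) {z : ℂ} (hz : 0 < z.im) : ContDiffAt ℝ (⊤ : ℕ∞) (bump p) z :=
  Real.smoothTransition.contDiff.contDiffAt.comp z
    (((contDiffAt_const.mul (contDiffAt_coshDist p hz)).sub contDiffAt_const).div_const _)

lemma contDiffOn_bump_mul {p : ℍ} {Y : ℂ → ℝ}
    (hY : ∀ z : ℍ, 1 / 2 < dist z p → ContDiffAt ℝ (⊤ : ℕ∞) Y z) :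
    ContDiffOn ℝ (⊤ : ℕ∞) (fun z => bump p z * Y z) upper := by
  intro z hz
  refine ContDiffAt.contDiffWithinAt ?_
  rcases le_or_gt (dist (⟨z, hz⟩ : ℍ) p) (1 / 2) with h | h
  · refine (contDiffAt_const (c := (0 : ℝ))).congr_of_eventuallyEq ?_
    filter_upwards [bump_eventually_zero h] with w hw
    rw [hw, zero_mul]
  · exact (contDiffAt_bump p hz).mul (hY _ h)

lemma hasFDerivAt_bump_mul {p z : ℍ} {Y : ℂ → ℝ} {Y' : ℂ →L[ℝ] ℝ} (h : 1 < dist z p)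
    (hY : HasFDerivAt Y Y' z) : HasFDerivAt (fun z => bump p z * Y z) Y' z := by
  refine hY.congr_of_eventuallyEq ?_
  filter_upwards [bump_eventually_one h] with w hw
  rw [hw, one_mul]

/-! ### Angle forms and chains of dipoles along a segment -/

/-- The form `d arg (z - p)`. -/
def angForm (p : ℂ) : Form := fun z => imForm (z - p)⁻¹

/-- The quotient `(z - p) / (z - p')` is a nonpositive real only on the Euclidean segment from `p`
to `p'`. Hyperbolic balls being Euclidean discs, hence convex, this segment stays in the ball of
radius `1/2` around `p`. Outside this ball the argument of the quotient is a single-valued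
primitive, and the bump function removes the singularities inside. -/
lemma exists_dipole {p p' : ℍ} (h : dist p p' ≤ 1 / 2) :
    ∃ Y : ℂ → ℝ, ContDiffOn ℝ (⊤ : ℕ∞) Y upper ∧
      ∀ z : ℍ, 1 < dist z p → HasFDerivAt Y (angForm p z - angForm p' z) z := by
  have hp' : ∀ z : ℍ, 1 / 2 < dist z p → (z : ℂ) - p' ≠ 0 := fun z hz k => by
    have : z = p' := UpperHalfPlane.ext (sub_eq_zero.1 k)
    rw [this, dist_comm] at hz
    exact absurd h hz.not_ge
  have hp : ∀ z : ℍ, 1 / 2 < dist z p → (z : ℂ) - p ≠ 0 := fun z hz k => by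
    have : z = p := UpperHalfPlane.ext (sub_eq_zero.1 k)
    rw [this, dist_self] at hz
    norm_num at hz
  have hs : ∀ z : ℍ, 1 / 2 < dist z p → ((z : ℂ) - p) / (z - p') ∈ Complex.slitPlane := by
    intro z hz
    by_contra hcon
    rw [Complex.mem_slitPlane_iff, not_or, not_lt, not_not] at hcon
    set q := ((z : ℂ) - p) / (z - p')
    have hq : q = q.re := by apply Complex.ext <;> simp [hcon.2]
    have e1 : (z : ℂ) - p = q.re * (z - p') := by
      rw [← hq, div_mul_cancel₀ _ (hp' z hz)]
    have hball : Convex ℝ (Metric.closedBall (p.center (1 / 2) : ℂ) (p.im * Real.sinh (1 / 2))) :=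
      convex_closedBall _ _
    have m1 : (p : ℂ) ∈ Metric.closedBall (p.center (1 / 2) : ℂ) (p.im * Real.sinh (1 / 2)) :=
      UpperHalfPlane.dist_le_iff_dist_coe_center_le.1 (by rw [dist_self]; norm_num)
    have m2 : (p' : ℂ) ∈ Metric.closedBall (p.center (1 / 2) : ℂ) (p.im * Real.sinh (1 / 2)) :=
      UpperHalfPlane.dist_le_iff_dist_coe_center_le.1 (by rw [dist_comm]; exact h)
    have hpos : 0 < 1 - q.re := by linarith [hcon.1]
    have m3 : (z : ℂ) ∈ Metric.closedBall (p.center (1 / 2) : ℂ) (p.im * Real.sinh (1 / 2)) := by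
      -- Solving `z - p = q (z - p')` for `z` gives `z = (p - q p') / (1 - q)`, a convex combination
      -- since `q ≤ 0`.
      have := hball m1 m2 (a := 1 / (1 - q.re)) (b := -q.re / (1 - q.re)) (by positivity)
        (div_nonneg (by linarith [hcon.1]) hpos.le) (by field_simp; ring)
      convert this using 1
      have hne : (1 - q.re : ℂ) ≠ 0 := by exact_mod_cast hpos.ne'
      simp only [Complex.real_smul]
      push_cast
      field_simp
      linear_combination e1
    exact absurd (UpperHalfPlane.dist_le_iff_dist_coe_center_le.2 m3) hz.not_ge
  refine ⟨fun z => bump p z * ((z - p) / (z - p')).arg, contDiffOn_bump_mul fun z hz => ?_,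
    fun z hz => hasFDerivAt_bump_mul hz ?_⟩
  · refine contDiffAt_arg ?_ (hs z hz)
    have : (fun z : ℂ => (z - p) / (z - p')) = fun z : ℂ => (z - p) * (z - p')⁻¹ :=
      funext fun z => div_eq_mul_inv _ _
    rw [this]
    exact (contDiffAt_id.sub contDiffAt_const).mul
      ((contDiffAt_id.sub contDiffAt_const).inv (hp' z hz))
  · have hz' : 1 / 2 < dist z p := by linarith
    have h1 := hp z hz'
    have h2 := hp' z hz'
    have hd := ((hasDerivAt_id (z : ℂ)).sub_const (p : ℂ)).div
      ((hasDerivAt_id (z : ℂ)).sub_const (p' : ℂ)) h2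
    refine (hasFDerivAt_arg hd (hs z hz')).congr_fderiv ?_
    rw [angForm, angForm, ← imForm_sub]
    congr 1
    simp only [id, Pi.div_apply]
    field_simp

/-- A telescoping sum of dipoles. -/
lemma exists_chain (P : ℕ → ℍ) (N : ℕ) (h : ∀ j < N, dist (P j) (P (j + 1)) ≤ 1 / 2) :
    ∃ Y : ℂ → ℝ, ContDiffOn ℝ (⊤ : ℕ∞) Y upper ∧ ∀ z : ℍ, (∀ j < N, 1 < dist z (P j)) →
      HasFDerivAt Y (angForm (P 0) z - angForm (P N) z) z := by
  induction N with
  | zero =>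
    refine ⟨fun _ => 0, contDiffOn_const, fun z _ => ?_⟩
    rw [sub_self]
    exact hasFDerivAt_const _ _
  | succ N ih =>
    obtain ⟨Y, h1, h2⟩ := ih fun j hj => h j (by omega)
    obtain ⟨Z, h3, h4⟩ := exists_dipole (h N (by omega))
    refine ⟨fun z => Y z + Z z, h1.add h3, fun z hz => ?_⟩
    have := (h2 z fun j hj => hz j (by omega)).add (h4 z (hz N (by omega)))
    refine this.congr_fderiv ?_
    abel

/-- The point at signed distance `R` from `g` on the perpendicular to `g` at `g.point t`. -/
def Geodesic.perp (g : Geodesic) (t R : ℝ) : ℍ :=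
  g.fermiH ⟨Real.sinh R, t - Real.log (Real.cosh R)⟩

lemma Geodesic.perp_zero (g : Geodesic) (t : ℝ) : g.perp t 0 = g.point t := by
  rw [g.point_eq_fermiH, Geodesic.perp]
  simp

lemma exp_sub_log_cosh (t R : ℝ) :
    Real.exp (t - Real.log (Real.cosh R)) = Real.exp t / Real.cosh R := by
  rw [Real.exp_sub, Real.exp_log (Real.cosh_pos R)]

lemma Geodesic.perp_height (g : Geodesic) (x : ℍ) :
    g.perp (g.pos x) (Real.arsinh (g.height x)) = x := by
  apply UpperHalfPlane.ext
  have e := g.fermi_unfermi x.im_pos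
  rw [Geodesic.perp, coe_fermiH]
  conv_rhs => rw [← e]
  congr 1
  apply Complex.ext
  · simp [Geodesic.unfermi]
  · simp only
    have h1 := g.pos_fermi (g.unfermi x)
    rw [e] at h1
    have h2 : ‖strip (g.unfermi x)‖ =
        Real.exp (g.unfermi x).im * Real.cosh (Real.arsinh (g.height x)) := by
      rw [Real.cosh_arsinh, strip, norm_mul, Complex.norm_real, Real.norm_of_nonneg (Real.exp_pos _).le]
      congr 1
      rw [Complex.norm_def, Complex.normSq_apply]
      congr 1
      simp [Geodesic.unfermi]
      ring
    rw [h1, h2, Real.log_mul (Real.exp_pos _).ne' (Real.cosh_pos _).ne', Real.log_exp]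
    ring

lemma Geodesic.dist_perp (g : Geodesic) (t R R' : ℝ) :
    dist (g.perp t R) (g.perp t R') = |R - R'| := by
  rw [Geodesic.perp, Geodesic.perp, Geodesic.fermiH, Geodesic.fermiH, Moebius.dist_act]
  have h : ∀ a b : ℝ, 0 ≤ a → 0 ≤ b → Real.cosh a = Real.cosh b → a = b := fun a b ha hb h => by
    have h1 := Real.cosh_le_cosh.1 h.le
    have h2 := Real.cosh_le_cosh.1 h.ge
    rw [abs_of_nonneg ha, abs_of_nonneg hb] at *
    exact le_antisymm h1 h2
  apply h _ _ dist_nonneg (abs_nonneg _)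
  rw [UpperHalfPlane.cosh_dist', Real.cosh_abs, Real.cosh_sub]
  have e1 : ∀ R, (stripH ⟨Real.sinh R, t - Real.log (Real.cosh R)⟩).re =
      Real.exp t / Real.cosh R * Real.sinh R := fun R => by
    change (strip _).re = _
    rw [strip_re, exp_sub_log_cosh]
  have e2 : ∀ R, (stripH ⟨Real.sinh R, t - Real.log (Real.cosh R)⟩).im =
      Real.exp t / Real.cosh R := fun R => by
    change (strip _).im = _
    rw [strip_im, exp_sub_log_cosh]
  rw [e1, e1, e2, e2]
  have := Real.exp_pos t
  have h1 := Real.cosh_pos R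
  have h2 := Real.cosh_pos R'
  have h3 := Real.cosh_sq R
  have h4 := Real.cosh_sq R'
  field_simp
  ring_nf
  rw [h3, h4]
  ring

/-- The perpendicular from `x` to `g` is divided into steps of length `|R₀| / N < 1/2`. The
intermediate points lie on the segment from `x` to its foot, so a point at distance more than `1`
from the segment is outside all the bumps. -/
lemma exists_perp_chain (g : Geodesic) (x : ℍ) :
    ∃ Y : ℂ → ℝ, ContDiffOn ℝ (⊤ : ℕ∞) Y upper ∧
      (∀ z : ℍ, (∀ w ∈ hypSegment x (g.foot x), 1 < dist z w) →
        HasFDerivAt Y (angForm x z - angForm (g.foot x) z) z) ∧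
      ∃ R, ∀ z : ℍ, R < dist x z → HasFDerivAt Y (angForm x z - angForm (g.foot x) z) z := by
  set R₀ := Real.arsinh (g.height x) with hR₀
  obtain ⟨N, hN⟩ := exists_nat_gt (2 * |R₀|)
  have hN0 : 0 < (N : ℝ) := lt_of_le_of_lt (by positivity) hN
  set P : ℕ → ℍ := fun j => g.perp (g.pos x) (R₀ * (1 - j / N)) with hP
  have hP0 : P 0 = x := by simp [hP, hR₀, g.perp_height]
  have hPN : P N = g.foot x := by
    simp only [hP]
    rw [div_self hN0.ne', sub_self, mul_zero, g.perp_zero]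
    rfl
  obtain ⟨Y, h1, h2⟩ := exists_chain P N fun j _ => by
    simp only [hP]
    rw [g.dist_perp]
    have : R₀ * (1 - (j : ℝ) / N) - R₀ * (1 - ((j + 1 : ℕ) : ℝ) / N) = R₀ / N := by
      push_cast; field_simp; ring
    rw [this, abs_div, abs_of_pos hN0, div_le_iff₀ hN0]
    linarith
  rw [hP0, hPN] at h2
  have hd : ∀ j ≤ N, dist x (P j) = |R₀| * (j / N) ∧ dist (P j) (g.foot x) = |R₀| * (1 - j / N) := by
    intro j hj
    have hj' : (j : ℝ) / N ≤ 1 := (div_le_one hN0).2 (by exact_mod_cast hj)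
    have hj0 : 0 ≤ (j : ℝ) / N := by positivity
    constructor
    · rw [← hP0]
      simp only [hP]
      rw [g.dist_perp, ← abs_of_nonneg hj0, ← abs_mul, abs_of_nonneg hj0]
      congr 1
      simp
      ring
    · rw [← hPN]
      simp only [hP]
      rw [g.dist_perp, div_self hN0.ne', sub_self, mul_zero, sub_zero, abs_mul,
        abs_of_nonneg (by linarith : 0 ≤ 1 - (j : ℝ) / N)]
  refine ⟨Y, h1, fun z hz => h2 z fun j hj => hz _ ?_, |R₀| + 1, fun z hz => h2 z fun j hj => ?_⟩
  · have e := hd j hj.le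
    have e' := hd N le_rfl
    rw [div_self hN0.ne', hPN] at e'
    change dist x (P j) + dist (P j) (g.foot x) = dist x (g.foot x)
    rw [e.1, e.2, e'.1]
    ring
  · have hj' : (j : ℝ) / N ≤ 1 := (div_le_one hN0).2 (by exact_mod_cast hj.le)
    have e := (hd j hj.le).1
    have h3 := dist_triangle x (P j) z
    rw [dist_comm z]
    have h4 := mul_le_mul_of_nonneg_left hj' (abs_nonneg R₀)
    linarith

/-- By `Moebius.app_sub` the argument of `M z - M q` is that of `z - q` minus that of `c z + d`, up
to a constant. On the half-plane `c z + d` avoids the real axis, unless `c = 0`, so its argument is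
a smooth correction that makes angle functions in a chart have derivative `angForm q`. -/
lemma exists_argCorrection (M : Moebius) : ∃ L : ℂ → ℝ, ∀ z ∈ upper,
    ContDiffAt ℝ (⊤ : ℕ∞) L z ∧ HasFDerivAt L (imForm (M.c / (M.c * z + M.d))) z := by
  by_cases hc : M.c = 0
  · refine ⟨fun _ => 0, fun z _ => ⟨contDiffAt_const, ?_⟩⟩
    refine (hasFDerivAt_const (0 : ℝ) z).congr_fderiv (ContinuousLinearMap.ext fun v => ?_)
    simp [hc, imForm]
  · refine ⟨fun z => (M.c * z + M.d : ℂ).arg, fun z hz => ?_⟩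
    have hs : (M.c * z + M.d : ℂ) ∈ Complex.slitPlane := by
      rw [Complex.mem_slitPlane_iff]
      right
      simp [hc, (show 0 < z.im from hz).ne']
    refine ⟨contDiffAt_arg ((contDiffAt_const.mul contDiffAt_id).add contDiffAt_const) hs, ?_⟩
    refine hasFDerivAt_arg ?_ hs
    simpa using ((hasDerivAt_id z).const_mul (M.c : ℂ)).add_const (M.d : ℂ)

lemma hasFDerivAt_arg_app (M : Moebius) {L : ℂ → ℝ} {z q κ : ℂ} (hz : z ∈ upper) (hq : q ∈ upper)
    (hκ : κ ≠ 0) (hzq : z ≠ q)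
    (hL : HasFDerivAt L (imForm (M.c / (M.c * z + M.d))) z)
    (h : κ * (M.app z - M.app q) ∈ Complex.slitPlane) :
    HasFDerivAt (fun z => (κ * (M.app z - M.app q)).arg + L z) (angForm q z) z := by
  have hd := ((M.hasDerivAt_app hz).sub_const (M.app q)).const_mul κ
  refine ((hasFDerivAt_arg hd h).add hL).congr_fderiv ?_
  rw [← imForm_add, angForm]
  congr 1
  have h1 := M.denom_ne hz
  have h2 := M.denom_ne hq
  have h3 := sub_ne_zero.2 hzq
  have h4 : (M.det : ℂ) ≠ 0 := by exact_mod_cast (show M.det ≠ 0 from M.det_pos.ne')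
  rw [M.app_sub hz hq]
  set U := (M.c : ℂ) * z + M.d with hU
  set V := (M.c : ℂ) * q + M.d with hV
  have h5 : V = U - M.c * (z - q) := by rw [hU, hV]; ring
  field_simp
  rw [h5]
  ring

lemma Geodesic.dist_foot (g : Geodesic) (z : ℍ) :
    dist z (g.point (g.pos z)) = |Real.arsinh (g.height z)| := by
  conv_lhs => rw [← g.perp_zero (g.pos z)]; arg 1; rw [← g.perp_height z]
  rw [g.dist_perp, sub_zero]

lemma Geodesic.log_im_le_pos (g : Geodesic) (z : ℍ) :
    Real.log (g.chart.inv.app z).im ≤ g.pos z := by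
  have := g.le_pos_fermi (g.unfermi z)
  rwa [g.fermi_unfermi z.im_pos] at this

/-! ### The angle around the origin of a ray, with a smoothed cut -/

/-- A positive function on `(r, ∞)` below the identity, equal to the identity on `[3 r, ∞)` and to
`v ↦ v - r` on `(r, 2 r]`. -/
def taper (r v : ℝ) : ℝ := v - r * (1 - Real.smoothTransition (v / r - 2))

lemma contDiff_taper (r : ℝ) : ContDiff ℝ (⊤ : ℕ∞) (taper r) :=
  contDiff_id.sub (contDiff_const.mul (contDiff_const.sub
    (Real.smoothTransition.contDiff.comp ((contDiff_id.div_const r).sub contDiff_const))))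

lemma taper_pos {r v : ℝ} (hr : 0 < r) (h : r < v) : 0 < taper r v := by
  have := mul_nonneg hr.le (Real.smoothTransition.nonneg (v / r - 2))
  unfold taper
  linarith

lemma taper_le {r : ℝ} (hr : 0 < r) (v : ℝ) : taper r v ≤ v := by
  have := mul_le_mul_of_nonneg_left (Real.smoothTransition.le_one (v / r - 2)) hr.le
  unfold taper
  linarith

lemma taper_of_ge {r v : ℝ} (hr : 0 < r) (h : 3 * r ≤ v) : taper r v = v := by
  rw [taper, Real.smoothTransition.one_of_one_le]
  · simp
  · have : 3 ≤ v / r := (le_div_iff₀ hr).2 h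
    linarith

lemma taper_of_le {r v : ℝ} (hr : 0 < r) (h : v ≤ 2 * r) : taper r v = v - r := by
  rw [taper, Real.smoothTransition.zero_of_nonpos]
  · simp
  · have : v / r ≤ 2 := (div_le_iff₀ hr).2 h
    linarith

section Ray

variable (f : CutoffProfile) (M : Moebius) (r : ℝ)

/-- An angle function around `M.inv.app (r * I)`, with a cut smoothed along the image of the
imaginary axis above this point. -/
def rayAngle (z : ℂ) : ℝ :=
  if r < (M.app z).im then
    (-Complex.I * (M.app z - r * Complex.I)).arg +
      2 * Real.pi * f.step ((M.app z).re / taper r (M.app z).im)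
  else (Complex.I * (M.app z - r * Complex.I)).arg

variable {f M r} {z : ℂ}

lemma contDiffAt_app (hz : z ∈ upper) : ContDiffAt ℝ (⊤ : ℕ∞) M.app z :=
  M.contDiffOn_app.contDiffAt (upper_mem_nhds hz)

lemma contDiffAt_re_div_taper (hr : 0 < r) (hz : z ∈ upper) (h : r < (M.app z).im) :
    ContDiffAt ℝ (⊤ : ℕ∞) (fun z => (M.app z).re / taper r (M.app z).im) z := by
  have h1 : ContDiffAt ℝ (⊤ : ℕ∞) (fun z => (M.app z).re) z :=
    Complex.reCLM.contDiff.contDiffAt.comp z (contDiffAt_app hz)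
  have h2 : ContDiffAt ℝ (⊤ : ℕ∞) (fun z => (M.app z).im) z :=
    Complex.imCLM.contDiff.contDiffAt.comp z (contDiffAt_app hz)
  exact h1.div ((contDiff_taper r).contDiffAt.comp z h2) (taper_pos hr h).ne'

lemma neg_I_mul_mem (h : r < (M.app z).im) :
    -Complex.I * (M.app z - r * Complex.I) ∈ Complex.slitPlane := by
  rw [Complex.mem_slitPlane_iff]
  left
  simpa using h

lemma I_mul_mem (h : (M.app z).im ≤ r) (h' : M.app z ≠ r * Complex.I) :
    Complex.I * (M.app z - r * Complex.I) ∈ Complex.slitPlane := by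
  rw [Complex.mem_slitPlane_iff]
  rcases h.lt_or_eq with h | h
  · left; simpa using h
  · right
    simp only [Complex.mul_im, Complex.I_re, zero_mul, Complex.I_im, one_mul, zero_add,
      Complex.sub_re, Complex.mul_re, Complex.ofReal_re, Complex.ofReal_im, mul_zero, mul_one,
      sub_zero]
    intro k
    apply h'
    apply Complex.ext <;> simp [k, h]

lemma rayAngle_eventuallyEq_of_lt (hz : z ∈ upper) (h : r < (M.app z).im) :
    rayAngle f M r =ᶠ[𝓝 z] fun z => (-Complex.I * (M.app z - r * Complex.I)).arg +
      2 * Real.pi * f.step ((M.app z).re / taper r (M.app z).im) := by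
  have h1 : ContinuousAt (fun z => (M.app z).im) z :=
    Complex.continuous_im.continuousAt.comp (contDiffAt_app hz).continuousAt
  filter_upwards [h1.eventually_const_lt h] with w hw
  rw [rayAngle, if_pos hw]

/-- At the level `Im = r` the two definitions match. Just above it, off the axis, `taper` is close
to `0`, so the step function has already reached `±1/2`. Then `2π` times it is `±π`, which is
exactly the difference between the arguments of `w` and `-w` on the corresponding side. -/
lemma rayAngle_eventuallyEq_of_le (hr : 0 < r) (hz : z ∈ upper) (h : (M.app z).im ≤ r)
    (h' : M.app z ≠ r * Complex.I) :
    rayAngle f M r =ᶠ[𝓝 z] fun z => (Complex.I * (M.app z - r * Complex.I)).arg := by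
  have h1 : ContinuousAt (fun z => (M.app z).im) z :=
    Complex.continuous_im.continuousAt.comp (contDiffAt_app hz).continuousAt
  have h2 : ContinuousAt (fun z => (M.app z).re) z :=
    Complex.continuous_re.continuousAt.comp (contDiffAt_app hz).continuousAt
  rcases h.lt_or_eq with h | h
  · filter_upwards [h1.eventually_lt_const h] with w hw
    rw [rayAngle, if_neg hw.not_gt]
  · have hre : (M.app z).re ≠ 0 := fun k => h' (by apply Complex.ext <;> simp [k, h])
    have h3 : ∀ᶠ w in 𝓝 z, Real.sinh 1 * ((M.app w).im - r) < |(M.app w).re| := by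
      refine ContinuousAt.eventually_lt (by fun_prop) (by fun_prop) ?_
      rw [h, sub_self, mul_zero]
      exact abs_pos.2 hre
    have h4 : (M.app z).im < 2 * r := by linarith
    filter_upwards [h1.eventually_lt_const h4, h3] with w hw1 hw2
    rw [rayAngle]
    split_ifs with h4
    swap
    · rfl
    have h5 : 0 < (M.app w).im - r := by linarith
    have h6 := Real.sinh_pos_iff.2 one_pos
    rw [taper_of_le hr hw1.le]
    have e : Complex.I * (M.app w - r * Complex.I) = -(-Complex.I * (M.app w - r * Complex.I)) := by
      ring
    have hre' : (M.app w).re ≠ 0 := by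
      intro k
      rw [k, abs_zero] at hw2
      exact absurd hw2 (mul_pos h6 h5).not_gt
    rw [e]
    rcases lt_or_gt_of_ne hre' with k | k
    · rw [Complex.arg_neg_eq_arg_sub_pi_of_im_pos (by simpa using k), f.step_of_le_neg_sinh]
      · ring
      · rw [abs_of_neg k] at hw2
        rw [div_le_iff₀ h5]
        linarith
    · rw [Complex.arg_neg_eq_arg_add_pi_of_im_neg (by simpa using k), f.step_of_sinh_le]
      · ring
      · rw [abs_of_pos k] at hw2
        rw [le_div_iff₀ h5]
        linarith

lemma contDiffAt_rayAngle (hr : 0 < r) (hz : z ∈ upper) (h' : M.app z ≠ r * Complex.I) :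
    ContDiffAt ℝ (⊤ : ℕ∞) (rayAngle f M r) z := by
  have hs : ∀ κ : ℂ, ContDiffAt ℝ (⊤ : ℕ∞) (fun z => κ * (M.app z - r * Complex.I)) z :=
    fun κ => contDiffAt_const.mul ((contDiffAt_app hz).sub contDiffAt_const)
  rcases lt_or_ge r (M.app z).im with h | h
  · refine ContDiffAt.congr_of_eventuallyEq ?_ (rayAngle_eventuallyEq_of_lt hz h)
    exact (contDiffAt_arg (hs _) (neg_I_mul_mem h)).add (contDiffAt_const.mul
      (f.contDiff_step.contDiffAt.comp z (contDiffAt_re_div_taper hr hz h)))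
  · exact (contDiffAt_arg (hs _) (I_mul_mem h h')).congr_of_eventuallyEq
      (rayAngle_eventuallyEq_of_le hr hz h h')

lemma hasFDerivAt_rayAngle_of_lt {L : ℂ → ℝ} {q : ℂ} (hr : 0 < r) (hz : z ∈ upper)
    (hq : q ∈ upper) (hMq : M.app q = r * Complex.I)
    (hL : HasFDerivAt L (imForm (M.c / (M.c * z + M.d))) z)
    (h : r < (M.app z).im) : HasFDerivAt (fun z => rayAngle f M r z + L z) (angForm q z +
      (2 * Real.pi) • (f.kernel ((M.app z).re / taper r (M.app z).im) •
        fderiv ℝ (fun z => (M.app z).re / taper r (M.app z).im) z)) z := by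
  have hzq : z ≠ q := fun k => by
    rw [k, hMq] at h
    simp at h
  have h1 := hasFDerivAt_arg_app M (κ := -Complex.I) hz hq (by simp) hzq hL
    (by rw [hMq]; exact neg_I_mul_mem h)
  have h2 := ((f.hasDerivAt_step _).comp_hasFDerivAt z
    ((contDiffAt_re_div_taper hr hz h).differentiableAt (by simp)).hasFDerivAt).const_mul
      (2 * Real.pi)
  refine (h1.add h2).congr_of_eventuallyEq ?_
  filter_upwards [rayAngle_eventuallyEq_of_lt (f := f) hz h] with w hw
  rw [hw, hMq]
  simp only [Pi.add_apply, Function.comp]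
  ring

lemma hasFDerivAt_rayAngle_of_le {L : ℂ → ℝ} {q : ℂ} (hr : 0 < r) (hz : z ∈ upper)
    (hq : q ∈ upper) (hMq : M.app q = r * Complex.I) (hzq : M.app z ≠ r * Complex.I)
    (hL : HasFDerivAt L (imForm (M.c / (M.c * z + M.d))) z)
    (h : (M.app z).im ≤ r) : HasFDerivAt (fun z => rayAngle f M r z + L z) (angForm q z) z := by
  have h1 := hasFDerivAt_arg_app M (κ := Complex.I) hz hq (by simp)
    (fun k => hzq (by rw [k, hMq])) hL (by rw [hMq]; exact I_mul_mem h hzq)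
  refine h1.congr_of_eventuallyEq ?_
  filter_upwards [rayAngle_eventuallyEq_of_le (f := f) hr hz h hzq] with w hw
  rw [hw, hMq]

end Ray

/-- Where `taper` is the identity, the argument of the step function is the height above `g`, so the
smoothed cut contributes `2π ω_g`. Since `taper` is at most the identity, a height at least `sinh 1`
forces the kernel to vanish; so away from the tube around the ray only the angle form remains. -/
lemma exists_ray_primitive (f : CutoffProfile) (g : Geodesic) (t₀ : ℝ) :
    ∃ Y : ℂ → ℝ, ContDiffOn ℝ (⊤ : ℕ∞) Y upper ∧
      (∀ z : ℍ, (∀ t, t₀ ≤ t → 1 < dist z (g.point t)) →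
        HasFDerivAt Y (angForm (g.point t₀) z) z) ∧
      ∃ R, ∀ z : ℍ, R < dist (g.point t₀) z → HasFDerivAt Y (angForm (g.point t₀) z +
        (2 * Real.pi) • (if t₀ < g.pos z then geodesicForm f g z else 0)) z := by
  obtain ⟨L, hL⟩ := exists_argCorrection g.chart.inv
  set M := g.chart.inv with hM
  set r := Real.exp t₀ with hr'
  have hr : 0 < r := Real.exp_pos _
  set q := g.point t₀ with hq
  have hMq : M.app q = r * Complex.I := by
    rw [hq, g.coe_point, hM, Moebius.inv_app _ (by simp [-Complex.ofReal_exp, Real.exp_pos])]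
  have hne : ∀ z : ℍ, 0 < dist z q → M.app z ≠ r * Complex.I := fun z hz k => by
    have h1 : M.act z = M.act q := UpperHalfPlane.ext (by simpa [hMq] using k)
    rw [← M.dist_act, h1, dist_self] at hz
    exact lt_irrefl _ hz
  have hheight : ∀ z : ℍ, g.height z = (M.app z).re / (M.app z).im :=
    fun z => g.sinhDist_eq z.im_pos
  have hk : ∀ z : ℍ, r < (M.app z).im → Real.sinh 1 ≤ |g.height z| →
      f.kernel ((M.app z).re / taper r (M.app z).im) = 0 := by
    intro z h1 h2
    apply f.kernel_eq_zero_of_le_abs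
    refine h2.trans ?_
    rw [hheight, abs_div, abs_div, abs_of_pos (taper_pos hr h1), abs_of_pos (hr.trans h1)]
    exact div_le_div_of_nonneg_left (abs_nonneg _) (taper_pos hr h1) (taper_le hr _)
  have key : ∀ z : ℍ, 1 < dist z q → (r < (M.app z).im → Real.sinh 1 ≤ |g.height z|) →
      HasFDerivAt (fun z => bump q z * (rayAngle f M r z + L z)) (angForm q z) z := by
    intro z hz h
    refine hasFDerivAt_bump_mul hz ?_
    rcases lt_or_ge r (M.app z).im with h1 | h1
    · have := hasFDerivAt_rayAngle_of_lt (f := f) hr z.im_pos q.im_pos hMq (hL z z.im_pos).2 h1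
      rwa [hk z h1 (h h1), zero_smul, smul_zero, add_zero] at this
    · exact hasFDerivAt_rayAngle_of_le hr z.im_pos q.im_pos hMq (hne z (by linarith))
        (hL z z.im_pos).2 h1
  -- This `R` bounds the transition zone of the tube. Below it the projection on `g` comes before
  -- `t₀`, the error being at most `log (1 + sinh 1)`; above it `Im > 3 r` and `taper` is the
  -- identity.
  obtain ⟨R, hR⟩ := g.exists_dist_le q (Real.sinh 1) (t₀ - Real.log (1 + Real.sinh 1))
    (t₀ + Real.log 3)
  have hs1 := Real.sinh_pos_iff.2 one_pos
  refine ⟨fun z => bump q z * (rayAngle f M r z + L z), contDiffOn_bump_mul fun z hz => ?_,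
    fun z hz => key z (hz t₀ le_rfl) fun h1 => ?_, max R 1, fun z hz => ?_⟩
  · exact (contDiffAt_rayAngle hr z.im_pos (hne z (by linarith))).add (hL z z.im_pos).1
  · have h2 : t₀ < g.pos z := by
      refine lt_of_lt_of_le ?_ (g.log_im_le_pos z)
      rwa [Real.lt_log_iff_exp_lt (hr.trans h1)]
    have h3 := hz _ h2.le
    rw [g.dist_foot] at h3
    rw [← Real.arsinh_le_arsinh, Real.arsinh_sinh]
    refine h3.le.trans (le_of_eq ?_)
    rcases le_total 0 (g.height z) with h4 | h4
    · rw [abs_of_nonneg h4, abs_of_nonneg (Real.arsinh_nonneg_iff.2 h4)]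
    · rw [abs_of_nonpos h4, abs_of_nonpos (Real.arsinh_nonpos_iff.2 h4), Real.arsinh_neg]
  · have hz1 : 1 < dist z q := by rw [dist_comm]; exact (le_max_right _ _).trans_lt hz
    have hz2 : R < dist q z := (le_max_left _ _).trans_lt hz
    rcases le_or_gt (Real.sinh 1) |g.height z| with h1 | h1
    · rw [geodesicForm_eq_zero f g z.im_pos h1, ite_self, smul_zero, add_zero]
      exact key z hz1 fun _ => h1
    have him : 0 < (M.app z).im := M.im_app_pos z.im_pos
    have hu : (g.unfermi z).im = Real.log (M.app z).im := rfl
    have hz3 : ¬ (t₀ - Real.log (1 + Real.sinh 1) ≤ Real.log (M.app z).im ∧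
        Real.log (M.app z).im ≤ t₀ + Real.log 3) := by
      rintro ⟨h2, h3⟩
      have := hR (g.unfermi z) h1.le (by rwa [hu]) (by rwa [hu])
      rw [show g.fermiH (g.unfermi z) = z from UpperHalfPlane.ext (g.fermi_unfermi z.im_pos)] at this
      exact this.not_gt hz2
    have hlog3 : 0 < Real.log 3 := Real.log_pos (by norm_num)
    rcases le_or_gt (t₀ - Real.log (1 + Real.sinh 1)) (Real.log (M.app z).im) with h2 | h2
    · have h3 : t₀ + Real.log 3 < Real.log (M.app z).im := not_le.1 fun k => hz3 ⟨h2, k⟩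
      have h4 : t₀ < g.pos z := by
        have := g.log_im_le_pos z
        rw [← hM] at this
        linarith
      have h5 : 3 * r < (M.app z).im := by
        have := Real.exp_lt_exp.2 h3
        rwa [Real.exp_log him, Real.exp_add, Real.exp_log (by norm_num), mul_comm] at this
      rw [if_pos h4]
      refine hasFDerivAt_bump_mul hz1 ?_
      have h6 := hasFDerivAt_rayAngle_of_lt (f := f) hr z.im_pos q.im_pos hMq (hL z z.im_pos).2
        (by linarith)
      refine h6.congr_fderiv ?_
      congr 2
      rw [geodesicForm_eq f g z.im_pos, taper_of_ge hr h5.le, hheight]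
      congr 1
      apply Filter.EventuallyEq.fderiv_eq
      have hc : ContinuousAt (fun z => (M.app z).im) z :=
        Complex.continuous_im.continuousAt.comp (contDiffAt_app z.im_pos).continuousAt
      filter_upwards [hc.eventually_const_lt h5, upper_mem_nhds z.im_pos] with w hw hw'
      rw [taper_of_ge hr hw.le]
      exact (hheight ⟨w, hw'⟩).symm
    · have h4 : ¬ t₀ < g.pos z := by
        have := g.pos_fermi_le (g.unfermi z)
        rw [g.fermi_unfermi z.im_pos, hu] at this
        have h5 : Real.log (1 + |(g.unfermi z).re|) ≤ Real.log (1 + Real.sinh 1) :=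
          Real.log_le_log (by positivity) (by linarith [show |(g.unfermi z).re| < _ from h1])
        linarith
      rw [if_neg h4, smul_zero, add_zero]
      refine key z hz1 fun h5 => ?_
      have h6 : t₀ < Real.log (M.app z).im := by rwa [Real.lt_log_iff_exp_lt him]
      have h7 : 0 < Real.log (1 + Real.sinh 1) := Real.log_pos (by linarith)
      linarith

/-- The angle form at the foot of the perpendicular, produced by the ray, is cancelled by the chain
that leads back to `x`; only the singular form at `x` is left, and it does not depend on `g`. -/
lemma exists_half_arc_primitive (f : CutoffProfile) (x : ℍ) (g : Geodesic) :
    ∃ Y : ℂ → ℝ, ContDiffOn ℝ (⊤ : ℕ∞) Y upper ∧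
      (∀ z : ℍ, (∀ w ∈ hypSegment x (g.foot x) ∪ g.point '' Ici (g.pos x), 1 < dist z w) →
        HasFDerivAt Y (angForm x z) z) ∧
      ∃ R, ∀ z : ℍ, R < dist x z → HasFDerivAt Y (angForm x z +
        (2 * Real.pi) • (if g.pos x < g.pos z then geodesicForm f g z else 0)) z := by
  obtain ⟨Y, h1, h2, R, h3⟩ := exists_perp_chain g x
  obtain ⟨Z, k1, k2, S, k3⟩ := exists_ray_primitive f g (g.pos x)
  refine ⟨fun z => Y z + Z z, h1.add k1, fun z hz => ?_,
    max R (S + dist x (g.point (g.pos x))), fun z hz => ?_⟩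
  · refine ((h2 z fun w hw => hz w (Or.inl hw)).add (k2 z fun t ht =>
      hz _ (Or.inr ⟨t, ht, rfl⟩))).congr_fderiv ?_
    rw [Geodesic.foot]
    abel
  · have hS : S < dist (g.point (g.pos x)) z := by
      have := dist_triangle x (g.point (g.pos x)) z
      have := (le_max_right _ _).trans_lt hz
      linarith
    refine ((h3 z ((le_max_left _ _).trans_lt hz)).add (k3 z hS)).congr_fderiv ?_
    rw [Geodesic.foot]
    abel

lemma hypSegment_comm (p q : ℍ) : hypSegment p q = hypSegment q p := by
  ext w
  simp only [hypSegment, Set.mem_ofPred_eq]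
  rw [dist_comm q w, dist_comm w p, dist_comm q p, add_comm]

/-- The two half-arcs issued from `x` carry the same singular form, so their difference, divided by
`2π`, is supported near the arc. The initial ray is treated as a final ray of the reversed geodesic;
subtraction and reversal both change the sign. -/
lemma exists_isPolygonalArcForm (f : CutoffProfile) (x : ℍ) (g' g : Geodesic) :
    ∃ ω, IsPolygonalArcForm f x g' g ω := by
  obtain ⟨Y, h1, h2, R, h3⟩ := exists_half_arc_primitive f x g
  obtain ⟨Z, k1, k2, S, k3⟩ := exists_half_arc_primitive f x g'.rev
  have hd : ∀ z ∈ upper, HasFDerivAt (fun z => (2 * Real.pi)⁻¹ * (Y z - Z z))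
      ((2 * Real.pi)⁻¹ • (fderiv ℝ Y z - fderiv ℝ Z z)) z := fun z hz =>
    ((((h1.contDiffAt (upper_mem_nhds hz)).differentiableAt (by simp)).hasFDerivAt.sub
      ((k1.contDiffAt (upper_mem_nhds hz)).differentiableAt (by simp)).hasFDerivAt).const_mul _)
  have hs := isSmoothClosed_of_primitive (contDiffOn_const.mul (h1.sub k1)) hd
  have e1 : g'.rev.foot x = g'.foot x := by
    rw [Geodesic.foot, g'.point_rev, g'.pos_rev, neg_neg, Geodesic.foot]
  have e2 : g'.rev.point '' Ici (g'.rev.pos x) = g'.point '' Iic (g'.pos x) := by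
    ext w
    simp only [Set.mem_image, mem_Ici, mem_Iic, g'.point_rev, g'.pos_rev]
    constructor
    · rintro ⟨t, ht, rfl⟩
      exact ⟨-t, by linarith, rfl⟩
    · rintro ⟨t, ht, rfl⟩
      exact ⟨-t, by linarith, by rw [neg_neg]⟩
  refine ⟨_, hs.smooth, hs.closed, fun z hz => ?_, max R S, fun z hz => ?_⟩
  · rw [(h2 z fun w hw => hz w ?_).fderiv, (k2 z fun w hw => hz w ?_).fderiv, sub_self, smul_zero]
    · rw [e1, e2, hypSegment_comm] at hw
      exact Or.inl (Or.inl hw.symm)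
    · rcases hw with hw | hw
      · exact Or.inl (Or.inr hw)
      · exact Or.inr hw
  · rw [(h3 z ((le_max_left _ _).trans_lt hz)).fderiv,
      (k3 z ((le_max_right _ _).trans_lt hz)).fderiv, add_sub_add_left_eq_sub, ← smul_sub,
      smul_smul, inv_mul_cancel₀ (by positivity), one_smul, g'.pos_rev, g'.pos_rev, geodesicForm_rev]
    simp only [neg_lt_neg_iff]
    split_ifs <;> simp [add_comm]

section

variable {n p : ℕ} [NeZero p]

lemma nonempty_arcForms (f : CutoffProfile) (x : ℍ) (G : Fin p → ThetaGeodesic n) :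
    Nonempty (ArcForms f x G) := by
  choose F hF using exists_isPolygonalArcForm f x
  exact ⟨⟨fun i => F (G (i + 1)).geod (G i).geod, fun i => hF _ _⟩⟩

end

/-! ### Endomorphism valued forms attached to families of edges -/

section EdgeForms

variable {V : Type*} [NormedAddCommGroup V] [NormedSpace ℝ V]

lemma tr_add (A B : V →L[ℝ] V) : tr (A + B) = tr A + tr B := by simp [tr]

lemma tr_smul (c : ℝ) (A : V →L[ℝ] V) : tr (c • A) = c * tr A := by simp [tr]

variable (V) in
/-- The trace as a linear form on continuous endomorphisms. -/
def trLin : (V →L[ℝ] V) →ₗ[ℝ] ℝ where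
  toFun := tr
  map_add' := tr_add
  map_smul' := tr_smul

lemma trLin_apply (A : V →L[ℝ] V) : trLin V A = tr A := rfl

lemma tr_sub (A B : V →L[ℝ] V) : tr (A - B) = tr A - tr B := map_sub (trLin V) A B

lemma tr_sum {ι : Type*} (s : Finset ι) (A : ι → V →L[ℝ] V) : tr (∑ i ∈ s, A i) = ∑ i ∈ s, tr (A i) :=
  map_sum (trLin V) A s

variable {ι κ : Type*} [Fintype ι] [Fintype κ]

/-- The form `α` is the sum over a family of edges of closed forms dual to the edges, with
coefficients `A`. -/
def IsEdgeSum (f : CutoffProfile) (α : EndForm V) (e : ι → OnePoint ℝ × OnePoint ℝ)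
    (A : ι → V →L[ℝ] V) : Prop :=
  ∃ ω : ι → Form, (∀ k, ∃ x g' g, HasGeodesicEnds f x g' g (ω k) ∧ e k = (g'.1.1, g.1.2)) ∧
    ∀ z, α z = ∑ k, (ω k z).smulRight (A k)

variable {f : CutoffProfile} {α β : EndForm V} {e : ι → OnePoint ℝ × OnePoint ℝ}
  {A : ι → V →L[ℝ] V} {e' : κ → OnePoint ℝ × OnePoint ℝ} {A' : κ → V →L[ℝ] V}

/-- Bilinearity reduces this to the scalar products of forms with geodesic ends. -/
lemma IsEdgeSum.integral_trWedge (hα : IsEdgeSum f α e A) (hβ : IsEdgeSum f β e' A') :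
    IntegrableOn (trWedge α β) upper ∧
      ∫ z in upper, trWedge α β z = ∑ k, ∑ l, eps (e k) (e' l) * tr (A k * A' l) := by
  obtain ⟨ω, h1, h2⟩ := hα
  obtain ⟨η, h3, h4⟩ := hβ
  have key : trWedge α β = fun z => ∑ k, ∑ l, wedge (ω k z) (η l z) * tr (A k * A' l) := by
    funext z
    simp only [trWedge, h2, h4, sum_apply, ContinuousLinearMap.smulRight_apply,
      Finset.sum_mul_sum, tr_sum, smul_mul_smul_comm, tr_smul]
    rw [← Finset.sum_sub_distrib]
    refine Finset.sum_congr rfl fun k _ => ?_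
    rw [← Finset.sum_sub_distrib]
    refine Finset.sum_congr rfl fun l _ => ?_
    rw [wedge]
    ring
  have hw : ∀ k l, IntegrableOn (fun z => wedge (ω k z) (η l z)) upper ∧
      ∫ z in upper, wedge (ω k z) (η l z) = eps (e k) (e' l) := by
    intro k l
    obtain ⟨x, g', g, k1, k2⟩ := h1 k
    obtain ⟨y, g₁', g₁, k3, k4⟩ := h3 l
    rw [k2, k4]
    exact k1.integral_wedge k3
  have hi : ∀ k l, Integrable (fun z => wedge (ω k z) (η l z) * tr (A k * A' l))
      (volume.restrict upper) := fun k l => (hw k l).1.mul_const _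
  rw [key]
  refine ⟨integrable_finsetSum _ fun k _ => integrable_finsetSum _ fun l _ => hi k l, ?_⟩
  rw [integral_finsetSum _ fun k _ => integrable_finsetSum _ fun l _ => hi k l]
  refine Finset.sum_congr rfl fun k _ => ?_
  rw [integral_finsetSum _ fun l _ => hi k l]
  refine Finset.sum_congr rfl fun l _ => ?_
  rw [integral_mul_const, (hw k l).2]

lemma IsEdgeSum.continuous_line_hasCompactSupport (hα : IsEdgeSum f α e A) (γ : Geodesic) :
    Continuous (fun t => α (γ.point t) (γ.velocity t)) ∧
      HasCompactSupport (fun t => α (γ.point t) (γ.velocity t)) := by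
  obtain ⟨ω, h1, h2⟩ := hα
  have key : (fun t => α (γ.point t) (γ.velocity t)) =
      fun t => ∑ k, ω k (γ.point t) (γ.velocity t) • A k := by
    funext t
    simp [h2]
  have h3 : ∀ k, Continuous (fun t => ω k (γ.point t) (γ.velocity t)) ∧
      HasCompactSupport (fun t => ω k (γ.point t) (γ.velocity t)) := fun k => by
    obtain ⟨x, g', g, k1, k2⟩ := h1 k
    exact ⟨(continuous_line k1 γ).1, (continuous_line k1 γ).2.1⟩
  rw [key]
  refine ⟨continuous_finsetSum _ fun k _ => (h3 k).1.smul continuous_const, ?_⟩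
  rw [hasCompactSupport_iff_eventuallyEq]
  have : ∀ᶠ t in coclosedCompact ℝ, ∀ k, ω k (γ.point t) (γ.velocity t) = 0 :=
    eventually_all.2 fun k => hasCompactSupport_iff_eventuallyEq.1 (h3 k).2
  filter_upwards [this] with t ht
  simp [ht]

lemma IsEdgeSum.exists_primitive (hα : IsEdgeSum f α e A) : ∃ (φ : ι → ℂ → ℝ)
    (c : ι → OnePoint ℝ → ℝ), IsPrimitive (fun z => ∑ k, φ k z • A k) α ∧
      (∀ k, IsBoundaryValue f (φ k) (c k)) ∧ ∀ k a b, c k b - c k a = eps (a, b) (e k) := by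
  obtain ⟨ω, h1, h2⟩ := hα
  have : ∀ k, ∃ φ : ℂ → ℝ, (∀ z ∈ upper, HasFDerivAt φ (ω k z) z) ∧ ∃ c, IsBoundaryValue f φ c ∧
      ∀ a b, c b - c a = eps (a, b) (e k) := by
    intro k
    obtain ⟨x, g', g, k1, k2⟩ := h1 k
    obtain ⟨φ, hφ⟩ := k1.exists_primitive
    obtain ⟨c, hc⟩ := k1.exists_boundaryValue hφ
    exact ⟨φ, hφ, c, hc, fun a b => by rw [k2]; exact k1.boundaryValue_sub hφ hc a b⟩
  choose φ hφ c hc hcc using this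
  refine ⟨φ, c, fun z => ?_, hc, hcc⟩
  rw [h2]
  exact HasFDerivAt.fun_sum fun k _ => (hφ k z z.im_pos).smul_const (A k)

/-- The endomorphisms `c a` are the limits of `B` at the ends of geodesics. -/
def HasBoundaryLimits (B : ℂ → V →L[ℝ] V) (c : OnePoint ℝ → V →L[ℝ] V) : Prop :=
  ∀ γ : Geodesic, Tendsto (fun t => B (γ.point t)) atTop (𝓝 (c γ.1.2)) ∧
    Tendsto (fun t => B (γ.point t)) atBot (𝓝 (c γ.1.1))

/-- Any primitive differs by a constant endomorphism from the one built edge by edge, and the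
constant disappears from the variation `c b - c a`. -/
lemma IsEdgeSum.exists_boundaryLimits (hα : IsEdgeSum f α e A) {B : ℂ → V →L[ℝ] V}
    (hB : IsPrimitive B α) : ∃ c, HasBoundaryLimits B c ∧
      ∀ a b, c b - c a = ∑ k, eps (a, b) (e k) • A k := by
  obtain ⟨φ, c, h1, h2, h3⟩ := hα.exists_primitive
  obtain ⟨C, hC⟩ := eq_add_const_of_hasFDerivAt (φ₁ := B) (fun z hz => hB ⟨z, hz⟩)
    (fun z hz => h1 ⟨z, hz⟩)
  refine ⟨fun a => ∑ k, c k a • A k + C, fun γ => ⟨?_, ?_⟩, fun a b => ?_⟩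
  · refine tendsto_const_nhds.congr' ?_
    have : ∀ᶠ t in atTop, ∀ k, φ k (γ.point t) = c k γ.1.2 :=
      eventually_all.2 fun k => (h2 k).eventually_atTop γ
    filter_upwards [this] with t ht
    rw [hC _ (γ.point t).im_pos]
    simp only [ht]
  · refine tendsto_const_nhds.congr' ?_
    have : ∀ᶠ t in atBot, ∀ k, φ k (γ.point t) = c k γ.1.1 :=
      eventually_all.2 fun k => (h2 k).eventually_atBot γ
    filter_upwards [this] with t ht
    rw [hC _ (γ.point t).im_pos]
    simp only [ht]
  · rw [add_sub_add_right_eq_sub, ← Finset.sum_sub_distrib]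
    exact Finset.sum_congr rfl fun k _ => by rw [← sub_smul, h3]

variable [FiniteDimensional ℝ V]

lemma IsEdgeSum.integrable_line (hα : IsEdgeSum f α e A) (γ : Geodesic)
    (ℓ : (V →L[ℝ] V) →ₗ[ℝ] ℝ) : Integrable fun t => ℓ (α (γ.point t) (γ.velocity t)) := by
  obtain ⟨h1, h2⟩ := hα.continuous_line_hasCompactSupport γ
  exact (ℓ.continuous_of_finiteDimensional.comp h1).integrable_of_hasCompactSupport
    (h2.comp_left (map_zero ℓ))

lemma IsEdgeSum.lineIntegrable (hα : IsEdgeSum f α e A) : LineIntegrable α := fun γ A =>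
  hα.integrable_line γ (trLin V ∘ₗ LinearMap.mulRight ℝ A)

lemma Geodesic.hasDerivAt_point (γ : Geodesic) (t : ℝ) :
    HasDerivAt (fun s => (γ.point s : ℂ)) (γ.velocity t) t := by
  refine DifferentiableAt.hasDerivAt ?_
  have h0 : (fun t : ℝ => (γ.point t : ℂ)) = fun t : ℝ => γ.chart.app (Real.exp t * Complex.I) :=
    funext γ.coe_point
  rw [h0]
  have h1 : (0 : ℝ) < (Real.exp t * Complex.I).im := by
    simp [-Complex.ofReal_exp, Real.exp_pos]
  have h2 := (γ.chart.hasDerivAt_app h1).differentiableAt.restrictScalars ℝ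
  exact h2.comp t (f := fun t : ℝ => (Real.exp t * Complex.I : ℂ))
    ((Real.hasDerivAt_exp t).ofReal_comp.mul_const _).differentiableAt

lemma IsPrimitive.hasDerivAt_line {B : ℂ → V →L[ℝ] V} (hB : IsPrimitive B α) (γ : Geodesic)
    (ℓ : (V →L[ℝ] V) →ₗ[ℝ] ℝ) (t : ℝ) :
    HasDerivAt (fun t => ℓ (B (γ.point t))) (ℓ (α (γ.point t) (γ.velocity t))) t := by
  have h1 := (hB (γ.point t)).comp_hasDerivAt t (γ.hasDerivAt_point t)
  exact (LinearMap.toContinuousLinearMap ℓ).hasFDerivAt.comp_hasDerivAt t h1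

variable {B : ℂ → V →L[ℝ] V} {c : OnePoint ℝ → V →L[ℝ] V}

lemma HasBoundaryLimits.tendsto (hc : HasBoundaryLimits B c) (γ : Geodesic)
    (ℓ : (V →L[ℝ] V) →ₗ[ℝ] ℝ) :
    Tendsto (fun t => ℓ (B (γ.point t))) atTop (𝓝 (ℓ (c γ.1.2))) ∧
    Tendsto (fun t => ℓ (B (γ.point t))) atBot (𝓝 (ℓ (c γ.1.1))) :=
  ⟨(ℓ.continuous_of_finiteDimensional.tendsto _).comp (hc γ).1,
    (ℓ.continuous_of_finiteDimensional.tendsto _).comp (hc γ).2⟩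

lemma IsEdgeSum.integral_line (hα : IsEdgeSum f α e A) (γ : Geodesic)
    (ℓ : (V →L[ℝ] V) →ₗ[ℝ] ℝ) :
    ∫ t, ℓ (α (γ.point t) (γ.velocity t)) = ∑ k, eps γ.1 (e k) * ℓ (A k) := by
  obtain ⟨φ, -, hB, -⟩ := hα.exists_primitive
  obtain ⟨c, hc, hc'⟩ := hα.exists_boundaryLimits hB
  rw [integral_of_hasDerivAt_of_tendsto (hB.hasDerivAt_line γ ℓ) (hα.integrable_line γ ℓ)
    (hc.tendsto γ ℓ).2 (hc.tendsto γ ℓ).1, ← map_sub, hc', map_sum]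
  simp

/-- As `p² = p`, cyclicity of the trace makes the integrands `Tr (α (pQ - pQp))` and `Tr (α (pQp -
Qp))`, linear in `α`. The fundamental theorem of calculus applies, and the contributions of the base
point add up to `-Tr (B [p, Q])`, which cancels the first term: the base point is irrelevant. -/
lemma IsEdgeSum.lineIntegration_eq (hα : IsEdgeSum f α e A) (hB : IsPrimitive B α)
    (hc : HasBoundaryLimits B c) (γ : Geodesic) (t : ℝ) (p Q : V →L[ℝ] V) (hp : p * p = p) :
    tr (B (γ.point t) * ⁅p, Q⁆) + lineIntegration γ t p Q α =
      tr (c γ.1.2 * (p * Q)) - tr (c γ.1.1 * (Q * p)) -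
        tr ((c γ.1.2 - c γ.1.1) * (p * Q * p)) := by
  set ℓ₁ : (V →L[ℝ] V) →ₗ[ℝ] ℝ := trLin V ∘ₗ LinearMap.mulRight ℝ (p * Q - p * Q * p) with hℓ₁
  set ℓ₂ : (V →L[ℝ] V) →ₗ[ℝ] ℝ := trLin V ∘ₗ LinearMap.mulRight ℝ (p * Q * p - Q * p) with hℓ₂
  have e1 : ∀ X, tr (Q * ⁅X, p⁆ * p) = ℓ₁ X := fun X => by
    simp only [hℓ₁, LinearMap.comp_apply, LinearMap.mulRight_apply, trLin_apply, Ring.lie_def]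
    have k1 : Q * (X * p - p * X) * p = (Q * X) * p - Q * p * (X * p) := by
      rw [mul_sub, sub_mul]
      simp only [mul_assoc, hp]
    rw [k1, tr_sub, mul_sub, tr_sub, mul_assoc Q, tr_mul_comm Q, tr_mul_comm (Q * p)]
    simp only [mul_assoc]
  have e2 : ∀ X, tr (Q * p * ⁅X, p⁆) = ℓ₂ X := fun X => by
    simp only [hℓ₂, LinearMap.comp_apply, LinearMap.mulRight_apply, trLin_apply, Ring.lie_def]
    have k1 : Q * p * (X * p - p * X) = (Q * p * X) * p - Q * p * X := by
      rw [mul_sub, ← mul_assoc, ← mul_assoc, mul_assoc Q p p, hp]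
    rw [k1, tr_sub, mul_sub, tr_sub, tr_mul_comm (Q * p * X), tr_mul_comm X, tr_mul_comm X]
    simp only [mul_assoc]
  rw [lineIntegration]
  simp only [e1, e2]
  rw [integral_Ioi_of_hasDerivAt_of_tendsto' (fun s _ => hB.hasDerivAt_line γ ℓ₁ s)
      (hα.integrable_line γ ℓ₁).integrableOn (hc.tendsto γ ℓ₁).1, ← integral_Iic_eq_integral_Iio,
    integral_Iic_of_hasDerivAt_of_tendsto' (fun s _ => hB.hasDerivAt_line γ ℓ₂ s)
      (hα.integrable_line γ ℓ₂).integrableOn (hc.tendsto γ ℓ₂).2]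
  simp only [hℓ₁, hℓ₂, LinearMap.comp_apply, LinearMap.mulRight_apply, trLin_apply, Ring.lie_def,
    mul_sub, sub_mul, tr_sub]
  ring

end EdgeForms

/-! ### Sums over the edges of a ghost polygon -/

section Polygons

variable {n p : ℕ} [NeZero p]

/-- The sum of the values at the visible edges minus the sum of the values at the ghost edges. -/
def edgeSum (G : Fin p → ThetaGeodesic n) (a : Edge n → ℝ) : ℝ :=
  ∑ i, (a (visibleEdge G i) - a (ghostEdge G i))

lemma sum_range_two_mul (F : ℕ → ℝ) (q : ℕ) :
    ∑ k ∈ Finset.range (2 * q), F k = ∑ i ∈ Finset.range q, (F (2 * i) + F (2 * i + 1)) := by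
  induction q with
  | zero => simp
  | succ q ih =>
    rw [Finset.sum_range_succ, ← ih, mul_add, mul_one, Finset.sum_range_succ, Finset.sum_range_succ]
    ring

lemma sum_Icc_ghostPolygon (G : Fin p → ThetaGeodesic n) (a : Edge n → ℝ) :
    ∑ k ∈ Finset.Icc 1 (2 * p), (-1 : ℝ) ^ k * a (ghostPolygon G k) = edgeSum G a := by
  set F : ℕ → ℝ := fun k => (-1 : ℝ) ^ k * a (ghostPolygon G k) with hF
  -- The indices of the geodesics being modulo `p`, the last term of a sum starting at `1` is the
  -- term of index `0`.
  have h0 : F (2 * p) = F 0 := by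
    simp only [hF, ghostPolygon, even_two_mul, if_true, Even.zero, pow_zero, Even.neg_one_pow,
      Nat.zero_div]
    rw [Nat.mul_div_cancel_left _ two_pos]
    congr 3
    apply Fin.ext
    simp
  have h1 : ∑ k ∈ Finset.Icc 1 (2 * p), F k = ∑ k ∈ Finset.range (2 * p), F k := by
    have e1 := Finset.sum_range_succ F (2 * p)
    have e2 := Finset.sum_range_succ' F (2 * p)
    have e3 : ∑ k ∈ Finset.Icc 1 (2 * p), F k = ∑ k ∈ Finset.range (2 * p), F (k + 1) := by
      rw [← Finset.sum_image (s := Finset.range (2 * p)) (g := fun k => k + 1) (f := F)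
        (by intro x _ y _ h; simpa using h)]
      congr 1
      ext k
      simp only [Finset.mem_Icc, Finset.mem_image, Finset.mem_range]
      constructor
      · rintro ⟨h1, h2⟩
        exact ⟨k - 1, by omega, by omega⟩
      · rintro ⟨j, h1, rfl⟩
        omega
    linarith
  rw [h1, sum_range_two_mul, ← Fin.sum_univ_eq_sum_range (fun i => F (2 * i) + F (2 * i + 1)),
    edgeSum]
  refine Finset.sum_congr rfl fun i _ => ?_
  have e1 : (2 * (i : ℕ) + 1) / 2 = i := by omega
  have e2 : (2 * (i : ℕ)) / 2 = i := by omega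
  have e3 : ¬ Even (2 * (i : ℕ) + 1) := by simp
  simp only [hF, ghostPolygon, even_two_mul, if_true, e1, e2, if_neg e3, Even.neg_one_pow,
    pow_succ, Fin.ofNat_val_eq_self]
  ring

lemma rotate_ofFn {α : Type*} {q : ℕ} (g : Fin q → α) (i : Fin q) :
    (List.ofFn g).rotate i = List.ofFn fun k => g (i + k) := by
  apply List.ext_getElem
  · simp
  · intro k h1 h2
    rw [List.getElem_rotate]
    simp only [List.getElem_ofFn, List.length_ofFn]
    congr 1
    apply Fin.ext
    rw [Fin.val_add]
    simp [add_comm]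

/-- The representatives are counted with multiplicity: a configuration with a cyclic symmetry still
has `p` of them, which agrees with a sum over indices. -/
lemma lists_ofFn {α : Type*} (g : Fin p → α) :
    (List.ofFn g : Cycle α).lists =
      (Finset.univ : Finset (Fin p)).val.map fun i => List.ofFn fun k => g (i + k) := by
  have hne : List.ofFn g ≠ [] := by simp [List.ofFn_eq_nil_iff, NeZero.ne p]
  rw [Cycle.lists_coe, Fin.univ_def]
  simp only [Multiset.map_coe, Multiset.coe_eq_coe]
  apply List.Perm.of_eq
  apply List.ext_getElem
  · rw [List.length_cyclicPermutations_of_ne_nil _ hne]; simp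
  · intro k h1 h2
    rw [List.getElem_cyclicPermutations, List.getElem_map, List.getElem_finRange, ← rotate_ofFn]
    simp

/-- The representative starting at `g_i` ends with `g_{i-1}`, so its ghost edge is `ζ_{i-1}`; the
shift disappears when all representatives are summed. -/
lemma edgesOfList_rot (g : Fin p → ThetaGeodesic n) (i : Fin p) :
    edgesOfList (rot g i) = {(1, visibleEdge g i), (-1, ghostEdge g (i - 1))} := by
  obtain ⟨q, rfl⟩ : ∃ q, p = q + 1 := ⟨p - 1, by have := NeZero.pos p; omega⟩
  have h : rot g i = g i :: List.ofFn fun k : Fin q => g (i + k.succ) := by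
    rw [rot, List.ofFn_succ, add_zero]
  have hl : ∀ hne : rot g i ≠ [], (rot g i).getLast hne = g (i - 1) := by
    intro hne
    simp only [rot]
    rw [List.getLast_ofFn, sub_eq_add_neg]
    congr 2
    exact eq_neg_of_add_eq_zero_left (Fin.last_add_one q)
  have key : ∀ (l : List (ThetaGeodesic n)) (hl : rot g i = g i :: l),
      edgesOfList (g i :: l) = {(1, visibleEdge g i), (-1, ghostEdge g (i - 1))} := by
    intro l hr
    have e1 : ghostEdge g (i - 1) = ⟨((g i).geod.1.1, (g (i - 1)).geod.1.2), rot g i,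
        rot_ne g i⟩ := by
      unfold ghostEdge
      congr 1 <;> simp
    rw [e1, edgesOfList]
    have e2 := hl (rot_ne g i)
    simp only [hr] at e2
    simp only [e2, hr, visibleEdge]
  rw [h]
  exact key _ h

lemma sum_signedEdges (g : Fin p → ThetaGeodesic n) (F : ℝ × Edge n → ℝ) :
    ((signedEdges (List.ofFn g : Cycle (ThetaGeodesic n))).map F).sum =
      ∑ i, (F (1, visibleEdge g i) + F (-1, ghostEdge g i)) := by
  rw [signedEdges, lists_ofFn, Multiset.bind_map, Multiset.map_bind, Multiset.sum_bind]
  change ((Finset.univ : Finset (Fin p)).val.map fun i =>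
    ((edgesOfList (rot g i)).map F).sum).sum = _
  simp only [edgesOfList_rot, Multiset.insert_eq_cons, Multiset.map_cons, Multiset.sum_cons,
    Multiset.map_singleton, Multiset.sum_singleton]
  change ∑ i : Fin p, _ = _
  rw [Finset.sum_add_distrib, Finset.sum_add_distrib]
  congr 1
  exact Equiv.sum_comp (Equiv.subRight (1 : Fin p)) fun i => F (-1, ghostEdge g i)

end Polygons

/-! ### Correlation functions of brackets -/

section Correlation

variable {V : Type*} [NormedAddCommGroup V] [NormedSpace ℝ V] [FiniteDimensional ℝ V]
  {n : ℕ} {K : Fin n → ℕ} (ρ : UniformlyHyperbolicBundle V K) {p m : ℕ} [NeZero p] [NeZero m]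

lemma correlation_coe (l : List (ThetaGeodesic n)) :
    ρ.correlation (l : Cycle (ThetaGeodesic n)) = tr (ρ.listProj l) := rfl

lemma listProj_append (l l' : List (ThetaGeodesic n)) :
    ρ.listProj (l ++ l') = ρ.listProj l' * ρ.listProj l := by
  simp [UniformlyHyperbolicBundle.listProj]

lemma listProj_cons (g : ThetaGeodesic n) (l : List (ThetaGeodesic n)) :
    ρ.listProj (g :: l) = ρ.listProj l * ρ.thetaProj g := by
  simp [UniformlyHyperbolicBundle.listProj]

lemma listProj_singleton (g : ThetaGeodesic n) : ρ.listProj [g] = ρ.thetaProj g := by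
  simp [UniformlyHyperbolicBundle.listProj]

/-- The correlation functions as a linear form on the ghost algebra. -/
def TLin : GhostSpace n →ₗ[ℝ] ℝ := Finsupp.linearCombination ℝ ρ.correlationGen

lemma TLin_apply (A : GhostSpace n) : TLin ρ A = ρ.T A := rfl

lemma T_config (l : List (ThetaGeodesic n)) (h : 2 ≤ l.length) :
    ρ.T (config l h) = tr (ρ.listProj l) := by
  simp [UniformlyHyperbolicBundle.T, config, UniformlyHyperbolicBundle.correlationGen,
    correlation_coe]

lemma ghostBracket_single (G H : Generator n) :
    ghostBracket K (Finsupp.single G 1) (Finsupp.single H 1) = bracketGen K G H := by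
  rw [ghostBracket, Finsupp.sum_single_index, Finsupp.sum_single_index] <;> simp

lemma T_multiset_sum {α : Type*} (s : Multiset α) (F : α → GhostSpace n) :
    ρ.T (s.map F).sum = (s.map fun x => ρ.T (F x)).sum := by
  rw [← TLin_apply, map_multiset_sum, Multiset.map_map]
  rfl

lemma T_smul (c : ℝ) (A : GhostSpace n) : ρ.T (c • A) = c * ρ.T A := map_smul (TLin ρ) c A

lemma T_neg (A : GhostSpace n) : ρ.T (-A) = -ρ.T A := map_neg (TLin ρ) A

lemma T_bracketPolygonGeodesic (G : Fin p → ThetaGeodesic n) (h : ThetaGeodesic n) :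
    ρ.T (bracketPolygonGeodesic (List.ofFn G : Cycle (ThetaGeodesic n)) h) =
      -edgeSum G fun θ => eps h.geod.1 θ.ends * tr (ρ.listProj (h :: θ.opp)) := by
  rw [bracketPolygonGeodesic, T_multiset_sum, sum_signedEdges, edgeSum, ← Finset.sum_neg_distrib]
  refine Finset.sum_congr rfl fun i _ => ?_
  simp only [T_smul, joinGeodesicEdge, T_config]
  ring

lemma T_ghostBracket_polygon_geodesic (hp : 2 ≤ p) (G : Fin p → ThetaGeodesic n)
    (h : ThetaGeodesic n) : ρ.T (ghostBracket K (ofTuple hp G) (ofGeodesic h)) =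
      -edgeSum G fun θ => eps h.geod.1 θ.ends * tr (ρ.listProj (h :: θ.opp)) := by
  rw [ofTuple, config, ofGeodesic, ghostBracket_single]
  exact T_bracketPolygonGeodesic ρ G h

lemma T_ghostBracket_geodesic_polygon (hp : 2 ≤ p) (G : Fin p → ThetaGeodesic n)
    (h : ThetaGeodesic n) : ρ.T (ghostBracket K (ofGeodesic h) (ofTuple hp G)) =
      edgeSum G fun θ => eps h.geod.1 θ.ends * tr (ρ.listProj (h :: θ.opp)) := by
  rw [ofTuple, config, ofGeodesic, ghostBracket_single]
  change ρ.T (-bracketPolygonGeodesic (List.ofFn G : Cycle (ThetaGeodesic n)) h) = _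
  rw [T_neg, T_bracketPolygonGeodesic, neg_neg]

lemma T_ghostBracket_polygons (hp : 2 ≤ p) (hm : 2 ≤ m) (G : Fin p → ThetaGeodesic n)
    (H : Fin m → ThetaGeodesic n) : ρ.T (ghostBracket K (ofTuple hp G) (ofTuple hm H)) =
      edgeSum G fun θ => edgeSum H fun σ =>
        eps σ.ends θ.ends * tr (ρ.listProj (σ.opp ++ θ.opp)) := by
  rw [ofTuple, config, ofTuple, config, ghostBracket_single]
  change ρ.T ((signedEdges (List.ofFn G : Cycle (ThetaGeodesic n)) ×ˢ
    signedEdges (List.ofFn H : Cycle (ThetaGeodesic n))).map fun q =>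
        (eps q.2.2.ends q.1.2.ends * (q.1.1 * q.2.1)) • joinEdges q.1.2 q.2.2).sum = _
  rw [T_multiset_sum]
  change ((Multiset.bind (signedEdges (List.ofFn G : Cycle (ThetaGeodesic n))) fun a =>
    (signedEdges (List.ofFn H : Cycle (ThetaGeodesic n))).map (Prod.mk a)).map _).sum = _
  rw [Multiset.map_bind, Multiset.sum_bind]
  simp only [Multiset.map_map, Function.comp_def, sum_signedEdges, T_smul, joinEdges, T_config,
    edgeSum]
  refine Finset.sum_congr rfl fun i _ => ?_
  rw [← Finset.sum_add_distrib, ← Finset.sum_sub_distrib]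
  refine Finset.sum_congr rfl fun j _ => ?_
  -- The bracket joins the opposite tuples in the order `θ*, σ*`; the trace does not see the
  -- exchange.
  simp only [listProj_append, tr_mul_comm (ρ.listProj (visibleEdge H j).opp),
    tr_mul_comm (ρ.listProj (ghostEdge H j).opp)]
  ring

end Correlation

/-! ### Ghost intersections and ghost integrals -/

section Intersections

variable {V : Type*} [NormedAddCommGroup V] [NormedSpace ℝ V] [FiniteDimensional ℝ V]
  {n : ℕ} {K : Fin n → ℕ} (ρ : UniformlyHyperbolicBundle V K) {p m : ℕ} [NeZero p] [NeZero m]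

lemma edgeSum_comm (G : Fin p → ThetaGeodesic n) (H : Fin m → ThetaGeodesic n)
    (F : Edge n → Edge n → ℝ) :
    edgeSum H (fun σ => edgeSum G fun θ => F σ θ) = edgeSum G fun θ => edgeSum H fun σ => F σ θ := by
  simp only [edgeSum, Finset.sum_sub_distrib]
  rw [Finset.sum_comm, Finset.sum_comm (f := fun i j => F (ghostEdge H i) (visibleEdge G j)),
    Finset.sum_comm (f := fun i j => F (visibleEdge H i) (ghostEdge G j)),
    Finset.sum_comm (f := fun i j => F (ghostEdge H i) (ghostEdge G j))]
  ring

lemma edgeSum_neg (G : Fin p → ThetaGeodesic n) (a : Edge n → ℝ) :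
    edgeSum G (fun θ => -a θ) = -edgeSum G a := by
  simp only [edgeSum, Finset.sum_sub_distrib, Finset.sum_neg_distrib]
  ring

/-- The pairs of endpoints of the edges of a ghost polygon. -/
def edgeEnds (G : Fin p → ThetaGeodesic n) : Fin p ⊕ Fin p → OnePoint ℝ × OnePoint ℝ :=
  Sum.elim (fun i => (visibleEdge G i).ends) fun i => (ghostEdge G i).ends

/-- The coefficients of the ghost dual form. -/
def edgeCoeff (G : Fin p → ThetaGeodesic n) : Fin p ⊕ Fin p → V →L[ℝ] V :=
  Sum.elim (fun i => ρ.listProj (visibleEdge G i).opp) fun i => -ρ.listProj (ghostEdge G i).opp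

lemma sum_edges (G : Fin p → ThetaGeodesic n) (e : OnePoint ℝ × OnePoint ℝ → ℝ)
    (ℓ : (V →L[ℝ] V) →ₗ[ℝ] ℝ) : ∑ k, e (edgeEnds G k) * ℓ (edgeCoeff ρ G k) =
      edgeSum G fun θ => e θ.ends * ℓ (ρ.listProj θ.opp) := by
  simp only [Fintype.sum_sum_type, edgeEnds, edgeCoeff, Sum.elim_inl, Sum.elim_inr, map_neg,
    mul_neg, Finset.sum_neg_distrib, edgeSum, Finset.sum_sub_distrib]
  ring

variable {f : CutoffProfile} {x y : ℍ} {G : Fin p → ThetaGeodesic n} {H : Fin m → ThetaGeodesic n}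

lemma isEdgeSum_ghostDualForm (η : ArcForms f x G) :
    IsEdgeSum f (ρ.ghostDualForm η) (edgeEnds G) (edgeCoeff ρ G) := by
  refine ⟨Sum.elim (fun i => geodesicForm f (G i).geod) η.form, ?_, fun z => ?_⟩
  · rintro (i | i)
    · exact ⟨x, _, _, geodesicForm_hasGeodesicEnds f x (G i).geod, rfl⟩
    · exact ⟨x, _, _, (η.isArcForm i).hasGeodesicEnds, rfl⟩
  · rw [UniformlyHyperbolicBundle.ghostDualForm, Fintype.sum_sum_type, Finset.sum_sub_distrib,
      sub_eq_add_neg, ← Finset.sum_neg_distrib]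
    congr 1
    refine Finset.sum_congr rfl fun i _ => ?_
    ext1 v
    simp [edgeCoeff]

lemma isEdgeSum_projectorForm (f : CutoffProfile) (h : ThetaGeodesic n) :
    IsEdgeSum f (ρ.projectorForm f h) (fun _ : Unit => h.geod.1) fun _ => ρ.thetaProj h :=
  ⟨fun _ => geodesicForm f h.geod,
    fun _ => ⟨UpperHalfPlane.I, _, _, geodesicForm_hasGeodesicEnds f _ h.geod, rfl⟩,
    fun z => by simp [UniformlyHyperbolicBundle.projectorForm]⟩

lemma ghostIntersection_eq (η : ArcForms f x G) (κ : ArcForms f y H) :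
    ρ.ghostIntersection η κ = edgeSum G fun θ => edgeSum H fun σ =>
      eps σ.ends θ.ends * tr (ρ.listProj (σ.opp ++ θ.opp)) := by
  rw [UniformlyHyperbolicBundle.ghostIntersection,
    ((isEdgeSum_ghostDualForm ρ κ).integral_trWedge (isEdgeSum_ghostDualForm ρ η)).2]
  have h2 : ∀ k, ∑ l, eps (edgeEnds H k) (edgeEnds G l) *
      tr (edgeCoeff ρ H k * edgeCoeff ρ G l) = edgeSum G fun θ =>
        eps (edgeEnds H k) θ.ends * tr (edgeCoeff ρ H k * ρ.listProj θ.opp) := fun k =>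
    sum_edges ρ G (fun e => eps (edgeEnds H k) e) (trLin V ∘ₗ LinearMap.mulLeft ℝ (edgeCoeff ρ H k))
  simp only [h2]
  have h3 : ∀ θ : Edge n, ∑ k, eps (edgeEnds H k) θ.ends *
      tr (edgeCoeff ρ H k * ρ.listProj θ.opp) = edgeSum H fun σ =>
        eps σ.ends θ.ends * tr (ρ.listProj (σ.opp ++ θ.opp)) := fun θ => by
    simp only [listProj_append, tr_mul_comm (ρ.listProj θ.opp)]
    exact sum_edges ρ H (fun e => eps e θ.ends)
      (trLin V ∘ₗ LinearMap.mulRight ℝ (ρ.listProj θ.opp))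
  rw [← funext h3]
  simp only [edgeSum, Finset.sum_sub_distrib]
  rw [Finset.sum_comm, Finset.sum_comm (t := (Finset.univ : Finset (Fin p)))]

lemma ghostIntersectionGeodesic_eq (η : ArcForms f x G) (h : ThetaGeodesic n) :
    ρ.ghostIntersectionGeodesic η h =
      -edgeSum G fun θ => eps h.geod.1 θ.ends * tr (ρ.listProj (h :: θ.opp)) := by
  rw [UniformlyHyperbolicBundle.ghostIntersectionGeodesic,
    ((isEdgeSum_projectorForm ρ f h).integral_trWedge (isEdgeSum_ghostDualForm ρ η)).2]
  simp only [Finset.univ_unique, Finset.sum_singleton, listProj_cons,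
    tr_mul_comm _ (ρ.thetaProj h)]
  exact congrArg Neg.neg
    (sum_edges ρ G (fun e => eps h.geod.1 e) (trLin V ∘ₗ LinearMap.mulLeft ℝ (ρ.thetaProj h)))

/-- The tuple starting at `g_{i+1}` ends with `g_i`, the one starting at `g_i` begins with it, and
the other factors are those of `P_i` in both cases; products are taken from right to left. -/
lemma listProj_rot_succ (G : Fin p → ThetaGeodesic n) (i : Fin p) :
    ρ.listProj (rot G (i + 1)) = ρ.thetaProj (G i) * ρ.othersProj G i ∧
    ρ.listProj (rot G i) = ρ.othersProj G i * ρ.thetaProj (G i) := by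
  obtain ⟨q, rfl⟩ : ∃ q, p = q + 1 := ⟨p - 1, by have := NeZero.pos p; omega⟩
  have h : rot G (i + 1) = (List.ofFn fun k : Fin q => G (i + k.succ)) ++ [G i] := by
    rw [rot, List.ofFn_succ', List.concat_eq_append]
    congr 2
    · funext k
      rw [add_assoc, add_comm 1, Fin.coeSucc_eq_succ]
    · rw [add_assoc, add_comm 1, Fin.last_add_one, add_zero]
  have h' : rot G i = G i :: List.ofFn fun k : Fin q => G (i + k.succ) := by
    rw [rot, List.ofFn_succ, add_zero]
  have ho : ρ.othersProj G i = ρ.listProj (List.ofFn fun k : Fin q => G (i + k.succ)) := by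
    rw [UniformlyHyperbolicBundle.othersProj, h, List.dropLast_concat]
  rw [ho, h, h', listProj_append, listProj_singleton, listProj_cons]
  exact ⟨rfl, rfl⟩

lemma thetaProj_mul_self (g : ThetaGeodesic n) : ρ.thetaProj g * ρ.thetaProj g = ρ.thetaProj g := by
  refine ContinuousLinearMap.ext fun v => ?_
  simp only [UniformlyHyperbolicBundle.thetaProj, UniformlyHyperbolicBundle.proj,
    mul_apply_eq_comp, LinearMap.coe_toContinuousLinearMap']
  exact LinearMap.congr_fun (Submodule.isIdempotentElem_projection _).eq v

/-- After line integration the value at `g_i⁺` multiplies `p(ζ_i*)` and the value at `g_i⁻`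
multiplies `p(ζ_{i-1}*)`. The remaining terms are the variations along the visible edges. -/
lemma ghostIntegral_eq {ι : Type*} [Fintype ι] {α : EndForm V} {e : ι → OnePoint ℝ × OnePoint ℝ}
    {A : ι → V →L[ℝ] V} (hα : IsEdgeSum f α e A) {B : ℂ → V →L[ℝ] V} (hB : IsPrimitive B α)
    (t : Fin p → ℝ) : ρ.ghostIntegral G α B t =
      -edgeSum G fun θ => ∑ k, eps θ.ends (e k) * tr (A k * ρ.listProj θ.opp) := by
  obtain ⟨c, hc, hcc⟩ := hα.exists_boundaryLimits hB
  have h1 : ∀ θ : Edge n, ∑ k, eps θ.ends (e k) * tr (A k * ρ.listProj θ.opp) =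
      tr ((c θ.ends.2 - c θ.ends.1) * ρ.listProj θ.opp) := fun θ => by
    rw [hcc, Finset.sum_mul, tr_sum]
    simp [tr_smul]
  simp only [h1]
  rw [UniformlyHyperbolicBundle.ghostIntegral]
  have h3 : ∀ i, tr (B ((G i).geod.point (t i)) * ⁅ρ.thetaProj (G i), ρ.othersProj G i⁆) +
      lineIntegration (G i).geod (t i) (ρ.thetaProj (G i)) (ρ.othersProj G i) α =
      tr (c (G i).geod.1.2 * ρ.listProj (rot G (i + 1))) -
        tr (c (G i).geod.1.1 * ρ.listProj (rot G i)) -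
        tr ((c (G i).geod.1.2 - c (G i).geod.1.1) * ρ.listProj (visibleEdge G i).opp) := fun i => by
    rw [hα.lineIntegration_eq hB hc _ _ _ _ (thetaProj_mul_self ρ _), visibleEdge, listProj_append,
      listProj_singleton, (listProj_rot_succ ρ G i).1, (listProj_rot_succ ρ G i).2, mul_assoc]
  -- Shifting the index pairs the values at `g_{i+1}⁻` and `g_i⁺`, the two ends of `ζ_i`.
  have h2 : ∑ i, tr (c (G i).geod.1.1 * (ρ.listProj (rot G i))) =
      ∑ i, tr (c (G (i + 1)).geod.1.1 * ρ.listProj (rot G (i + 1))) :=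
    (Equiv.sum_comp (Equiv.addRight (1 : Fin p))
      fun i => tr (c (G i).geod.1.1 * ρ.listProj (rot G i))).symm
  simp only [h3, edgeSum, ghostEdge, sub_mul, tr_sub, Finset.sum_sub_distrib, h2, visibleEdge]
  ring

end Intersections

/-! ### Asymptotic geodesics and the projective case -/

/-- In the chart of `δ` the geodesic `γ` is a vertical line at abscissa `b / d`, parametrised by the
height `(a / d) e^s`. After the time shift `log (a / d)` both points are at the same height, and the
hyperbolic cosine of their distance is `1` plus a multiple of `e^{-2s}`. -/
lemma exists_dist_point_le (γ δ : Geodesic) (h : γ.1.2 = δ.1.2) :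
    ∃ τ, ∀ᶠ s in atTop, dist (γ.point s) (δ.point (s + τ)) ≤ 1 := by
  have hc := (δ.rel_spec γ).2.1.2 h.symm
  set M := δ.rel γ with hM
  have hd := M.det_pos
  rw [hc, mul_zero, sub_zero] at hd
  have hd0 : M.d ≠ 0 := right_ne_zero_of_mul hd.ne'
  have ha0 : M.a ≠ 0 := left_ne_zero_of_mul hd.ne'
  have hr : 0 < M.a / M.d := by
    have : M.a / M.d = M.a * M.d / M.d ^ 2 := by field_simp
    rw [this]
    positivity
  have key : ∀ s, Real.cosh (dist (γ.point s) (δ.point (s + Real.log (M.a / M.d)))) =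
      1 + (M.b / M.a) ^ 2 / 2 * Real.exp (-s) ^ 2 := by
    intro s
    have e1 : δ.chart.inv.act (γ.point s) = M.act (stripH ⟨0, s⟩) := by
      apply UpperHalfPlane.ext
      rw [γ.point_eq_fermiH]
      exact (Moebius.mul_app _ _ (strip_im_pos _)).symm
    have e2 : δ.chart.inv.act (δ.point (s + Real.log (M.a / M.d))) =
        stripH ⟨0, s + Real.log (M.a / M.d)⟩ := by
      rw [δ.point_eq_fermiH, Geodesic.fermiH, Moebius.inv_act]
    have e3 : (M.act (stripH ⟨0, s⟩) : ℂ) = ⟨M.b / M.d, M.a / M.d * Real.exp s⟩ := by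
      change M.app (strip _) = _
      have hd1 : (M.d : ℂ) ≠ 0 := by exact_mod_cast hd0
      rw [Moebius.app, hc, Complex.ofReal_zero, zero_mul, zero_add, div_eq_iff hd1]
      apply Complex.ext
      · simp only [Complex.add_re, Complex.mul_re, Complex.ofReal_re, Complex.ofReal_im, strip_re,
          strip_im]
        field_simp
        ring
      · simp only [Complex.add_im, Complex.mul_im, Complex.ofReal_re, Complex.ofReal_im, strip_re,
          strip_im]
        field_simp
        ring
    have e4 : (stripH ⟨0, s + Real.log (M.a / M.d)⟩ : ℂ) = ⟨0, M.a / M.d * Real.exp s⟩ := by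
      change strip _ = _
      apply Complex.ext
      · simp
      · rw [strip_im, Real.exp_add, Real.exp_log hr, mul_comm]
    rw [← Moebius.dist_act δ.chart.inv, e1, e2, UpperHalfPlane.cosh_dist, Complex.dist_eq,
      Complex.sq_norm, ← UpperHalfPlane.coe_im, ← UpperHalfPlane.coe_im, e3, e4,
      Complex.normSq_apply, Real.exp_neg]
    simp only [Complex.sub_re, Complex.sub_im]
    have := Real.exp_pos s
    field_simp
    ring
  refine ⟨Real.log (M.a / M.d), ?_⟩
  have h1 : Tendsto (fun s => 1 + (M.b / M.a) ^ 2 / 2 * Real.exp (-s) ^ 2) atTop (𝓝 1) := by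
    have := ((Real.tendsto_exp_neg_atTop_nhds_zero.pow 2).const_mul
      ((M.b / M.a) ^ 2 / 2)).const_add 1
    simpa using this
  have h2 : (1 : ℝ) < Real.cosh 1 := Real.one_lt_cosh.2 one_ne_zero
  filter_upwards [h1.eventually_lt_const h2] with s hs
  rw [← key, Real.cosh_lt_cosh, abs_of_nonneg dist_nonneg, abs_of_pos one_pos] at hs
  exact hs.le

/-! ### Dominated subspaces and asymptotic geodesics -/

section Domination

variable {V : Type*} [NormedAddCommGroup V] [NormedSpace ℝ V]

/-- The subspace `A` is dominated by the complementary subspace `Q` for the family of norms `N`,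
and the angle between them is bounded below. -/
structure IsDominated (N : ℝ → V → ℝ) (A Q : Submodule ℝ V) : Prop where
  isCompl : IsCompl A Q
  pos : ∀ s v, v ≠ 0 → 0 < N s v
  dominated : ∀ u ∈ A, ∀ v ∈ Q, v ≠ 0 → ∀ δ > 0, ∀ᶠ s in atTop, N s u ≤ δ * N s v
  angle : ∃ c > 0, ∀ s, ∀ u ∈ A, ∀ v ∈ Q, c * N s v ≤ N s (u + v)

/-- Suppose that `u ∈ A` has a nonzero component `v` in `Q'`, and `w ∈ A'` a nonzero component `q`
in `Q`. Then `N u ≪ N q ≲ N w ≲ N' w ≪ N' v ≲ N' u ≲ N u`, by domination, angles and comparability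
in turn, which is absurd. -/
lemma IsDominated.le_or_le {N N' : ℝ → V → ℝ} {A Q A' Q' : Submodule ℝ V} (h : IsDominated N A Q)
    (h' : IsDominated N' A' Q') {C : ℝ} (hC : ∀ᶠ s in atTop, ∀ v, N s v ≤ C * N' s v)
    (hC' : ∀ᶠ s in atTop, ∀ v, N' s v ≤ C * N s v) : A ≤ A' ∨ A' ≤ A := by
  by_contra! hcon
  obtain ⟨u, hu, hu'⟩ := SetLike.not_le_iff_exists.1 hcon.1
  obtain ⟨w, hw', hw⟩ := SetLike.not_le_iff_exists.1 hcon.2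
  obtain ⟨u₁, hu₁, v, hv, rfl⟩ : ∃ y ∈ A', ∃ z ∈ Q', y + z = u :=
    Submodule.mem_sup.1 (h'.isCompl.sup_eq_top ▸ Submodule.mem_top)
  obtain ⟨w₁, hw₁, q, hq, rfl⟩ : ∃ y ∈ A, ∃ z ∈ Q, y + z = w :=
    Submodule.mem_sup.1 (h.isCompl.sup_eq_top ▸ Submodule.mem_top)
  have hv0 : v ≠ 0 := fun k => hu' (by rw [k, add_zero]; exact hu₁)
  have hq0 : q ≠ 0 := fun k => hw (by rw [k, add_zero]; exact hw₁)
  have hu0 : u₁ + v ≠ 0 := fun k => hu' (k ▸ A'.zero_mem)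
  obtain ⟨c, hc, hcN⟩ := h.angle
  obtain ⟨c', hc', hcN'⟩ := h'.angle
  -- The ratios absorb the angle and comparison constants, and the extra factor `1/2` in the second
  -- one yields `D N u ≤ D N u / 2` with `D = |C| + 1`.
  have hd := h.dominated _ hu q hq hq0 (c / (|C| + 1)) (by positivity)
  have hd' := h'.dominated _ hw' v hv hv0 (c' / (|C| + 1) / 2) (by positivity)
  obtain ⟨s, h1, h2, h3, h4⟩ := (hC.and (hC'.and (hd.and hd'))).exists
  have h5 := hcN s w₁ hw₁ q hq
  have h6 := hcN' s u₁ hu₁ v hv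
  have h7 := h1 (w₁ + q)
  have h8 := h2 (u₁ + v)
  have hN := h.pos s _ hu0
  have hD : 0 < |C| + 1 := by positivity
  have hNw : 0 ≤ N' s (w₁ + q) := by
    by_cases k : w₁ + q = 0
    · exact absurd (k ▸ A.zero_mem) hw
    · exact (h'.pos s _ k).le
  have k1 : N s (w₁ + q) ≤ (|C| + 1) * N' s (w₁ + q) :=
    h7.trans (mul_le_mul_of_nonneg_right (by linarith [le_abs_self C]) hNw)
  have k2 : N' s (u₁ + v) ≤ (|C| + 1) * N s (u₁ + v) :=
    h8.trans (mul_le_mul_of_nonneg_right (by linarith [le_abs_self C]) hN.le)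
  have k3 : (|C| + 1) * N s (u₁ + v) ≤ c * N s q := by
    have := mul_le_mul_of_nonneg_left h3 hD.le
    calc _ ≤ _ := this
      _ = c * N s q := by field_simp
  have k4 : (|C| + 1) * N' s (w₁ + q) ≤ c' * N' s v / 2 := by
    have := mul_le_mul_of_nonneg_left h4 hD.le
    calc _ ≤ _ := this
      _ = c' * N' s v / 2 := by field_simp
  have k5 := mul_pos hD hN
  linarith

variable {h : UnitTangent → Basis (Fin (finrank ℝ V)) ℝ V}

lemma frameInner_self_nonneg (x : UnitTangent) (v : V) : 0 ≤ frameInner h x v v :=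
  Finset.sum_nonneg fun _ _ => mul_self_nonneg _

lemma frameNorm_pos (x : UnitTangent) {v : V} (hv : v ≠ 0) : 0 < frameNorm h x v := by
  refine Real.sqrt_pos.2 (lt_of_le_of_ne (frameInner_self_nonneg x v) fun k => hv ?_)
  apply (h x).repr.map_eq_zero_iff.1
  ext i
  exact mul_self_eq_zero.1 ((Finset.sum_eq_zero_iff_of_nonneg fun _ _ => mul_self_nonneg _).1
    k.symm i (Finset.mem_univ i))

lemma frameNorm_sq (x : UnitTangent) (v : V) : frameNorm h x v ^ 2 = frameInner h x v v :=
  Real.sq_sqrt (frameInner_self_nonneg x v)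

lemma frameNorm_nonneg (x : UnitTangent) (v : V) : 0 ≤ frameNorm h x v := Real.sqrt_nonneg _

lemma frameInner_add_self (x : UnitTangent) (u v : V) : frameInner h x (u + v) (u + v) =
    frameInner h x u u + 2 * frameInner h x u v + frameInner h x v v := by
  simp only [frameInner, map_add, Finsupp.add_apply, Finset.mul_sum, ← Finset.sum_add_distrib]
  exact Finset.sum_congr rfl fun i _ => by ring

lemma flow_unitVector (s t : ℝ) (g : Geodesic) : flow s (unitVector g t) = unitVector g (t + s) := by
  simp [flow, unitVector]

variable {L P : UnitTangent → Submodule ℝ V} {k : ℕ}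

namespace IsUniformlyHyperbolic

lemma L_unitVector (hρ : IsUniformlyHyperbolic h L P k) (g : Geodesic) (s : ℝ) :
    L (unitVector g s) = L (unitVector g 0) := by
  rw [← hρ.invariant_L s (unitVector g 0), flow_unitVector, zero_add]

lemma P_unitVector (hρ : IsUniformlyHyperbolic h L P k) (g : Geodesic) (s : ℝ) :
    P (unitVector g s) = P (unitVector g 0) := by
  rw [← hρ.invariant_P s (unitVector g 0), flow_unitVector, zero_add]

/-- Transversality along constant sequences bounds the scalar product by `(1 - ε) ‖u‖ ‖v‖`, whence
`‖u + v‖² ≥ ε (‖u‖² + ‖v‖²)`. Replacing `ε` by `min ε 1` keeps the factor `1 - ε` nonnegative. -/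
lemma exists_angle (hρ : IsUniformlyHyperbolic h L P k) : ∃ c > 0, ∀ x, ∀ u ∈ L x, ∀ v ∈ P x,
    c * frameNorm h x v ≤ frameNorm h x (u + v) ∧ c * frameNorm h x u ≤ frameNorm h x (u + v) := by
  obtain ⟨ε, hε, ht⟩ := hρ.transverse
  refine ⟨√(min ε 1), Real.sqrt_pos.2 (lt_min hε one_pos), fun x u hu v hv => ?_⟩
  have h1 := ht x (fun _ => x) (fun _ => x) (fun _ => u) (fun _ => v) u v tendsto_const_nhds
    tendsto_const_nhds tendsto_const_nhds tendsto_const_nhds (fun _ => hu) (fun _ => hv)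
  set a := frameNorm h x u
  set b := frameNorm h x v
  have ha : 0 ≤ a := frameNorm_nonneg x u
  have hb : 0 ≤ b := frameNorm_nonneg x v
  have h2 : |frameInner h x u v| ≤ (1 - min ε 1) * (a * b) :=
    h1.trans (mul_le_mul_of_nonneg_right (by linarith [min_le_left ε 1]) (mul_nonneg ha hb))
  have h3 := frameInner_add_self (h := h) x u v
  rw [← frameNorm_sq, ← frameNorm_sq, ← frameNorm_sq] at h3
  have h4 := neg_abs_le (frameInner h x u v)
  have h5 : 0 ≤ 1 - min ε 1 := by linarith [min_le_right ε 1]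
  have h6 : (1 - min ε 1) * (2 * (a * b)) ≤ (1 - min ε 1) * (a ^ 2 + b ^ 2) :=
    mul_le_mul_of_nonneg_left (by nlinarith [sq_nonneg (a - b)]) h5
  have h0 : 0 ≤ min ε 1 := (lt_min hε one_pos).le
  have h7 : min ε 1 * (a ^ 2 + b ^ 2) ≤ frameNorm h x (u + v) ^ 2 := by
    change _ = a ^ 2 + _ + b ^ 2 at h3
    linarith
  constructor <;> refine abs_le_of_sq_le_sq' ?_ (frameNorm_nonneg x _) |>.2
  · rw [mul_pow, Real.sq_sqrt h0]
    linarith [mul_nonneg h0 (sq_nonneg a)]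
  · rw [mul_pow, Real.sq_sqrt h0]
    linarith [mul_nonneg h0 (sq_nonneg b)]

lemma tendsto_decay {B b c : ℝ} (hb : 0 < b) :
    Tendsto (fun s => B * Real.exp (-b * s) * c) atTop (𝓝 0) := by
  have h1 : Tendsto (fun s => Real.exp (-(b * s))) atTop (𝓝 0) :=
    Real.tendsto_exp_neg_atTop_nhds_zero.comp (tendsto_id.const_mul_atTop hb)
  simpa [neg_mul] using (h1.const_mul B).mul_const c

lemma isDominated_forward (hρ : IsUniformlyHyperbolic h L P k) (g : Geodesic) (τ : ℝ) :
    IsDominated (fun s => frameNorm h (unitVector g (s + τ))) (L (unitVector g 0))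
      (P (unitVector g 0)) := by
  refine ⟨hρ.isCompl _, fun s v hv => frameNorm_pos _ hv, fun u hu v hv hv0 δ hδ => ?_, ?_⟩
  · by_cases hu0 : u = 0
    · refine Eventually.of_forall fun s => ?_
      subst hu0
      simpa [frameNorm, frameInner] using mul_nonneg hδ.le (frameNorm_nonneg _ v)
    obtain ⟨B, hB, b, hb, H⟩ := hρ.contracting
    set x := unitVector g τ with hx
    have hxu := frameNorm_pos (h := h) x hu0
    have hxv := frameNorm_pos (h := h) x hv0
    filter_upwards [(tendsto_decay (B := B) (c := frameNorm h x u / frameNorm h x v)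
      hb).eventually_lt_const hδ, eventually_gt_atTop 0] with s hs hs0
    have h1 := H s hs0 x u (by rwa [hρ.L_unitVector]) v (by rwa [hρ.P_unitVector]) hu0 hv0
    rw [hx, flow_unitVector, add_comm τ, ← hx, div_le_iff₀ hxu] at h1
    refine h1.trans ?_
    have h2 := frameNorm_nonneg (h := h) (unitVector g (s + τ)) v
    calc _ = B * Real.exp (-b * s) * (frameNorm h x u / frameNorm h x v) *
          frameNorm h (unitVector g (s + τ)) v := by field_simp
      _ ≤ _ := mul_le_mul_of_nonneg_right hs.le h2
  · obtain ⟨c, hc, H⟩ := hρ.exists_angle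
    exact ⟨c, hc, fun s u hu v hv =>
      (H _ u (by rwa [hρ.L_unitVector]) v (by rwa [hρ.P_unitVector])).1⟩

/-- The same contraction, read from time `-(s + τ)` to time `-τ`: in the past the roles of `L` and
`P` are exchanged. -/
lemma isDominated_backward (hρ : IsUniformlyHyperbolic h L P k) (g : Geodesic) (τ : ℝ) :
    IsDominated (fun s => frameNorm h (unitVector g (-(s + τ)))) (P (unitVector g 0))
      (L (unitVector g 0)) := by
  refine ⟨(hρ.isCompl _).symm, fun s v hv => frameNorm_pos _ hv, fun v hv u hu hu0 δ hδ => ?_, ?_⟩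
  · by_cases hv0 : v = 0
    · refine Eventually.of_forall fun s => ?_
      subst hv0
      simpa [frameNorm, frameInner] using mul_nonneg hδ.le (frameNorm_nonneg _ u)
    obtain ⟨B, hB, b, hb, H⟩ := hρ.contracting
    set x := unitVector g (-τ) with hx
    have hxu := frameNorm_pos (h := h) x hu0
    have hxv := frameNorm_pos (h := h) x hv0
    filter_upwards [(tendsto_decay (B := B) (c := frameNorm h x v / frameNorm h x u)
      hb).eventually_lt_const hδ, eventually_gt_atTop 0] with s hs hs0
    have h1 := H s hs0 (unitVector g (-(s + τ))) u (by rwa [hρ.L_unitVector]) v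
      (by rwa [hρ.P_unitVector]) hu0 hv0
    rw [flow_unitVector, show -(s + τ) + s = -τ by ring, ← hx] at h1
    have hyu := frameNorm_pos (h := h) (unitVector g (-(s + τ))) hu0
    have hyv := frameNorm_pos (h := h) (unitVector g (-(s + τ))) hv0
    rw [← mul_div_assoc, div_le_div_iff₀ hyu hyv] at h1
    calc frameNorm h (unitVector g (-(s + τ))) v
        = (frameNorm h x u * frameNorm h (unitVector g (-(s + τ))) v) / frameNorm h x u := by
          field_simp
      _ ≤ (B * Real.exp (-b * s) * frameNorm h x v * frameNorm h (unitVector g (-(s + τ))) u) /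
          frameNorm h x u := div_le_div_of_nonneg_right h1 hxu.le
      _ = B * Real.exp (-b * s) * (frameNorm h x v / frameNorm h x u) *
          frameNorm h (unitVector g (-(s + τ))) u := by field_simp
      _ ≤ _ := mul_le_mul_of_nonneg_right hs.le hyu.le
  · obtain ⟨c, hc, H⟩ := hρ.exists_angle
    exact ⟨c, hc, fun s v hv u hu => by
      rw [add_comm v u]
      exact (H _ u (by rwa [hρ.L_unitVector]) v (by rwa [hρ.P_unitVector])).2⟩

variable [FiniteDimensional ℝ V]

/-- Asymptotic geodesics, suitably parametrised, stay within distance `1`, so the norms along them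
are comparable. The two dominated subspaces are then nested, and they have the same dimension. -/
lemma L_eq_of_asymptotic (hρ : IsUniformlyHyperbolic h L P k) {C : ℝ}
    (hC : ∀ x y : UnitTangent, dist x.1.2 y.1.2 ≤ 1 → ∀ v : V,
      frameNorm h x v ≤ C * frameNorm h y v) {γ δ : Geodesic} (e : γ.1.2 = δ.1.2) :
    L (unitVector γ 0) = L (unitVector δ 0) := by
  obtain ⟨τ, hτ⟩ := exists_dist_point_le γ δ e
  have h1 := hρ.isDominated_forward γ 0
  have h2 := hρ.isDominated_forward δ τ
  simp only [add_zero] at h1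
  obtain h3 | h3 := h1.le_or_le h2 (hτ.mono fun s hs => hC (unitVector γ s) (unitVector δ (s + τ)) hs)
    (hτ.mono fun s hs => hC (unitVector δ (s + τ)) (unitVector γ s) (by rw [dist_comm]; exact hs))
  · exact Submodule.eq_of_le_of_finrank_eq h3 (by rw [hρ.finrank_eq, hρ.finrank_eq])
  · exact (Submodule.eq_of_le_of_finrank_eq h3 (by rw [hρ.finrank_eq, hρ.finrank_eq])).symm

lemma P_eq_of_asymptotic (hρ : IsUniformlyHyperbolic h L P k) {C : ℝ}
    (hC : ∀ x y : UnitTangent, dist x.1.2 y.1.2 ≤ 1 → ∀ v : V,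
      frameNorm h x v ≤ C * frameNorm h y v) {γ δ : Geodesic} (e : γ.1.1 = δ.1.1) :
    P (unitVector γ 0) = P (unitVector δ 0) := by
  obtain ⟨τ, hτ⟩ := exists_dist_point_le γ.rev δ.rev e
  simp only [Geodesic.point_rev] at hτ
  have h1 := hρ.isDominated_backward γ 0
  have h2 := hρ.isDominated_backward δ τ
  simp only [add_zero] at h1
  have hr : finrank ℝ (P (unitVector γ 0)) = finrank ℝ (P (unitVector δ 0)) := by
    have k1 := Submodule.finrank_add_eq_of_isCompl (hρ.isCompl (unitVector γ 0))
    have k2 := Submodule.finrank_add_eq_of_isCompl (hρ.isCompl (unitVector δ 0))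
    rw [hρ.finrank_eq] at k1 k2
    omega
  obtain h3 | h3 := h1.le_or_le h2
    (hτ.mono fun s hs => hC (unitVector γ (-s)) (unitVector δ (-(s + τ))) hs)
    (hτ.mono fun s hs => hC (unitVector δ (-(s + τ))) (unitVector γ (-s))
      (by rw [dist_comm]; exact hs))
  · exact Submodule.eq_of_le_of_finrank_eq h3 hr
  · exact (Submodule.eq_of_le_of_finrank_eq h3 hr.symm).symm

end IsUniformlyHyperbolic

end Domination

/-! ### Rank one projectors and the projective case -/

section Projective

variable {V : Type*} [NormedAddCommGroup V] [NormedSpace ℝ V]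

/-- An endomorphism which factors on both sides through a rank one projector is a multiple of it. -/
lemma eq_tr_smul_of_rank_one [FiniteDimensional ℝ V] {A p : V →L[ℝ] V} (hp : p * p = p)
    (hr : finrank ℝ (LinearMap.range (p : V →ₗ[ℝ] V)) = 1)
    (h1 : p * A = A) (h2 : A * p = A) : A = tr A • p := by
  obtain ⟨⟨v, hv⟩, hv0, hspan⟩ := finrank_eq_one_iff'.1 hr
  have hv1 : v ≠ 0 := fun k => hv0 (by simpa using k)
  have hmul : ∀ w ∈ LinearMap.range (p : V →ₗ[ℝ] V), ∃ c : ℝ, c • v = w := fun w hw => by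
    obtain ⟨c, hc⟩ := hspan ⟨w, hw⟩
    exact ⟨c, congrArg Subtype.val hc⟩
  obtain ⟨c, hc⟩ := hmul (A v) ⟨A v, by
    change (p * A) v = A v
    rw [h1]⟩
  have hA : A = c • p := by
    refine ContinuousLinearMap.ext fun x => ?_
    obtain ⟨d, hd⟩ := hmul (p x) ⟨x, rfl⟩
    have h3 : A x = A (p x) := by
      conv_lhs => rw [← h2]
      rfl
    rw [h3, ← hd, map_smul, ← hc, smul_apply, ← hd, smul_comm]
  have hproj : LinearMap.IsProj (LinearMap.range (p : V →ₗ[ℝ] V)) (p : V →ₗ[ℝ] V) :=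
    ⟨fun x => ⟨x, rfl⟩, by
      rintro _ ⟨x, rfl⟩
      exact congrArg (fun q : V →L[ℝ] V => q x) hp⟩
  have htr : tr p = 1 := by
    rw [tr, hproj.trace, hr, Nat.cast_one]
  rw [hA, tr_smul, htr, mul_one]

variable [FiniteDimensional ℝ V] {n : ℕ} {K : Fin n → ℕ} (ρ : UniformlyHyperbolicBundle V K)
  {p m : ℕ} [NeZero p] [NeZero m]

lemma subsingleton_labels {K : Fin n → ℕ} (hm : StrictMono K) (hK : ∀ a, K a = 1) :
    Subsingleton (Fin n) :=
  ⟨fun a b => hm.injective (by rw [hK, hK])⟩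

variable {a : Fin n}

lemma range_proj (g : Geodesic) : LinearMap.range (ρ.proj a g : V →ₗ[ℝ] V) =
    ⨆ b, ⨆ _ : b ≤ a.castSucc, ρ.E b (unitVector g 0) :=
  Submodule.range_projection ((ρ.hyperbolic a).isCompl (unitVector g 0))

lemma ker_proj (g : Geodesic) : LinearMap.ker (ρ.proj a g : V →ₗ[ℝ] V) =
    ⨆ b, ⨆ _ : a.castSucc < b, ρ.E b (unitVector g 0) :=
  Submodule.ker_projection ((ρ.hyperbolic a).isCompl (unitVector g 0))

lemma proj_mul_self (g : Geodesic) : ρ.proj a g * ρ.proj a g = ρ.proj a g :=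
  thetaProj_mul_self ρ ⟨g, a⟩

/-- The two projectors have the same range, as `L` depends only on the positive end. -/
lemma proj_mul_proj_of_snd_eq (hC : ρ.HasComparableMetrics) {g g' : Geodesic}
    (e : g.1.2 = g'.1.2) : ρ.proj a g * ρ.proj a g' = ρ.proj a g' := by
  obtain ⟨C, hC⟩ := hC
  have h := (ρ.hyperbolic a).L_eq_of_asymptotic hC e
  refine ContinuousLinearMap.ext fun x => ?_
  have h1 : ρ.proj a g' x ∈ LinearMap.range (ρ.proj a g : V →ₗ[ℝ] V) := by
    rw [range_proj]
    refine h.ge ?_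
    rw [← range_proj]
    exact ⟨x, rfl⟩
  obtain ⟨y, hy⟩ := h1
  change ρ.proj a g (ρ.proj a g' x) = ρ.proj a g' x
  rw [← hy]
  exact congrArg (fun q : V →L[ℝ] V => q y) (proj_mul_self ρ g)

/-- The two projectors have the same kernel, as `P` depends only on the negative end. -/
lemma proj_mul_proj_of_fst_eq (hC : ρ.HasComparableMetrics) {g g' : Geodesic}
    (e : g.1.1 = g'.1.1) : ρ.proj a g * ρ.proj a g' = ρ.proj a g := by
  obtain ⟨C, hC⟩ := hC
  have h := (ρ.hyperbolic a).P_eq_of_asymptotic hC e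
  refine ContinuousLinearMap.ext fun x => ?_
  have h1 : x - ρ.proj a g' x ∈ LinearMap.ker (ρ.proj a g : V →ₗ[ℝ] V) := by
    rw [ker_proj]
    refine h.ge ?_
    rw [← ker_proj, LinearMap.mem_ker]
    change ρ.proj a g' (x - ρ.proj a g' x) = 0
    rw [map_sub, sub_eq_zero]
    exact (congrArg (fun q : V →L[ℝ] V => q x) (proj_mul_self ρ g')).symm
  rw [LinearMap.mem_ker] at h1
  change ρ.proj a g (x - ρ.proj a g' x) = 0 at h1
  rw [map_sub, sub_eq_zero] at h1
  exact h1.symm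

lemma finrank_range_proj (hK : ∀ a, K a = 1) (g : Geodesic) :
    finrank ℝ (LinearMap.range (ρ.proj a g : V →ₗ[ℝ] V)) = 1 := by
  rw [range_proj]
  exact ((ρ.hyperbolic a).finrank_eq (unitVector g 0)).trans (hK a)

lemma tr_listProj_rot {p : ℕ} (G : Fin p → ThetaGeodesic n) (i : Fin p) :
    tr (ρ.listProj (rot G i)) = ρ.correlation (List.ofFn G : Cycle (ThetaGeodesic n)) := by
  rw [correlation_coe, rot, ← rotate_ofFn, ρ.tr_listProj_rotate]

lemma thetaProj_eq (hK : ∀ a, K a = 1) (g : ThetaGeodesic n) :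
    ρ.thetaProj g = ρ.proj a g.geod := by
  have := subsingleton_labels ρ.strictMono hK
  rw [UniformlyHyperbolicBundle.thetaProj, Subsingleton.elim g.label a]

lemma edgeProj_geodesic (g : Geodesic) : ρ.edgeProj a g.1 = ρ.proj a g := dif_pos g.2

/-- The product along `g_i*` begins and ends with `p(g_i)`, so it is a multiple of this rank one
projector. One of the two factors is redundant in the trace, which leaves the correlation function
of `G`. -/
lemma listProj_visibleEdge (hK : ∀ a, K a = 1) (G : Fin p → ThetaGeodesic n) (i : Fin p) :
    ρ.listProj (visibleEdge G i).opp = ρ.correlation (List.ofFn G : Cycle (ThetaGeodesic n)) •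
      ρ.edgeProj a (visibleEdge G i).ends := by
  have e1 : ρ.listProj (visibleEdge G i).opp = ρ.thetaProj (G i) * ρ.listProj (rot G i) := by
    rw [visibleEdge, listProj_append, listProj_singleton]
  have e2 : ρ.edgeProj a (visibleEdge G i).ends = ρ.thetaProj (G i) := by
    rw [thetaProj_eq ρ hK, visibleEdge, edgeProj_geodesic]
  have e3 := thetaProj_mul_self ρ (G i)
  have e4 : ρ.listProj (rot G i) * ρ.thetaProj (G i) = ρ.listProj (rot G i) := by
    rw [(listProj_rot_succ ρ G i).2, mul_assoc, e3]
  rw [e2, ← tr_listProj_rot ρ G i]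
  have e5 : tr (ρ.listProj (rot G i)) = tr (ρ.listProj (visibleEdge G i).opp) := by
    rw [e1, tr_mul_comm, e4]
  rw [e5]
  refine eq_tr_smul_of_rank_one e3 ?_ ?_ ?_
  · rw [thetaProj_eq ρ (a := a) hK]
    exact finrank_range_proj ρ hK _
  · rw [e1, ← mul_assoc, e3]
  · rw [e1, mul_assoc, e4]

/-- The product along `ζ_i*` has `p(g_i)` on the left and `p(g_{i+1})` on the right. The first
shares its range with `p(ζ_i)` and the second its kernel, so the product factors on both sides
through `p(ζ_i)`. -/
lemma listProj_ghostEdge (hK : ∀ a, K a = 1) (hC : ρ.HasComparableMetrics)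
    (G : Fin p → ThetaGeodesic n) (i : Fin p)
    (hne : (ghostEdge G i).ends.1 ≠ (ghostEdge G i).ends.2) :
    ρ.listProj (ghostEdge G i).opp = ρ.correlation (List.ofFn G : Cycle (ThetaGeodesic n)) •
      ρ.edgeProj a (ghostEdge G i).ends := by
  rw [UniformlyHyperbolicBundle.edgeProj, dif_pos hne, ← tr_listProj_rot ρ G (i + 1)]
  set ζ : Geodesic := ⟨(ghostEdge G i).ends, hne⟩
  change ρ.listProj (rot G (i + 1)) = _
  refine eq_tr_smul_of_rank_one (proj_mul_self ρ ζ) (finrank_range_proj ρ hK ζ) ?_ ?_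
  · rw [(listProj_rot_succ ρ G i).1, ← mul_assoc, thetaProj_eq ρ (a := a) hK,
      proj_mul_proj_of_snd_eq ρ hC (g := ζ) (g' := (G i).geod) rfl]
  · rw [(listProj_rot_succ ρ G (i + 1)).2, mul_assoc, thetaProj_eq ρ (a := a) hK,
      proj_mul_proj_of_fst_eq ρ hC (g := (G (i + 1)).geod) (g' := ζ) rfl]

/-- In the projective case the coefficients of the ghost dual form are multiples of the projectors
of the edges. -/
lemma edgeSum_projective (hK : ∀ a, K a = 1) (hC : ρ.HasComparableMetrics)
    (G : Fin p → ThetaGeodesic n) (c : OnePoint ℝ × OnePoint ℝ → ℝ) (hc : ∀ x, c (x, x) = 0)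
    (ℓ : (V →L[ℝ] V) →ₗ[ℝ] ℝ) : edgeSum G (fun θ => c θ.ends * ℓ (ρ.listProj θ.opp)) =
      ρ.correlation (List.ofFn G : Cycle (ThetaGeodesic n)) *
        edgeSum G fun θ => c θ.ends * ℓ (ρ.edgeProj a θ.ends) := by
  rw [edgeSum, edgeSum, Finset.mul_sum]
  refine Finset.sum_congr rfl fun i _ => ?_
  have h1 : c (ghostEdge G i).ends * ℓ (ρ.listProj (ghostEdge G i).opp) =
      ρ.correlation (List.ofFn G : Cycle (ThetaGeodesic n)) *
        (c (ghostEdge G i).ends * ℓ (ρ.edgeProj a (ghostEdge G i).ends)) := by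
    -- No proportionality is available for a phantom edge, but its weight vanishes.
    by_cases hne : (ghostEdge G i).ends.1 = (ghostEdge G i).ends.2
    · have h2 : c (ghostEdge G i).ends = 0 := by
        rw [← Prod.mk.eta (p := (ghostEdge G i).ends), hne, hc]
      rw [h2]
      ring
    · rw [listProj_ghostEdge ρ (a := a) hK hC G i hne, map_smul, smul_eq_mul]
      ring
  rw [h1, listProj_visibleEdge ρ (a := a) hK, map_smul, smul_eq_mul]
  ring

lemma sum_Icc_sum_Icc_ghostPolygon (G : Fin p → ThetaGeodesic n) (H : Fin m → ThetaGeodesic n)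
    (F : Edge n → Edge n → ℝ) : ∑ i ∈ Finset.Icc 1 (2 * p), ∑ j ∈ Finset.Icc 1 (2 * m),
      (-1 : ℝ) ^ (i + j) * F (ghostPolygon H j) (ghostPolygon G i) =
      edgeSum G fun θ => edgeSum H fun σ => F σ θ := by
  rw [← sum_Icc_ghostPolygon]
  refine Finset.sum_congr rfl fun i _ => ?_
  rw [← sum_Icc_ghostPolygon, Finset.mul_sum]
  exact Finset.sum_congr rfl fun j _ => by rw [pow_add, mul_assoc]

lemma sum_Icc_succ_ghostPolygon (G : Fin p → ThetaGeodesic n) (F : Edge n → ℝ) :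
    ∑ i ∈ Finset.Icc 1 (2 * p), (-1 : ℝ) ^ (i + 1) * F (ghostPolygon G i) = -edgeSum G F := by
  rw [← sum_Icc_ghostPolygon, ← Finset.sum_neg_distrib]
  exact Finset.sum_congr rfl fun i _ => by rw [pow_succ]; ring

variable {f : CutoffProfile} {x y : ℍ} {G : Fin p → ThetaGeodesic n} {H : Fin m → ThetaGeodesic n}

lemma ghostIntersection_projective (hK : ∀ a, K a = 1) (hC : ρ.HasComparableMetrics) (a : Fin n)
    (η : ArcForms f x G) (κ : ArcForms f y H) : ρ.ghostIntersection η κ =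
      ρ.correlation (List.ofFn G : Cycle (ThetaGeodesic n)) *
      ρ.correlation (List.ofFn H : Cycle (ThetaGeodesic n)) *
      edgeSum G fun θ => edgeSum H fun σ =>
        eps σ.ends θ.ends * tr (ρ.edgeProj a θ.ends * ρ.edgeProj a σ.ends) := by
  rw [ghostIntersection_eq]
  have h1 : ∀ θ : Edge n, (edgeSum H fun σ => eps σ.ends θ.ends *
      tr (ρ.listProj (σ.opp ++ θ.opp))) = ρ.correlation (List.ofFn H : Cycle (ThetaGeodesic n)) *
        edgeSum H fun σ => eps σ.ends θ.ends * tr (ρ.listProj θ.opp * ρ.edgeProj a σ.ends) := by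
    intro θ
    simp only [listProj_append]
    exact edgeSum_projective ρ hK hC H (fun e => eps e θ.ends) (fun x => eps_phantom_left x _)
      (trLin V ∘ₗ LinearMap.mulLeft ℝ (ρ.listProj θ.opp))
  have h2 : ∀ σ : Edge n, (edgeSum G fun θ => eps σ.ends θ.ends *
      tr (ρ.listProj θ.opp * ρ.edgeProj a σ.ends)) =
      ρ.correlation (List.ofFn G : Cycle (ThetaGeodesic n)) *
        edgeSum G fun θ => eps σ.ends θ.ends * tr (ρ.edgeProj a θ.ends * ρ.edgeProj a σ.ends) :=
    fun σ => edgeSum_projective ρ hK hC G (fun e => eps σ.ends e) (fun x => eps_phantom_right x _)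
      (trLin V ∘ₗ LinearMap.mulRight ℝ (ρ.edgeProj a σ.ends))
  have h3 : ∀ {q : ℕ} [NeZero q] (F : Fin q → ThetaGeodesic n) (c : ℝ) (b : Edge n → ℝ),
      (edgeSum F fun θ => c * b θ) = c * edgeSum F b := fun F c b => by
    simp only [edgeSum, Finset.mul_sum, mul_sub]
  simp only [h1, h3]
  rw [← edgeSum_comm]
  simp only [h2, h3]
  rw [edgeSum_comm]
  ring

lemma ghostIntersectionGeodesic_projective (hK : ∀ a, K a = 1) (hC : ρ.HasComparableMetrics)
    (a : Fin n) (η : ArcForms f x G) (h : ThetaGeodesic n) : ρ.ghostIntersectionGeodesic η h =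
      -(ρ.correlation (List.ofFn G : Cycle (ThetaGeodesic n)) *
        edgeSum G fun θ => eps h.geod.1 θ.ends *
          tr (ρ.edgeProj a θ.ends * ρ.edgeProj a h.geod.1)) := by
  rw [ghostIntersectionGeodesic_eq, edgeProj_geodesic, ← thetaProj_eq ρ (a := a) hK]
  simp only [listProj_cons]
  exact congrArg Neg.neg (edgeSum_projective ρ hK hC G (fun e => eps h.geod.1 e)
    (fun x => eps_phantom_right x _) (trLin V ∘ₗ LinearMap.mulRight ℝ (ρ.thetaProj h)))

/-- The minus sign of `ghostIntegral_eq` is absorbed by antisymmetry of `ε`, which puts the edges of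
`H` first as in the ghost intersection. -/
lemma ghostIntegral_ghostDualForm (η : ArcForms f x G) (κ : ArcForms f y H) {B : ℂ → V →L[ℝ] V}
    (hB : IsPrimitive B (ρ.ghostDualForm κ)) (t : Fin p → ℝ) :
    ρ.ghostIntegral G (ρ.ghostDualForm κ) B t = ρ.ghostIntersection η κ := by
  rw [ghostIntegral_eq ρ (isEdgeSum_ghostDualForm ρ κ) hB t, ghostIntersection_eq, ← edgeSum_neg]
  congr 1
  funext θ
  simp only [listProj_append, tr_mul_comm (ρ.listProj θ.opp)]
  rw [← Finset.sum_neg_distrib]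
  simp only [← neg_mul, ← eps_antisymm]
  exact sum_edges ρ H (fun e => eps e θ.ends)
    (trLin V ∘ₗ LinearMap.mulRight ℝ (ρ.listProj θ.opp))

lemma ghostIntegral_projectorForm (η : ArcForms f x G) (h : ThetaGeodesic n) {B : ℂ → V →L[ℝ] V}
    (hB : IsPrimitive B (ρ.projectorForm f h)) (t : Fin p → ℝ) :
    -ρ.ghostIntegral G (ρ.projectorForm f h) B t = ρ.ghostIntersectionGeodesic η h := by
  rw [ghostIntegral_eq ρ (isEdgeSum_projectorForm ρ f h) hB t, ghostIntersectionGeodesic_eq,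
    neg_neg, ← edgeSum_neg]
  congr 1
  funext θ
  rw [eps_antisymm, listProj_cons, tr_mul_comm]
  simp

lemma integral_line_ghostDualForm (η : ArcForms f x G) (h : ThetaGeodesic n) :
    (-∫ t, tr (ρ.ghostDualForm η (h.geod.point t) (h.geod.velocity t) * ρ.thetaProj h)) =
      ρ.ghostIntersectionGeodesic η h := by
  have h1 := (isEdgeSum_ghostDualForm ρ η).integral_line h.geod
    (trLin V ∘ₗ LinearMap.mulRight ℝ (ρ.thetaProj h))
  rw [sum_edges ρ G (fun e => eps h.geod.1 e)] at h1
  rw [ghostIntersectionGeodesic_eq]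
  simp only [listProj_cons]
  exact congrArg Neg.neg h1

end Projective

end Ghost

end

/-! ### The main theorem -/

theorem mainTheorem11 {V : Type*} [NormedAddCommGroup V] [NormedSpace ℝ V] [FiniteDimensional ℝ V]
    {n : ℕ} {K : Fin n → ℕ} (ρ : UniformlyHyperbolicBundle V K) (f : CutoffProfile)
    {p m : ℕ} [NeZero p] [NeZero m] (hp : 2 ≤ p) (hm : 2 ≤ m)
    (G : Fin p → ThetaGeodesic n) (H : Fin m → ThetaGeodesic n) (h : ThetaGeodesic n) (x y : ℍ) :
    -- the polygonal arc forms which enter the ghost dual forms exist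
    (Nonempty (ArcForms f x G) ∧ Nonempty (ArcForms f y H)) ∧
    -- and for every choice of them
    ∀ (η : ArcForms f x G) (κ : ArcForms f y H),
      -- the ghost intersection of two ghost polygons
      ((IntegrableOn (trWedge (ρ.ghostDualForm κ) (ρ.ghostDualForm η)) {z : ℂ | 0 < z.im} ∧
        LineIntegrable (ρ.ghostDualForm κ) ∧
        (∃ B, IsPrimitive B (ρ.ghostDualForm κ)) ∧
        (∀ B, IsPrimitive B (ρ.ghostDualForm κ) → ∀ t : Fin p → ℝ,
          ρ.ghostIntegral G (ρ.ghostDualForm κ) B t = ρ.ghostIntersection η κ)) ∧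
      ρ.ghostIntersection η κ = ρ.T (ghostBracket K (ofTuple hp G) (ofTuple hm H)) ∧
      ρ.ghostIntersection η κ =
        ∑ i ∈ Finset.Icc 1 (2 * p), ∑ j ∈ Finset.Icc 1 (2 * m), (-1 : ℝ) ^ (i + j) *
          eps (ghostPolygon H j).ends (ghostPolygon G i).ends *
          ρ.correlation
            (((ghostPolygon H j).opp ++ (ghostPolygon G i).opp : List (ThetaGeodesic n)) :
              Cycle (ThetaGeodesic n)) ∧
      ((∀ a, K a = 1) → ρ.HasComparableMetrics → ∀ a : Fin n,
        ρ.ghostIntersection η κ =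
          ρ.correlation (List.ofFn G : Cycle (ThetaGeodesic n)) *
          ρ.correlation (List.ofFn H : Cycle (ThetaGeodesic n)) *
          ∑ i ∈ Finset.Icc 1 (2 * p), ∑ j ∈ Finset.Icc 1 (2 * m), (-1 : ℝ) ^ (i + j) *
            eps (ghostPolygon H j).ends (ghostPolygon G i).ends *
            tr (ρ.edgeProj a (ghostPolygon G i).ends * ρ.edgeProj a (ghostPolygon H j).ends))) ∧
      -- the ghost intersection of a ghost polygon and a geodesic
      ((IntegrableOn (trWedge (ρ.projectorForm f h) (ρ.ghostDualForm η)) {z : ℂ | 0 < z.im} ∧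
        LineIntegrable (ρ.projectorForm f h) ∧
        LineIntegrable (ρ.ghostDualForm η) ∧
        (∃ B, IsPrimitive B (ρ.projectorForm f h)) ∧
        (∀ B, IsPrimitive B (ρ.projectorForm f h) → ∀ t : Fin p → ℝ,
          -ρ.ghostIntegral G (ρ.projectorForm f h) B t = ρ.ghostIntersectionGeodesic η h) ∧
        (-∫ t, tr (ρ.ghostDualForm η (h.geod.point t) (h.geod.velocity t) * ρ.thetaProj h)) =
          ρ.ghostIntersectionGeodesic η h) ∧
      ρ.ghostIntersectionGeodesic η h = ρ.T (ghostBracket K (ofTuple hp G) (ofGeodesic h)) ∧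
      -ρ.ghostIntersectionGeodesic η h = ρ.T (ghostBracket K (ofGeodesic h) (ofTuple hp G)) ∧
      ρ.ghostIntersectionGeodesic η h =
        ∑ i ∈ Finset.Icc 1 (2 * p), (-1 : ℝ) ^ (i + 1) *
          eps h.geod.1 (ghostPolygon G i).ends *
          ρ.correlation ((h :: (ghostPolygon G i).opp : List (ThetaGeodesic n)) :
            Cycle (ThetaGeodesic n)) ∧
      ((∀ a, K a = 1) → ρ.HasComparableMetrics → ∀ a : Fin n,
        ρ.ghostIntersectionGeodesic η h =
          ρ.correlation (List.ofFn G : Cycle (ThetaGeodesic n)) *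
          ∑ i ∈ Finset.Icc 1 (2 * p), (-1 : ℝ) ^ (i + 1) *
            eps h.geod.1 (ghostPolygon G i).ends *
            tr (ρ.edgeProj a (ghostPolygon G i).ends * ρ.edgeProj a h.geod.1))) := by
  refine ⟨⟨nonempty_arcForms f x G, nonempty_arcForms f y H⟩, fun η κ => ?_⟩
  have hη := isEdgeSum_ghostDualForm ρ η
  have hκ := isEdgeSum_ghostDualForm ρ κ
  have hh := isEdgeSum_projectorForm ρ f h
  refine ⟨⟨⟨(hκ.integral_trWedge hη).1, hκ.lineIntegrable, ?_,
      fun B hB t => ghostIntegral_ghostDualForm ρ η κ hB t⟩, ?_, ?_, fun hK hC a => ?_⟩,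
    ⟨(hh.integral_trWedge hη).1, hh.lineIntegrable, hη.lineIntegrable, ?_,
      fun B hB t => ghostIntegral_projectorForm ρ η h hB t, integral_line_ghostDualForm ρ η h⟩,
      ?_, ?_, ?_, fun hK hC a => ?_⟩
  · obtain ⟨φ, -, hφ, -⟩ := hκ.exists_primitive
    exact ⟨_, hφ⟩
  · rw [T_ghostBracket_polygons, ghostIntersection_eq]
  · rw [ghostIntersection_eq]
    simp only [mul_assoc]
    exact (sum_Icc_sum_Icc_ghostPolygon G H fun σ θ =>
      eps σ.ends θ.ends * tr (ρ.listProj (σ.opp ++ θ.opp))).symm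
  · rw [ghostIntersection_projective ρ hK hC a]
    simp only [mul_assoc]
    rw [sum_Icc_sum_Icc_ghostPolygon G H fun σ θ =>
      eps σ.ends θ.ends * tr (ρ.edgeProj a θ.ends * ρ.edgeProj a σ.ends)]
  · obtain ⟨φ, -, hφ, -⟩ := hh.exists_primitive
    exact ⟨_, hφ⟩
  · rw [T_ghostBracket_polygon_geodesic, ghostIntersectionGeodesic_eq]
  · rw [T_ghostBracket_geodesic_polygon, ghostIntersectionGeodesic_eq, neg_neg]
  · rw [ghostIntersectionGeodesic_eq]
    simp only [mul_assoc]
    exact (sum_Icc_succ_ghostPolygon G fun θ =>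
      eps h.geod.1 θ.ends * tr (ρ.listProj (h :: θ.opp))).symm
  · rw [ghostIntersectionGeodesic_projective ρ hK hC a]
    simp only [mul_assoc]
    rw [sum_Icc_succ_ghostPolygon G fun θ =>
      eps h.geod.1 θ.ends * tr (ρ.edgeProj a θ.ends * ρ.edgeProj a h.geod.1), mul_neg]
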